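/- **Setting.** A snake graph $\mathcal G=(G_1,\dots,G_d)$, $d\ge1$, is a sequence of unit square tiles in the plane such that $G_{i+1}$ is the east or the north neighbour of $G_i$; $e_i$ is the edge shared by $G_i$ and $G_{i+1}$ (these are the interior edges, all other edges are boundary edges), and $\mathcal G[i,j]$ is the subgraph with tiles $G_i,\dots,G_j$. A sign function $f$ gives each edge a sign such that on every tile the north and west edges have the same sign, the south and east edges have the same sign, and the north and south edges have opposite signs. $\operatorname{Match}\mathcal G$ is the set of perfect matchings of $\mathcal G$. A band graph $\mathcal G^b$ is obtained from a snake graph $\mathcal G$ by glueing the south or west edge $b$ of the first tile to the north or east edge $b'$ of the last tile with $f(b')=f(b)$, the southwest vertex of the first tile being identified with the end point of $b'$ that is not the northeast vertex of the last tile; its interior edges are those of $\mathcal G$ and $b=b'$. $\operatorname{Match}$ of a band graph is the set of its good perfect matchings $P$, i.e. those for which $P\sqcup\{e\}$ is a perfect matching of the snake graph obtained by cutting along $e$, for some interior edge $e$. Let $\mathcal G_1=(G_1,\dots,G_d)$ be a snake graph with sign function $f$ and with a self-overlap $\mathcal G_1[s,t]\cong\mathcal G_1[s',t']$ in the same direction,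 where $1\le s<s'<t$, $t'\le d$: there is a lattice motion (a translation, or the reflection in the diagonal followed by a translation) which maps $G_i$ to $G_{i+p}$ for $s\le i\le t$, $p:=s'-s=t'-t$, and which is maximal, i.e. it does not also map $G_{s-1}$ to $G_{s'-1}$ (if $s>1$) or $G_{t+1}$ to $G_{t'+1}$ (if $t'<d$). Suppose that it is a self-crossing: if $s>1$ or $t'<d$ then $f(e_{s-1})=-f(e_t)$ with $s>1$, or $f(e_{s'-1})=-f(e_{t'})$ with $t'<d$; moreover $f(e_t)=f(e_{s'-1})$; and if $s=1$ and $t'=d$, then the two copies of the overlap carry the same signs, $f(e_{s'})=f(e_s)$ (in all other cases this is automatic). Let $$\mathcal G_3=\mathcal G_1[1,t]\cup\mathcal G_1[t'+1,d],\qquad \mathcal G_4^\circ=\mathcal G_1[s,s'-1]\text{ glued along } b=e_{s'-1},\qquad \mathcal G_{56}=\mathcal G_1[1,s-1]\cup\mathcal G_1[s',t]\cup\mathcal G_1[t'+1,d],$$ with adjacencies induced by the overlap: the sequences of signs of the interior edges of $\mathcal G_3$ and $\mathcal G_{56}$ are $f(e_1),\dots,f(e_{t-1}),f(e_{t'}),\dots,f(e_{d-1})$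 and $f(e_1),\dots,f(e_{s-1}),f(e_{s'}),\dots,f(e_{t-1}),f(e_{t'}),\dots,f(e_{d-1})$. Let $a$ be the south or west edge of $G_s$ of sign $-f(e_{s'-1})$ (so $a=e_{s-1}$ if $s>1$), and $\tilde a$ its copy at $G_{s'}$. For $s-1\le k\le s'-1$ let $W_k=\mathcal G_1[k+1,k+p]$; its end edges are $e_{k+p}$ and the south or west edge of $G_{k+1}$ of the same sign; glueing them turns $W_k$ into $\mathcal G_4^\circ$, and replacing $W_k$ in $\mathcal G_1$ by one copy of this edge gives $\mathcal G_3$. **The map $\varphi$ on $P\in\operatorname{Match}\mathcal G_1$.** Let $k\in\{s-1,\dots,s'-1\}$ be minimal such that $P$ contains an end edge $e$ of $W_k$ and the end points of the other end edge $e'$ are both matched in $P$ by edges of $W_k$, or both by edges outside $W_k$. Put $S=(P\cap W_k)\setminus\{e\}$ in the first case and $S=P\cap W_k$ in the second. If there is no such $k$, put $k=s-1$ and let $S$ consist of the edges of $P$ on $\mathcal G_1[s,s'-1]$ and, if $a\notin P$, of $\tilde a$. Then $\varphi(P)=(\varphi_3(P),\varphi_4(P))$, where $\varphi_4(P)$ is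 the set of edges of $\mathcal G_4^\circ$ induced by $S$ and $\varphi_3(P)$ is the set of edges of $\mathcal G_3$ induced by $P\setminus S$ on removing $W_k$. **The map $\varphi$ on $P\in\operatorname{Match}\mathcal G_{56}$.** Put the edges of $P$ on $G_1,\dots,G_{s-1}$ (including $a$, if $s>1$ and $a\in P$) and the other edges of $P$ on the corresponding tiles of $\mathcal G_3$; add the edge $a$ if its end points are not matched by the edges on $G_1,\dots,G_{s-1}$; and let $\varphi_3(P)$ be the unique completion to a perfect matching of $\mathcal G_3$ by boundary edges of $\mathcal G_3$. Let $\varphi_4(P)$ be the set of those boundary edges of $\mathcal G_4^\circ$ which do not come from an edge that was added to $P$ in this process. **The map $\psi$ on $(P_3,P_4)\in\operatorname{Match}\mathcal G_3\times\operatorname{Match}\mathcal G_4^\circ$.** Let $k\in\{s-1,\dots,s'-1\}$ be minimal, where $k=s'-1$ is admitted only if $a\notin P_3$, such that $P_4$ on $W_k$ (where, for $k=s-1$, the edge $a$ of $P_4$ may be put on $\tilde a$ instead of $a$) and $P_3$ on the rest of $\mathcal G_1$ form a perfect matching of $\mathcal G_1$; each edge of $P_3$ and of $P_4$ is used once, on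 one of its copies. Then $\psi(P_3,P_4)$ is this perfect matching. If there is no such $k$, then $\psi(P_3,P_4)=P_3|_{\mathcal G_{56}}\in\operatorname{Match}\mathcal G_{56}$, the set of edges of $\mathcal G_{56}$ all of whose copies in $\mathcal G_3$ lie in $P_3$. **Theorem.** The map $$\varphi:\operatorname{Match}\mathcal G_1\sqcup\operatorname{Match}\mathcal G_{56}\longrightarrow\operatorname{Match}\mathcal G_3\times\operatorname{Match}\mathcal G_4^\circ$$ is a (well-defined) bijection with inverse $\psi$. Moreover, for $(P_3,P_4)\in\operatorname{Match}\mathcal G_3\times\operatorname{Match}\mathcal G_4^\circ$, a position $k$ as in the definition of $\psi$ exists if and only if $(P_3,P_4)$ is not of the form $\varphi(P)$ with $P\in\operatorname{Match}\mathcal G_{56}$. -/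

import Mathlib

namespace SnakeCalculus

/-! ### Perfect matchings of a multigraph -/

/-- The multigraph with vertex set `V`, edge set `E` and end points `ends e` of the edges. -/
def graphOfEnds {α β : Type} (V : Set α) (E : Set β) (ends : β → Sym2 α)
    (h : ∀ e ∈ E, ∀ v ∈ ends e, v ∈ V) : Graph α β where
  vertexSet := V
  edgeSet := E
  IsLink e x y := e ∈ E ∧ ends e = s(x, y)
  isLink_symm := fun e _ => ⟨fun x y hxy => ⟨hxy.1, hxy.2.trans Sym2.eq_swap⟩⟩
  eq_or_eq_of_isLink_of_isLink := by
    rintro e x y v w ⟨-, h1⟩ ⟨-, h2⟩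
    rcases Sym2.eq_iff.1 (h1.symm.trans h2) with h | h
    · exact Or.inl h.1
    · exact Or.inr h.1
  edge_mem_iff_exists_isLink := fun e => by
    constructor
    · intro he
      induction hs : ends e using Sym2.ind with
      | _ x y => exact ⟨x, y, he, rfl⟩
    · rintro ⟨x, y, he, -⟩
      exact he
  left_mem_of_isLink := fun e x y hxy => h e hxy.1 x (by rw [hxy.2]; exact Sym2.mem_mk_left x y)

/-- A set `P` of edges such that every vertex is incident to exactly one edge of `P`. -/
def IsPerfectMatching {α β : Type} (Γ : Graph α β) (P : Set β) : Prop :=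
  P ⊆ Γ.edgeSet ∧ ∀ v ∈ Γ.vertexSet, ∃! e, e ∈ P ∧ Γ.Inc e v

/-! ### Tiles, their edges and signs

Everything takes place in the integer lattice. The tile with southwest corner `q` is the unit
square with corners `q`, `q + (1,0)`, `q + (0,1)`, `q + (1,1)`. -/

inductive Dir where
  | east
  | north

def Dir.vec : Dir → ℤ × ℤ
  | .east => (1, 0)
  | .north => (0, 1)

/-- The unit segment from the lattice point `base` to `base + dir.vec`. -/
abbrev Edge : Type := (ℤ × ℤ) × Dir

def Edge.base (e : Edge) : ℤ × ℤ := e.1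

def Edge.tip (e : Edge) : ℤ × ℤ := e.1 + e.2.vec

def Edge.ends (e : Edge) : Sym2 (ℤ × ℤ) := s(e.base, e.tip)

def southEdge (q : ℤ × ℤ) : Edge := (q, .east)
def westEdge (q : ℤ × ℤ) : Edge := (q, .north)
def northEdge (q : ℤ × ℤ) : Edge := (q + (0, 1), .east)
def eastEdge (q : ℤ × ℤ) : Edge := (q + (1, 0), .north)

def tileEdges (q : ℤ × ℤ) : Set Edge := {southEdge q, westEdge q, northEdge q, eastEdge q}

/-- A sign function, given on all lattice edges at once. A snake graph has exactly two sign
functions: the restriction of this one, and its negative. -/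
def sign (e : Edge) : ℤˣ :=
  match e.2 with
  | .east => (e.1.1 + e.1.2).negOnePow
  | .north => -(e.1.1 + e.1.2).negOnePow

/-- On every tile the north and west edges have the same sign, the south and east edges have the
same sign, and the north and south edges have opposite signs. -/
theorem sign_isSignFunction (q : ℤ × ℤ) :
    sign (northEdge q) = sign (westEdge q) ∧ sign (southEdge q) = sign (eastEdge q) ∧
      sign (northEdge q) = -sign (southEdge q) := by
  have h1 : q.1 + (q.2 + 1) = (q.1 + q.2) + 1 := by ring
  have h2 : q.1 + 1 + q.2 = (q.1 + q.2) + 1 := by ring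
  simp [sign, northEdge, westEdge, southEdge, eastEdge, h1, h2, Int.negOnePow_succ]

/-- One of the two pairs of edges of a tile: south and west, or north and east. -/
inductive Corner where
  | sw
  | ne

/-- The two south/west edges of a tile have opposite signs, and so do the two north/east edges.
Hence every edge of the tile is determined by its pair and its sign. -/
def sideOfSign (q : ℤ × ℤ) : Corner → ℤˣ → Edge
  | .sw, σ => if sign (southEdge q) = σ then southEdge q else westEdge q
  | .ne, σ => if sign (northEdge q) = σ then northEdge q else eastEdge q

theorem sign_sideOfSign (q : ℤ × ℤ) (c : Corner) (σ : ℤˣ) : sign (sideOfSign q c σ) = σ := by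
  obtain ⟨h1, h2, h3⟩ := sign_isSignFunction q
  cases c
  · by_cases h : sign (southEdge q) = σ
    · simp [sideOfSign, h]
    · have h' := Int.units_ne_iff_eq_neg.1 h
      simp only [sideOfSign, if_neg h]
      rw [← h1, h3, h', neg_neg]
  · by_cases h : sign (northEdge q) = σ
    · simp [sideOfSign, h]
    · have h' := Int.units_ne_iff_eq_neg.1 h
      simp only [sideOfSign, if_neg h]
      rw [← h2, ← neg_neg (sign (southEdge q)), ← h3, h', neg_neg]

/-! ### Snake graphs -/

/-- A snake graph with tiles `G_1, …, G_d`: the tile `G_{i+1}` is the neighbour of `G_i` in the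
direction `step i`, for `1 ≤ i < d`; the other values of `step` play no role.
(Snake graphs are considered up to translation, so `G_1` is placed at the origin.) -/
structure SnakeGraph where
  d : ℕ
  one_le_d : 1 ≤ d
  step : ℕ → Dir

namespace SnakeGraph

variable (G : SnakeGraph)

/-- The southwest corner of the tile `G_i`, for `1 ≤ i ≤ d`. -/
def tile (i : ℕ) : ℤ × ℤ := ∑ j ∈ Finset.Ico 1 i, (G.step j).vec

/-- The edges of the subgraph `G[i,j]`, which is empty if `j < i`. -/
def edgesOn (i j : ℕ) : Set Edge := {e | ∃ k, i ≤ k ∧ k ≤ j ∧ e ∈ tileEdges (G.tile k)}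

/-- The underlying graph. -/
def graph : Graph (ℤ × ℤ) Edge :=
  graphOfEnds {v | ∃ e ∈ G.edgesOn 1 G.d, v ∈ e.ends} (G.edgesOn 1 G.d) Edge.ends
    (fun e he _ hv => ⟨e, he, hv⟩)

/-- The set `Match G`. -/
def matchings : Set (Set Edge) := {P | IsPerfectMatching G.graph P}

/-- The interior edge `e_i` shared by `G_i` and `G_{i+1}`, for `1 ≤ i < d`. -/
def interiorEdge (i : ℕ) : Edge :=
  match G.step i with
  | .north => northEdge (G.tile i)
  | .east => eastEdge (G.tile i)

/-- The sign of `e_i`. -/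
def sgn (i : ℕ) : ℤˣ := sign (G.interiorEdge i)

def boundaryEdges : Set Edge :=
  G.edgesOn 1 G.d \ {e | ∃ i, 1 ≤ i ∧ i < G.d ∧ e = G.interiorEdge i}

/-- The south/west or north/east edge of sign `σ` of the tile `G_i`. In particular
`e_i = G.edge i .ne (G.sgn i) = G.edge (i + 1) .sw (G.sgn i)`. -/
def edge (i : ℕ) (c : Corner) (σ : ℤˣ) : Edge := sideOfSign (G.tile i) c σ

/-- The snake graph with `d` tiles whose interior edges `e_1, …, e_{d-1}` have the signs
`a 1, …, a (d-1)`. A snake graph with a sign function is determined by these signs up to an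
isomorphism preserving the order of the tiles, the two corners of each tile and the signs. -/
def ofSigns (d : ℕ) (hd : 1 ≤ d) (a : ℕ → ℤˣ) : SnakeGraph where
  d := d
  one_le_d := hd
  step i := if a i = (i : ℤ).negOnePow then .north else .east

theorem tile_succ (i : ℕ) (hi : 1 ≤ i) : G.tile (i + 1) = G.tile i + (G.step i).vec := by
  simp [tile, Finset.sum_Ico_succ_top hi]

theorem tile_sum (i : ℕ) (hi : 1 ≤ i) : (G.tile i).1 + (G.tile i).2 + 1 = i := by
  induction i, hi using Nat.le_induction with
  | base => simp [tile]
  | succ n hn ih =>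
    rw [G.tile_succ n hn]
    cases G.step n <;> simp [Dir.vec] <;> omega

theorem sgn_eq (i : ℕ) (hi : 1 ≤ i) :
    G.sgn i = match G.step i with
      | .north => (i : ℤ).negOnePow
      | .east => -(i : ℤ).negOnePow := by
  have h := G.tile_sum i hi
  have h1 : (G.tile i).1 + ((G.tile i).2 + 1) = i := by omega
  have h2 : (G.tile i).1 + 1 + (G.tile i).2 = i := by omega
  unfold sgn interiorEdge
  cases G.step i <;> simp [sign, northEdge, eastEdge, h1, h2]

theorem sgn_ofSigns (d : ℕ) (hd : 1 ≤ d) (a : ℕ → ℤˣ) (i : ℕ) (hi : 1 ≤ i) :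
    (ofSigns d hd a).sgn i = a i := by
  rw [sgn_eq _ i hi]
  by_cases h : a i = (i : ℤ).negOnePow
  · simp [ofSigns, h]
  · simp [ofSigns, Int.units_ne_iff_eq_neg.1 h]

end SnakeGraph

/-! ### Band graphs -/

/-- The band graph with tiles `G_1, …, G_p`, arranged cyclically, obtained from a snake graph by
glueing a south/west edge `b` of `G_1` to the north/east edge `b'` of `G_p` of the same sign.
`sgn i`, for `1 ≤ i < p`, is the sign of the interior edge `e_i` between `G_i` and `G_{i+1}`, and
`sgn 0` is the sign of the glueing edge `e_0 = b = b'`. -/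
structure BandGraph where
  p : ℕ
  one_le_p : 1 ≤ p
  sgn : ℕ → ℤˣ

namespace BandGraph

variable (B : BandGraph)

/-- The snake graph `(G_{k+1}, …, G_p, G_1, …, G_k)` obtained by cutting the band graph along its
interior edge `e_k`, for `0 ≤ k < p`. -/
def cut (k : ℕ) : SnakeGraph := SnakeGraph.ofSigns B.p B.one_le_p fun i => B.sgn ((k + i) % B.p)

/-- The glueing edge `b` of the first tile of the snake graph `B.cut 0`. -/
def glueFirst : Edge := (B.cut 0).edge 1 .sw (B.sgn 0)

/-- The glueing edge `b'` of the last tile of the snake graph `B.cut 0`. -/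
def glueLast : Edge := (B.cut 0).edge B.p .ne (B.sgn 0)

/-- The southwest vertex of the first tile is identified with the end point of `b'` which is not the
northeast vertex of the last tile, and this northeast vertex with the other end point of `b`. -/
def VertexRel (u v : ℤ × ℤ) : Prop :=
  (u = B.glueFirst.base ∧ v = B.glueLast.base) ∨ (u = B.glueFirst.tip ∧ v = B.glueLast.tip)

/-- The edge `b` is identified with the edge `b'`. -/
def EdgeRel (e f : Edge) : Prop := e = B.glueFirst ∧ f = B.glueLast

/-- The type of vertices of the band graph: lattice points after the identification. -/
abbrev Vert : Type := Quot B.VertexRel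

/-- The type of edges of the band graph: lattice edges after the identification. -/
abbrev BEdge : Type := Quot B.EdgeRel

def ends : B.BEdge → Sym2 B.Vert :=
  Quot.lift (fun e => Sym2.map (Quot.mk B.VertexRel) e.ends) (by
    rintro e f ⟨rfl, rfl⟩
    have h1 : Quot.mk B.VertexRel B.glueFirst.base = Quot.mk B.VertexRel B.glueLast.base :=
      Quot.sound (Or.inl ⟨rfl, rfl⟩)
    have h2 : Quot.mk B.VertexRel B.glueFirst.tip = Quot.mk B.VertexRel B.glueLast.tip :=
      Quot.sound (Or.inr ⟨rfl, rfl⟩)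
    simp only [Edge.ends, Sym2.map_mk, h1, h2])

/-- The underlying graph of the band graph. -/
def graph : Graph B.Vert B.BEdge :=
  graphOfEnds (Quot.mk _ '' (B.cut 0).graph.vertexSet) (Quot.mk _ '' (B.cut 0).graph.edgeSet)
    B.ends (by
      rintro _ ⟨e, he, rfl⟩ v hv
      obtain ⟨u, hu, rfl⟩ := Sym2.mem_map.1 hv
      exact ⟨u, ⟨e, he, hu⟩, rfl⟩)

/-- The south/west or north/east edge of sign `σ` of the tile `G_{m+1}`, with `m` modulo `p`. -/
def edge (m : ℕ) (c : Corner) (σ : ℤˣ) : B.BEdge :=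
  Quot.mk _ ((B.cut 0).edge (m % B.p + 1) c σ)

/-- The interior edge `e_k`, for `0 ≤ k < p`. -/
def interiorEdge (k : ℕ) : B.BEdge := B.edge k .sw (B.sgn k)

def boundaryEdges : Set B.BEdge :=
  B.graph.edgeSet \ {x | ∃ k, k < B.p ∧ x = B.interiorEdge k}

/-- The edges of the band graph which come from a set of edges of the snake graph `B.cut k`. -/
def ofCut (k : ℕ) (Q : Set Edge) : Set B.BEdge :=
  {x | ∃ i c σ, i < B.p ∧ (B.cut k).edge (i + 1) c σ ∈ Q ∧ x = B.edge (k + i) c σ}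

/-- A perfect matching `P` is good if, for some interior edge `e_k`, adding to `P` one of the two
copies `e₀` of `e_k` at the ends of the snake graph `B.cut k` gives a perfect matching `Q` of
that snake graph. -/
def IsGood (P : Set B.BEdge) : Prop :=
  IsPerfectMatching B.graph P ∧ ∃ k, k < B.p ∧ ∃ Q ∈ (B.cut k).matchings, ∃ e₀ ∈ Q,
    (e₀ = (B.cut k).edge 1 .sw (B.sgn k) ∨ e₀ = (B.cut k).edge B.p .ne (B.sgn k)) ∧
      P = B.ofCut k (Q \ {e₀})

/-- The set of good perfect matchings of the band graph. -/
def matchings : Set (Set B.BEdge) := {P | B.IsGood P}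

end BandGraph

/-! ### Self-crossings with overlap in the same direction and `s' < t` -/

/-- The lattice motions preserving the southwest-northeast orientation: the translation by `v`, or
the reflection in the diagonal followed by it. -/
def motion (r : Bool) (v q : ℤ × ℤ) : ℤ × ℤ := v + if r then q.swap else q

/-- A snake graph `G` with a self-overlap `G[s,t] ≅ G[s',t']`, `t' = t + (s' - s)`, in the same
direction, with `s < s' < t`, which is a self-crossing. The isomorphism is the restriction of the
lattice motion given by `r` and `v`, it maps `G_i` to `G_{i+s'-s}`, and it does not extend. -/
structure SelfCrossing where
  G : SnakeGraph
  s : ℕ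
  s' : ℕ
  t : ℕ
  one_le_s : 1 ≤ s
  s_lt_s' : s < s'
  s'_lt_t : s' < t
  t'_le_d : t + (s' - s) ≤ G.d
  r : Bool
  v : ℤ × ℤ
  overlap : ∀ i, s ≤ i → i ≤ t → G.tile (i + (s' - s)) = motion r v (G.tile i)
  maximal_left : ¬(1 < s ∧ G.tile (s' - 1) = motion r v (G.tile (s - 1)))
  maximal_right : ¬(t + (s' - s) < G.d ∧ G.tile (t + (s' - s) + 1) = motion r v (G.tile (t + 1)))
  /-- The first crossing condition; it is void if `s = 1` and `t' = d`. -/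
  crossing_ends : 1 < s ∨ t + (s' - s) < G.d →
    (1 < s ∧ G.sgn (s - 1) = -G.sgn t) ∨
      (t + (s' - s) < G.d ∧ G.sgn (s' - 1) = -G.sgn (t + (s' - s)))
  /-- The second crossing condition. -/
  crossing_mid : G.sgn t = G.sgn (s' - 1)
  /-- If the overlap reaches both ends of `G`, then its two copies carry the same sign function.
  In all other cases this follows from maximality and the crossing conditions. -/
  sign_compatible : s = 1 → t + (s' - s) = G.d → G.sgn s' = G.sgn s

namespace SelfCrossing

variable (X : SelfCrossing)

/-- The number `s' - s` of tiles by which the two copies of the overlap differ. -/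
def p : ℕ := X.s' - X.s

theorem p_eq : X.s' = X.s + X.p ∧ 1 ≤ X.p ∧ X.s + 2 * X.p < X.G.d := by
  have h1 := X.s_lt_s'
  have h2 := X.s'_lt_t
  have h3 := X.t'_le_d
  unfold p
  omega

/-- `G[1,t] ∪ G[t'+1,d]`, where `G_{t'+1}` is attached to `G_t` in the way it is attached to
`G_{t'}` in `G`. -/
def G3 : SnakeGraph :=
  SnakeGraph.ofSigns (X.G.d - X.p) (by have := X.p_eq; omega) fun i =>
    if i < X.t then X.G.sgn i else X.G.sgn (i + X.p)

/-- The band graph obtained from `G[s,s'-1]` by glueing along `b = e_{s'-1}`. -/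
def G4 : BandGraph where
  p := X.p
  one_le_p := X.p_eq.2.1
  sgn i := if i = 0 then X.G.sgn (X.s' - 1) else X.G.sgn (X.s - 1 + i)

/-- `G[1,s-1] ∪ G[s',t] ∪ G[t'+1,d]`, where `G_{s-1}` is attached to `G_{s'}` in the way it is
attached to `G_s` in `G`, and `G_{t'+1}` to `G_t` in the way it is attached to `G_{t'}`. -/
def G56 : SnakeGraph :=
  SnakeGraph.ofSigns (X.G.d - 2 * X.p) (by have := X.p_eq; omega) fun i =>
    if i < X.s then X.G.sgn i
    else if i < X.t - X.p then X.G.sgn (i + X.p) else X.G.sgn (i + 2 * X.p)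

/-! For `s - 1 ≤ k ≤ s' - 1` the subgraph `G[k+1,k+p]` of `G[s,2s'-s-1]` becomes the band graph
`G4` when its two end edges `endL k` and `endR k` are glued. Replacing it in `G` by a single copy
of this edge turns `G` into `G3`. -/

/-- The south/west edge of `G_{k+1}` glued to `endR k`. It is the interior edge `e_k` if `s ≤ k`,
and a boundary edge of `G_s` if `k = s - 1`. -/
def endL (k : ℕ) : Edge := X.G.edge (k + 1) .sw (X.G.sgn (k + X.p))

/-- The interior edge `e_{k+p}`, a north/east edge of `G_{k+p}`. -/
def endR (k : ℕ) : Edge := X.G.interiorEdge (k + X.p)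

def IsWindow (k : ℕ) : Prop := X.s ≤ k + 1 ∧ k + 1 ≤ X.s'

/-- The edges of `G[k+1,k+p]`. -/
def window (k : ℕ) : Set Edge := X.G.edgesOn (k + 1) (k + X.p)

/-- The sign of the south/west edge of `G_s` which is not glued in `G4`. For `s > 1` this edge is
`e_{s-1}`. -/
def aSign : ℤˣ := -X.G.sgn (X.s' - 1)

/-- The south/west edge `a` of `G_s` which is not glued in `G4`. -/
def a : Edge := X.G.edge X.s .sw X.aSign

/-- The copy of `a` at the tile `G_{s'}`; it is a boundary edge of `G`. -/
def aCopy : Edge := X.G.edge X.s' .sw X.aSign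

/-- The edge `a`, as an edge of `G3`. -/
def a3 : Edge := X.G3.edge X.s .sw X.aSign

/-- The edges of `G3` corresponding to a set `A` of edges of `G`, when `G3` is formed from
`G[1,k]` and `G[k+p+1,d]`, with the end edges of `G[k+1,k+p]` glued to each other. -/
def toG3 (k : ℕ) (A : Set Edge) : Set Edge :=
  {e | ∃ i c σ, 1 ≤ i ∧ i ≤ X.G.d ∧ X.G.edge i c σ ∈ A ∧
    (((i ≤ k ∨ (i = k + 1 ∧ c = .sw)) ∧ e = X.G3.edge i c σ) ∨
      (k + X.p < i ∧ e = X.G3.edge (i - X.p) c σ))}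

/-- The edges of `G4` corresponding to a set `S` of edges of `G[s,2s'-s-1]`; this subgraph winds
twice around `G4`. -/
def toG4 (S : Set Edge) : Set X.G4.BEdge :=
  {x | ∃ i c σ, X.s ≤ i ∧ i < X.s' + X.p ∧ X.G.edge i c σ ∈ S ∧ x = X.G4.edge (i - X.s) c σ}

/-! ### The map on `Match G` -/

/-- The end points of `e` are matched in `P` by edges belonging to `W`. -/
def MatchedBy (P W : Set Edge) (e : Edge) : Prop := ∀ u ∈ e.ends, ∃ f ∈ P, f ∈ W ∧ u ∈ f.ends

/-- `P` contains `e`, and the end points of the opposite end edge `e'` of `G[k+1,k+p]` are both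
matched by edges in this subgraph, or both by edges outside of it. -/
def Suitable (P : Set Edge) (k : ℕ) (e e' : Edge) : Prop :=
  e ∈ P ∧ (MatchedBy P (X.window k) e' ∨ MatchedBy P (X.window k)ᶜ e')

/-- The positions at which `P` can be cut. -/
def cutPositions (P : Set Edge) : Set ℕ :=
  {k | X.IsWindow k ∧ (X.Suitable P k (X.endL k) (X.endR k) ∨
    X.Suitable P k (X.endR k) (X.endL k))}

open Classical in
/-- The restriction of `P` to `G[k+1,k+p]` if the end points of `e'` are matched outside of this
subgraph; otherwise this restriction without `e`. -/
noncomputable def cutPart (P : Set Edge) (k : ℕ) (e e' : Edge) : Set Edge :=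
  if MatchedBy P (X.window k) e' then (P ∩ X.window k) \ {e} else P ∩ X.window k

open Classical in
/-- The first `s' - s` edges of `P` from the tile `G_s` on, for a matching without cut position:
those on `G[s,s'-1]` and, if `a` is not in `P`, the copy of `a` at `G_{s'}`. -/
noncomputable def boundaryPart (P : Set Edge) : Set Edge :=
  if X.a ∈ P then P ∩ X.G.edgesOn X.s (X.s' - 1)
  else P ∩ (X.G.edgesOn X.s (X.s' - 1) ∪ {X.aCopy})

open Classical in
/-- The position at which `P` is cut: the first possible one. -/
noncomputable def cutPos (P : Set Edge) : ℕ :=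
  if (X.cutPositions P).Nonempty then sInf (X.cutPositions P) else X.s - 1

open Classical in
/-- The subset of `P` which becomes the matching of `G4`. -/
noncomputable def part4 (P : Set Edge) : Set Edge :=
  if (X.cutPositions P).Nonempty then
    if X.Suitable P (X.cutPos P) (X.endL (X.cutPos P)) (X.endR (X.cutPos P)) then
      X.cutPart P (X.cutPos P) (X.endL (X.cutPos P)) (X.endR (X.cutPos P))
    else X.cutPart P (X.cutPos P) (X.endR (X.cutPos P)) (X.endL (X.cutPos P))
  else X.boundaryPart P

/-- The map on `Match G`. -/
noncomputable def phi1 (P : Set Edge) : Set Edge × Set X.G4.BEdge :=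
  (X.toG3 (X.cutPos P) (P \ X.part4 P), X.toG4 (X.part4 P))

/-! ### The map on `Match G56` -/

/-- The edges of `P` on the tiles `G_1, …, G_{s-1}`, as edges of `G3`. -/
def left56 (P : Set Edge) : Set Edge :=
  {e | ∃ i c σ, 1 ≤ i ∧ i < X.s ∧ X.G56.edge i c σ ∈ P ∧ e = X.G3.edge i c σ}

/-- The edges of `P` on the other tiles, as edges of `G3`. The interior edge `a` between `G_{s-1}`
and `G_{s'}`, which exists if `s > 1`, is regarded as an edge of `G_{s-1}` only. -/
def right56 (P : Set Edge) : Set Edge :=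
  {e | ∃ i c σ, X.s ≤ i ∧ i ≤ X.G56.d ∧ X.G56.edge i c σ ∈ P ∧
    ¬(1 < X.s ∧ i = X.s ∧ c = .sw ∧ σ = X.aSign) ∧ e = X.G3.edge (i + X.p) c σ}

open Classical in
/-- The part of the matching of `G3` which is prescribed by `P`: the edges of `P`, and the edge `a`
if its end points are not matched by the edges of `P` on `G_1, …, G_{s-1}`. -/
noncomputable def base56 (P : Set Edge) : Set Edge :=
  if ∀ u ∈ X.a3.ends, ∀ f ∈ X.left56 P, u ∉ f.ends then
    X.left56 P ∪ X.right56 P ∪ {X.a3}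
  else X.left56 P ∪ X.right56 P

/-- `R` is a perfect matching of `G3` that arises from `Q` by adding boundary edges of `G3`. -/
def IsCompletion (Q R : Set Edge) : Prop :=
  R ∈ X.G3.matchings ∧ Q ⊆ R ∧ R \ Q ⊆ X.G3.boundaryEdges

open Classical in
/-- The unique completion of `Q` by boundary edges (by convention `∅`, which is not a perfect
matching, if there is no unique completion). -/
noncomputable def completion (Q : Set Edge) : Set Edge :=
  if h : ∃! R, X.IsCompletion Q R then h.exists.choose else ∅

/-- The edges used for the completion, including `a` if it was added. -/
noncomputable def added (P : Set Edge) : Set Edge :=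
  X.completion (X.base56 P) \ (X.left56 P ∪ X.right56 P)

/-- The boundary edges of `G4` which are not used for the completion. -/
noncomputable def unused4 (P : Set Edge) : Set X.G4.BEdge :=
  {x | x ∈ X.G4.boundaryEdges ∧ ∀ i c σ, X.s ≤ i → i ≤ X.s' → X.G3.edge i c σ ∈ X.added P →
    x ≠ X.G4.edge (i - X.s) c σ}

/-- The map on `Match G56`. -/
noncomputable def phi56 (P : Set Edge) : Set Edge × Set X.G4.BEdge :=
  (X.completion (X.base56 P), X.unused4 P)

/-! ### The maps `φ` and `ψ` -/

/-- `Match G ⊔ Match G56`. -/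
def source : Set (Set Edge ⊕ Set Edge) := Sum.inl '' X.G.matchings ∪ Sum.inr '' X.G56.matchings

/-- `Match G3 × Match G4`. -/
def target : Set (Set Edge × Set X.G4.BEdge) := X.G3.matchings ×ˢ X.G4.matchings

noncomputable def phi : Set Edge ⊕ Set Edge → Set Edge × Set X.G4.BEdge :=
  Sum.elim X.phi1 X.phi56

/-- `P` is a perfect matching of `G` which is `Q.2` on `G[k+1,k+p]` (the set `S` of edges) and
`Q.1` on the rest of `G`. If `k = s - 1`, then the edge `a` of `Q.2` may be put on either of the
two copies of `a` at the ends of `G[s,s'-1]`. -/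
def IsSplice (k : ℕ) (Q : Set Edge × Set X.G4.BEdge) (P : Set Edge) : Prop :=
  P ∈ X.G.matchings ∧ ∃ S ⊆ P,
    S ⊆ X.window k ∪ {e | k + 1 = X.s ∧ e = X.aCopy} ∧
    P \ S ⊆ X.G.edgesOn 1 k ∪ {X.endL k} ∪ X.G.edgesOn (k + X.p + 1) X.G.d ∧
    X.toG3 k (P \ S) = Q.1 ∧ X.toG4 S = Q.2

/-- The positions `k` at which `Q.1` and `Q.2` can be spliced. The last one, `k = s' - 1`, is only
admitted if `a` is not in `Q.1`. -/
def splicePositions (Q : Set Edge × Set X.G4.BEdge) : Set ℕ :=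
  {k | X.IsWindow k ∧ (k + 1 = X.s' → X.a3 ∉ Q.1) ∧ ∃ P, X.IsSplice k Q P}

/-- The restriction to `G56` of a matching of `G3`: those edges of `G56` all of whose copies in
`G3` belong to it. (All edges have a single copy except, for `s > 1`, the interior edge `a`
between `G_{s-1}` and `G_{s'}`, which has one copy at each of these two tiles.) -/
def restrict56 (P : Set Edge) : Set Edge :=
  {e | e ∈ X.G56.graph.edgeSet ∧ ∀ i c σ, 1 ≤ i → i ≤ X.G56.d → e = X.G56.edge i c σ →
    if i < X.s then X.G3.edge i c σ ∈ P else X.G3.edge (i + X.p) c σ ∈ P}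

open Classical in
noncomputable def psi (Q : Set Edge × Set X.G4.BEdge) : Set Edge ⊕ Set Edge :=
  if (X.splicePositions Q).Nonempty then
    Sum.inl (Classical.epsilon (X.IsSplice (sInf (X.splicePositions Q)) Q))
  else Sum.inr (X.restrict56 Q.1)

end SelfCrossing

end SnakeCalculus

/-! ### Corners and edges of tiles, described by signs -/

namespace SnakeCalculus

/-! A perfect matching of a snake graph is recorded by one sign per tile. Tile i chooses two
opposite edges, the south/west one of sign `m i` and the north/east one of sign `-m i`, and an edge
lies in the matching when every tile containing it chooses it. The only constraint sits at the
interior edges. If `m i = ε i`, then tile i covers both end points of e_i without choosing e_i, so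
tile i + 1 has to choose e_i, which means `m (i + 1) = ε i`. The sequences obeying this rule are the
`Admissible` codes; `SnakeGraph.ofCode_mem_matchings` and `SnakeGraph.exists_code` show that they
describe exactly the matchings. Good matchings of a band graph correspond in the same way to
periodic admissible codes.

The crossing conditions make the signs of G periodic with period p along the overlap
(`sgn_periodic`), while e_{s-1} and e_{s'-1} have opposite signs (`sgn_pred_s`). Let β be the sign
of the glueing edge. Cutting and splicing become operations on sequences: `Splice k m m₃ n` says
that m is m₃ with one period of n inserted after position k. `splice_of_isSplice` and
`Splice.isSplice` compare this with the geometric notion, and the spliced sequence is admissible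
precisely if two local conditions hold, collected in `Junction`. In the same way the geometric cut
positions become `CodeCut`.

Up to the first cut, the code m is -β on the tiles s, s + 1, … and constant on their translates by
p. Up to the first position of a splice, m₃ is -β and n is β. Where m₃ and n agree, the position of
a splice can be moved without changing the result (`splice_iff_splice`). Hence cutting at the first
cut and splicing at the first admitted position undo each other (`IsFirstCut.isLeast`,
`IsFirstCut.splice`), although the two positions may differ.

If no splice is possible, then n is constantly β, m₃ is -β on the tiles s, …, s' - 1, and one
further condition relates the tiles s - 1 and s' (`not_nonempty_iff`). These m₃ arise exactly from
the admissible codes of `G56` by inserting p tiles of value -β (`Inserted.admissible_iff`). A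
constant code selects no interior edge between two of its tiles. So the inserted part is recovered
by completion with boundary edges, and the boundary edges of `G4` not used for it form the matching
with constant code β. -/

theorem units_eq_neg_iff_ne {a b : ℤˣ} : a = -b ↔ a ≠ b := Int.units_ne_iff_eq_neg.symm

theorem units_eq_or_eq_neg (a b : ℤˣ) : a = b ∨ a = -b := by
  by_cases h : a = b
  · exact Or.inl h
  · exact Or.inr (units_eq_neg_iff_ne.2 h)

theorem units_neg_ne (a : ℤˣ) : -a ≠ a := by
  revert a; decide

theorem units_ne_neg (a : ℤˣ) : a ≠ -a := (units_neg_ne a).symm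

/-- The vertex shared by the two edges of sign `σ` of a tile. -/
def sideVertex (q : ℤ × ℤ) (σ : ℤˣ) : ℤ × ℤ :=
  if sign (southEdge q) = σ then q + (1, 0) else q + (0, 1)

theorem ends_sideOfSign_sw (q : ℤ × ℤ) (σ : ℤˣ) :
    Edge.ends (sideOfSign q .sw σ) = s(q, sideVertex q σ) := by
  unfold sideOfSign sideVertex
  dsimp only
  split_ifs <;> simp [Edge.ends, Edge.base, Edge.tip, southEdge, westEdge, Dir.vec]

theorem sign_northEdge_eq_iff (q : ℤ × ℤ) (σ : ℤˣ) :
    sign (northEdge q) = σ ↔ sign (southEdge q) ≠ σ := by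
  rw [(sign_isSignFunction q).2.2, neg_eq_iff_eq_neg, units_eq_neg_iff_ne]

theorem ends_sideOfSign_ne (q : ℤ × ℤ) (σ : ℤˣ) :
    Edge.ends (sideOfSign q .ne σ) = s(sideVertex q σ, q + (1, 1)) := by
  unfold sideOfSign sideVertex
  dsimp only
  simp only [sign_northEdge_eq_iff]
  split_ifs <;>
    simp_all [Edge.ends, Edge.base, Edge.tip, northEdge, eastEdge, Dir.vec, add_assoc]

theorem base_sideOfSign_sw (q : ℤ × ℤ) (σ : ℤˣ) : Edge.base (sideOfSign q .sw σ) = q := by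
  unfold sideOfSign
  dsimp only
  split_ifs <;> rfl

theorem tip_sideOfSign_sw (q : ℤ × ℤ) (σ : ℤˣ) :
    Edge.tip (sideOfSign q .sw σ) = sideVertex q σ := by
  unfold sideOfSign sideVertex
  dsimp only
  split_ifs <;> simp [Edge.tip, southEdge, westEdge, Dir.vec]

theorem base_sideOfSign_ne (q : ℤ × ℤ) (σ : ℤˣ) :
    Edge.base (sideOfSign q .ne σ) = sideVertex q σ := by
  unfold sideOfSign sideVertex
  dsimp only
  simp only [sign_northEdge_eq_iff]
  split_ifs <;> simp_all [Edge.base, northEdge, eastEdge]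

theorem tip_sideOfSign_ne (q : ℤ × ℤ) (σ : ℤˣ) :
    Edge.tip (sideOfSign q .ne σ) = q + (1, 1) := by
  unfold sideOfSign
  dsimp only
  split_ifs <;> simp [Edge.tip, northEdge, eastEdge, Dir.vec, add_assoc]

theorem sideVertex_inj {q : ℤ × ℤ} {σ τ : ℤˣ} : sideVertex q σ = sideVertex q τ ↔ σ = τ := by
  constructor
  · intro h
    by_contra hne
    have h1 : σ = -τ := units_eq_neg_iff_ne.2 hne
    subst h1
    unfold sideVertex at h
    rcases units_eq_or_eq_neg (sign (southEdge q)) τ with h1 | h1 <;>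
      simp [h1, Prod.ext_iff] at h
  · rintro rfl; rfl

theorem sideVertex_ne_self (q : ℤ × ℤ) (σ : ℤˣ) : sideVertex q σ ≠ q := by
  unfold sideVertex
  split_ifs <;> simp [Prod.ext_iff]

theorem sideVertex_ne_top (q : ℤ × ℤ) (σ : ℤˣ) : sideVertex q σ ≠ q + (1, 1) := by
  unfold sideVertex
  split_ifs <;> simp [Prod.ext_iff]

/-- The coordinate sum serves as a level. The southwest corner of tile i has level i - 1 and its
side vertices have level i, so the level of the base point of an edge almost determines its tile. -/
theorem sideVertex_sum (q : ℤ × ℤ) (σ : ℤˣ) :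
    (sideVertex q σ).1 + (sideVertex q σ).2 = q.1 + q.2 + 1 := by
  unfold sideVertex
  split_ifs <;> simp <;> ring

/-- The lattice point `u` is a corner of the tile `q`. -/
def IsCorner (q u : ℤ × ℤ) : Prop :=
  q.1 ≤ u.1 ∧ u.1 ≤ q.1 + 1 ∧ q.2 ≤ u.2 ∧ u.2 ≤ q.2 + 1

theorem isCorner_iff (q u : ℤ × ℤ) (σ : ℤˣ) :
    IsCorner q u ↔ u = q ∨ u = sideVertex q σ ∨ u = sideVertex q (-σ) ∨ u = q + (1, 1) := by
  have h : (sideVertex q σ = q + (1, 0) ∧ sideVertex q (-σ) = q + (0, 1)) ∨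
      (sideVertex q σ = q + (0, 1) ∧ sideVertex q (-σ) = q + (1, 0)) := by
    unfold sideVertex
    rcases units_eq_or_eq_neg (sign (southEdge q)) σ with h1 | h1 <;>
      simp [h1]
  obtain ⟨a, b⟩ := q
  obtain ⟨x, y⟩ := u
  rcases h with ⟨h1, h2⟩ | ⟨h1, h2⟩ <;> rw [h1, h2] <;>
    simp only [IsCorner, Prod.mk_add_mk, Prod.mk.injEq, add_zero] <;> omega

/-- The edges of a tile of signs `σ` and `-σ` at opposite corners partition the vertices. -/
theorem isCorner_iff_ends (q u : ℤ × ℤ) (σ : ℤˣ) :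
    IsCorner q u ↔ u ∈ Edge.ends (sideOfSign q .sw σ) ∨ u ∈ Edge.ends (sideOfSign q .ne (-σ)) := by
  rw [isCorner_iff q u σ, ends_sideOfSign_sw, ends_sideOfSign_ne, Sym2.mem_iff, Sym2.mem_iff]
  tauto

/-- Together with `isCorner_iff_ends` this says that the two edges chosen by a tile match its four
corners perfectly. -/
theorem disjoint_ends (q u : ℤ × ℤ) (σ : ℤˣ) (h1 : u ∈ Edge.ends (sideOfSign q .sw σ))
    (h2 : u ∈ Edge.ends (sideOfSign q .ne (-σ))) : False := by
  rw [ends_sideOfSign_sw, Sym2.mem_iff] at h1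
  rw [ends_sideOfSign_ne, Sym2.mem_iff] at h2
  rcases h1 with rfl | rfl <;> rcases h2 with h | h
  · exact sideVertex_ne_self _ _ h.symm
  · simp [Prod.ext_iff] at h
  · exact units_ne_neg _ (sideVertex_inj.1 h)
  · exact sideVertex_ne_top _ _ h

theorem mem_tileEdges_iff (q : ℤ × ℤ) (e : Edge) :
    e ∈ tileEdges q ↔ ∃ c σ, e = sideOfSign q c σ := by
  obtain ⟨h1, h2, h3⟩ := sign_isSignFunction q
  constructor
  · rintro (rfl | rfl | rfl | rfl)
    · exact ⟨.sw, sign (southEdge q), by simp [sideOfSign]⟩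
    · exact ⟨.sw, -sign (southEdge q), by simp [sideOfSign]⟩
    · exact ⟨.ne, sign (northEdge q), by simp [sideOfSign]⟩
    · exact ⟨.ne, -sign (northEdge q), by simp [sideOfSign]⟩
  · rintro ⟨c, σ, rfl⟩
    cases c <;> unfold sideOfSign <;> dsimp only <;> split_ifs <;> simp [tileEdges]

namespace SnakeGraph

variable (G : SnakeGraph)

theorem mem_edgesOn_iff {i j : ℕ} {e : Edge} :
    e ∈ G.edgesOn i j ↔ ∃ k c σ, i ≤ k ∧ k ≤ j ∧ e = G.edge k c σ := by
  simp only [edgesOn, Set.mem_ofPred_eq, mem_tileEdges_iff, edge]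
  constructor
  · rintro ⟨k, h1, h2, c, σ, h⟩
    exact ⟨k, c, σ, h1, h2, h⟩
  · rintro ⟨k, c, σ, h1, h2, h⟩
    exact ⟨k, h1, h2, c, σ, h⟩

theorem sideVertex_sgn (i : ℕ) (hi : 1 ≤ i) : sideVertex (G.tile i) (G.sgn i) = G.tile (i + 1) := by
  obtain ⟨h1, h2, h3⟩ := sign_isSignFunction (G.tile i)
  rw [G.tile_succ i hi]
  unfold sideVertex sgn interiorEdge
  cases G.step i <;> simp [Dir.vec, h2, h3]

theorem interiorEdge_eq (i : ℕ) : G.interiorEdge i = G.edge i .ne (G.sgn i) := by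
  obtain ⟨h1, h2, h3⟩ := sign_isSignFunction (G.tile i)
  unfold sgn interiorEdge edge sideOfSign
  cases G.step i <;> simp [h3, ← h2]

theorem interiorEdge_eq_sw (i : ℕ) (hi : 1 ≤ i) :
    G.interiorEdge i = G.edge (i + 1) .sw (G.sgn i) := by
  have e1 := sign_isSignFunction (G.tile (i + 1))
  have h := G.tile_succ i hi
  unfold sgn interiorEdge edge sideOfSign
  revert h
  cases G.step i <;> intro h
  · have e : eastEdge (G.tile i) = westEdge (G.tile (i + 1)) := by
      simp [eastEdge, westEdge, h, Dir.vec]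
    simp [e, ← e1.1, e1.2.2]
  · have e : northEdge (G.tile i) = southEdge (G.tile (i + 1)) := by
      simp [northEdge, southEdge, h, Dir.vec]
    simp [e]

theorem edge_succ_sw (i : ℕ) (hi : 1 ≤ i) :
    G.edge (i + 1) .sw (G.sgn i) = G.edge i .ne (G.sgn i) := by
  rw [← interiorEdge_eq, interiorEdge_eq_sw _ _ hi]

/-- Two edges of tiles coincide only if they are given in the same way or are an interior edge. -/
theorem edge_eq_edge {i j : ℕ} {c c' : Corner} {σ τ : ℤˣ} (hi : 1 ≤ i) (hj : 1 ≤ j)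
    (h : G.edge i c σ = G.edge j c' τ) :
    σ = τ ∧ ((i = j ∧ c = c') ∨ (c = .ne ∧ c' = .sw ∧ j = i + 1 ∧ σ = G.sgn i) ∨
      (c = .sw ∧ c' = .ne ∧ i = j + 1 ∧ σ = G.sgn j)) := by
  have hs := congrArg sign h
  simp only [edge, sign_sideOfSign] at hs
  refine ⟨hs, ?_⟩
  subst hs
  -- A south/west edge of tile i starts at level i - 1 and a north/east edge at level i. Equal base
  -- points therefore leave only the same tile or an adjacent one.
  have hb := congrArg Edge.base h
  have h1 := G.tile_sum i hi
  have h2 := G.tile_sum j hj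
  have h3 := sideVertex_sum (G.tile i) σ
  have h4 := sideVertex_sum (G.tile j) σ
  cases c <;> cases c' <;>
    simp only [edge, base_sideOfSign_sw, base_sideOfSign_ne] at hb
  · rw [hb] at h1
    exact Or.inl ⟨by omega, rfl⟩
  · rw [← hb] at h4
    have : i = j + 1 := by omega
    subst this
    rw [← G.sideVertex_sgn j hj, sideVertex_inj] at hb
    exact Or.inr (Or.inr ⟨rfl, rfl, rfl, hb.symm⟩)
  · rw [hb] at h3
    have : j = i + 1 := by omega
    subst this
    rw [← G.sideVertex_sgn i hi, sideVertex_inj] at hb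
    exact Or.inr (Or.inl ⟨rfl, rfl, rfl, hb⟩)
  · rw [hb] at h3
    exact Or.inl ⟨by omega, rfl⟩

theorem tile_mono {i j : ℕ} (h : i ≤ j) :
    (G.tile i).1 ≤ (G.tile j).1 ∧ (G.tile i).2 ≤ (G.tile j).2 := by
  induction j, h using Nat.le_induction with
  | base => simp
  | succ n hn ih =>
    rcases Nat.eq_zero_or_pos n with rfl | hpos
    · have : i = 0 := by omega
      subst this
      simp [tile]
    · rw [G.tile_succ n hpos]
      cases G.step n <;> simp [Dir.vec] <;> omega

/-- A vertex of two tiles lies on the interior edges between them. -/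
theorem mem_ends_of_isCorner {i j : ℕ} {u : ℤ × ℤ} (hi : 1 ≤ i) (hij : i < j)
    (h1 : IsCorner (G.tile i) u) (h2 : IsCorner (G.tile j) u) :
    u ∈ (G.edge i .ne (G.sgn i)).ends ∧ IsCorner (G.tile (i + 1)) u := by
  -- All tiles after the i-th lie weakly northeast of the southwest corner of tile i + 1, which
  -- confines a common corner to the edge e_i.
  have hm := G.tile_mono (i := i + 1) (j := j) hij
  have hmem : u ∈ (G.edge i .ne (G.sgn i)).ends := by
    rw [edge, ends_sideOfSign_ne, Sym2.mem_iff, G.sideVertex_sgn i hi]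
    rw [G.tile_succ i hi] at hm ⊢
    unfold IsCorner at h1 h2
    rw [Prod.ext_iff, Prod.ext_iff]
    revert hm
    cases G.step i <;> simp [Dir.vec] <;> omega
  refine ⟨hmem, ?_⟩
  rw [← G.edge_succ_sw i hi] at hmem
  exact (isCorner_iff_ends _ _ _).2 (Or.inl hmem)

theorem isCorner_of_mem_ends {i : ℕ} {c : Corner} {σ : ℤˣ} {u : ℤ × ℤ}
    (h : u ∈ (G.edge i c σ).ends) : IsCorner (G.tile i) u := by
  cases c
  · exact (isCorner_iff_ends _ _ _).2 (Or.inl h)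
  · exact (isCorner_iff_ends _ _ (-σ)).2 (Or.inr (by rwa [neg_neg]))

end SnakeGraph

end SnakeCalculus

namespace SnakeCalculus

/-! ### Matchings as sign sequences

A perfect matching of a snake graph chooses in every tile a pair of opposite edges: the south/west
edge of sign `m i` and the north/east edge of sign `-m i`. The matching consists of the edges that
are chosen in all tiles containing them. -/

/-- The side `c` of sign `σ` of the `i`-th tile is chosen by this tile, and by the adjacent tile
if it is an interior edge; here `ε i` is the sign of the interior edge between the `i`-th tile and
the next. -/
def Selected (ε m : ℕ → ℤˣ) (i : ℕ) : Corner → ℤˣ → Prop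
  | .sw, σ => m i = σ ∧ (ε (i - 1) = σ → m (i - 1) = -σ)
  | .ne, σ => m i = -σ ∧ (ε i = σ → m (i + 1) = σ)

/-- The sequence `m 1, …, m d` describes a matching; the additional values `m 0` and `m (d + 1)`
are such that the end edges of the snake graph are treated as interior edges. -/
structure Admissible (d : ℕ) (ε m : ℕ → ℤˣ) : Prop where
  first : m 0 = -ε 0
  last : m (d + 1) = ε d
  step : ∀ i, 1 ≤ i → i < d → m i = ε i → m (i + 1) = ε i

/-- The values at the ends extend the rule to 0 and d: its hypothesis fails at 0, and its conclusion
at d is `last`. No separate treatment of the end tiles is needed afterwards. -/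
theorem Admissible.step_le {d : ℕ} {ε m : ℕ → ℤˣ} (h : Admissible d ε m) {i : ℕ} (hi : i ≤ d)
    (hm : m i = ε i) : m (i + 1) = ε i := by
  rcases Nat.eq_zero_or_pos i with rfl | h0
  · exact absurd (h.first.symm.trans hm) (units_neg_ne _)
  · rcases hi.eq_or_lt with rfl | h1
    · exact h.last
    · exact h.step i h0 h1 hm

namespace SnakeGraph

variable (G : SnakeGraph)

/-- The function `ε` gives the signs of the interior edges. -/
def IsSigns (ε : ℕ → ℤˣ) : Prop := ∀ i, 1 ≤ i → i < G.d → ε i = G.sgn i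

/-- The set of edges which are chosen in all tiles containing them. -/
def ofCode (ε m : ℕ → ℤˣ) : Set Edge :=
  {e | ∃ i c σ, 1 ≤ i ∧ i ≤ G.d ∧ e = G.edge i c σ ∧ Selected ε m i c σ}

variable {G} {ε m : ℕ → ℤˣ}

theorem IsSigns.edge_succ_sw (hε : G.IsSigns ε) {i : ℕ} (hi : 1 ≤ i) (hd : i < G.d) :
    G.edge (i + 1) .sw (ε i) = G.edge i .ne (ε i) := by
  rw [hε i hi hd, G.edge_succ_sw i hi]

/-- At an interior edge the condition `Selected` is symmetric in the two adjacent tiles, so it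
depends on the edge only and not on its description. -/
theorem selected_of_edge_eq (hε : G.IsSigns ε) {i j : ℕ} {c c' : Corner} {σ τ : ℤˣ}
    (hi : 1 ≤ i) (hj : 1 ≤ j) (hid : i ≤ G.d) (hjd : j ≤ G.d)
    (h : G.edge i c σ = G.edge j c' τ) (hs : Selected ε m i c σ) : Selected ε m j c' τ := by
  obtain ⟨rfl, ⟨rfl, rfl⟩ | ⟨rfl, rfl, rfl, h1⟩ | ⟨rfl, rfl, rfl, h1⟩⟩ := G.edge_eq_edge hi hj h
  · exact hs
  · rw [← hε i hi (by omega)] at h1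
    exact ⟨hs.2 h1.symm, fun _ => hs.1⟩
  · rw [← hε j hj (by omega)] at h1
    exact ⟨hs.2 h1.symm, fun _ => hs.1⟩

theorem edge_mem_ofCode (hε : G.IsSigns ε) {i : ℕ} {c : Corner} {σ : ℤˣ}
    (hi : 1 ≤ i) (hid : i ≤ G.d) : G.edge i c σ ∈ G.ofCode ε m ↔ Selected ε m i c σ := by
  constructor
  · rintro ⟨j, c', τ, hj, hjd, h, hs⟩
    exact selected_of_edge_eq hε hj hi hjd hid h.symm hs
  · intro h
    exact ⟨i, c, σ, hi, hid, rfl, h⟩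

theorem ofCode_subset : G.ofCode ε m ⊆ G.edgesOn 1 G.d := by
  rintro e ⟨i, c, σ, hi, hid, rfl, -⟩
  exact G.mem_edgesOn_iff.2 ⟨i, c, σ, hi, hid, rfl⟩

/-- A vertex of the chosen south/west edge of the `i`-th tile is matched in the tiles
`l + 1, …, i`, unless the vertex lies on the edge `e_l` which is not chosen by the `l`-th tile. -/
theorem exists_selected_left (hε : G.IsSigns ε) {l i : ℕ} {u : ℤ × ℤ}
    (hli : l < i) (hid : i ≤ G.d) (hu : u ∈ (G.edge i .sw (m i)).ends) :
    (∃ j c σ, l < j ∧ j ≤ i ∧ Selected ε m j c σ ∧ u ∈ (G.edge j c σ).ends) ∨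
      (m l = ε l ∧ m (l + 1) = ε l ∧ u ∈ (G.edge (l + 1) .sw (ε l)).ends) := by
  induction i, hli using Nat.le_induction with
  | base =>
    by_cases hs : Selected ε m (l + 1) .sw (m (l + 1))
    · exact Or.inl ⟨_, _, _, Nat.lt_succ_self l, le_rfl, hs, hu⟩
    · simp only [Selected, Nat.add_sub_cancel, true_and] at hs
      push Not at hs
      rw [← hs.1] at hu
      refine Or.inr ⟨?_, hs.1.symm, hu⟩
      by_contra hne
      exact hs.2 (by rw [← hs.1]; exact units_eq_neg_iff_ne.2 hne)
  | succ n hn ih =>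
    by_cases hs : Selected ε m (n + 1) .sw (m (n + 1))
    · exact Or.inl ⟨_, _, _, by omega, le_rfl, hs, hu⟩
    · simp only [Selected, Nat.add_sub_cancel, true_and] at hs
      push Not at hs
      rw [← hs.1, hε.edge_succ_sw (by omega) (by omega)] at hu
      have hc := G.isCorner_of_mem_ends hu
      have hmn : m n = ε n := by
        by_contra hne
        exact hs.2 (by rw [← hs.1]; exact units_eq_neg_iff_ne.2 hne)
      -- Tile n does not choose e_n, so the vertex lies on one of its two other chosen edges. On the
      -- south/west one the walk to the left continues; the north/east one has sign `-ε n`, hence is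
      -- not interior, and is selected.
      rcases (isCorner_iff_ends _ _ (m n)).1 hc with h | h
      · rcases ih (by omega) h with ⟨j, c, σ, h1, h2, h3⟩ | h1
        · exact Or.inl ⟨j, c, σ, h1, by omega, h3⟩
        · exact Or.inr h1
      · refine Or.inl ⟨n, .ne, -m n, by omega, by omega, ⟨by simp, fun h' => ?_⟩, h⟩
        exact absurd (hmn.trans h') (units_ne_neg _)

/-- A vertex of the chosen north/east edge of the `i`-th tile is matched in the tiles
`i, …, r`, unless the vertex lies on the edge `e_r` which is not chosen by the tile `r + 1`. -/
theorem exists_selected_right (hε : G.IsSigns ε) {i r : ℕ} {u : ℤ × ℤ} (hi : 1 ≤ i)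
    (hir : i ≤ r) (hrd : r ≤ G.d) (hu : u ∈ (G.edge i .ne (-m i)).ends) :
    (∃ j c σ, i ≤ j ∧ j ≤ r ∧ Selected ε m j c σ ∧ u ∈ (G.edge j c σ).ends) ∨
      (m r = -ε r ∧ m (r + 1) = -ε r ∧ u ∈ (G.edge r .ne (ε r)).ends) := by
  induction hn : r - i generalizing i with
  | zero =>
    have : r = i := by omega
    subst this
    by_cases hs : Selected ε m r .ne (-m r)
    · exact Or.inl ⟨_, _, _, le_rfl, le_rfl, hs, hu⟩
    · simp only [Selected, neg_neg, true_and] at hs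
      push Not at hs
      rw [← hs.1] at hu
      refine Or.inr ⟨?_, ?_, hu⟩
      · rw [hs.1, neg_neg]
      · rw [units_eq_neg_iff_ne, hs.1]; exact hs.2
  | succ n ih =>
    by_cases hs : Selected ε m i .ne (-m i)
    · exact Or.inl ⟨_, _, _, le_rfl, hir, hs, hu⟩
    · simp only [Selected, neg_neg, true_and] at hs
      push Not at hs
      have h1 : m (i + 1) = -ε i := by rw [units_eq_neg_iff_ne, hs.1]; exact hs.2
      rw [← hs.1, ← hε.edge_succ_sw hi (by omega)] at hu
      have hc := G.isCorner_of_mem_ends hu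
      rcases (isCorner_iff_ends _ _ (m (i + 1))).1 hc with h | h
      · refine Or.inl ⟨i + 1, .sw, m (i + 1), by omega, by omega, ⟨rfl, fun h' => ?_⟩, h⟩
        rw [Nat.add_sub_cancel] at h'
        exact absurd (h1.symm.trans h'.symm) (units_neg_ne _)
      · rcases ih (by omega) (by omega) h (by omega) with ⟨j, c, σ, h1, h2, h3⟩ | h1
        · exact Or.inl ⟨j, c, σ, by omega, h2, h3⟩
        · exact Or.inr h1

/-- Existence for perfect matchings: the walks to the left and to the right could only fail at the
ends, where the values `m 0` and `m (d + 1)` exclude it. -/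
theorem exists_selected (hε : G.IsSigns ε) (hm : Admissible G.d ε m) {i : ℕ} {u : ℤ × ℤ}
    (hi : 1 ≤ i) (hid : i ≤ G.d) (hu : IsCorner (G.tile i) u) :
    ∃ j c σ, 1 ≤ j ∧ j ≤ G.d ∧ Selected ε m j c σ ∧ u ∈ (G.edge j c σ).ends := by
  rcases (isCorner_iff_ends _ _ (m i)).1 hu with h | h
  · rcases exists_selected_left hε (l := 0) hi hid h with ⟨j, c, σ, h1, h2, h3⟩ | h1
    · exact ⟨j, c, σ, h1, by omega, h3⟩
    · exact absurd (hm.first.symm.trans h1.1) (units_neg_ne _)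
  · rcases exists_selected_right hε hi hid le_rfl h with ⟨j, c, σ, h1, h2, h3⟩ | h1
    · exact ⟨j, c, σ, by omega, h2, h3⟩
    · exact absurd (hm.last.symm.trans h1.2.1) (units_ne_neg _)

/-- A tile chooses at most one of the edges at each of its vertices. -/
theorem eq_of_selected_of_mem {i : ℕ} {c : Corner} {σ : ℤˣ} {u : ℤ × ℤ}
    (hs : Selected ε m i c σ) (hu : u ∈ (G.edge i c σ).ends) :
    (u ∈ (G.edge i .sw (m i)).ends → c = .sw ∧ σ = m i) ∧
      (u ∈ (G.edge i .ne (-m i)).ends → c = .ne ∧ σ = -m i) := by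
  cases c
  · have h1 := hs.1
    subst h1
    exact ⟨fun _ => ⟨rfl, rfl⟩, fun h => (disjoint_ends _ _ _ hu h).elim⟩
  · have h1 : σ = -m i := by rw [hs.1, neg_neg]
    subst h1
    exact ⟨fun h => (disjoint_ends _ _ _ h hu).elim, fun _ => ⟨rfl, rfl⟩⟩

/-- If both end points of `e_i` are matched by edges before `e_i`, then they are not matched by
later edges. -/
theorem not_selected_of_lt (hε : G.IsSigns ε) (hm : Admissible G.d ε m) {i j : ℕ} {c : Corner}
    {σ : ℤˣ} {u : ℤ × ℤ} (hi : 1 ≤ i) (hij : i < j) (hjd : j ≤ G.d) (hmi : m i = ε i)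
    (hu : u ∈ (G.edge i .ne (ε i)).ends) (hs : Selected ε m j c σ)
    (hu' : u ∈ (G.edge j c σ).ends) : False := by
  induction hn : j - i generalizing i with
  | zero => omega
  | succ n ih =>
    have h1 := hm.step_le (by omega) hmi
    rw [← hε.edge_succ_sw hi (by omega), ← h1] at hu
    rcases Nat.lt_or_ge (i + 1) j with hlt | hge
    · obtain ⟨h2, -⟩ := G.mem_ends_of_isCorner (by omega) hlt (G.isCorner_of_mem_ends hu)
        (G.isCorner_of_mem_ends hu')
      rw [← hε (i + 1) (by omega) (by omega)] at h2
      -- If tile i + 1 does not choose e_{i+1}, the same situation recurs one tile later. If it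
      -- does, then its chosen edges e_i and e_{i+1} are disjoint, although u lies on both.
      rcases units_eq_or_eq_neg (m (i + 1)) (ε (i + 1)) with h3 | h3
      · exact ih (by omega) hlt h3 h2 (by omega)
      · refine disjoint_ends _ _ _ hu (?_ : u ∈ (G.edge (i + 1) .ne (-m (i + 1))).ends)
        rwa [h3, neg_neg]
    · have : j = i + 1 := by omega
      subst this
      obtain ⟨rfl, rfl⟩ := (eq_of_selected_of_mem hs hu').1 hu
      have h4 := hs.2 (by rw [h1, Nat.add_sub_cancel])
      rw [Nat.add_sub_cancel, h1, hmi] at h4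
      exact units_ne_neg _ h4

/-- Uniqueness for perfect matchings. A vertex shared with a later tile lies on e_i. If tile i does
not choose e_i, later edges avoid the vertex; if it does, the selected edge is e_i itself, which can
be regarded as an edge of tile i + 1, and the distance shrinks. -/
theorem edge_eq_of_selected (hε : G.IsSigns ε) (hm : Admissible G.d ε m) {i j : ℕ}
    {c c' : Corner} {σ τ : ℤˣ} {u : ℤ × ℤ} (hi : 1 ≤ i) (hij : i ≤ j) (hjd : j ≤ G.d)
    (hs : Selected ε m i c σ) (hs' : Selected ε m j c' τ)
    (hu : u ∈ (G.edge i c σ).ends) (hu' : u ∈ (G.edge j c' τ).ends) :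
    G.edge i c σ = G.edge j c' τ := by
  induction hn : j - i generalizing i c σ with
  | zero =>
    have : j = i := by omega
    subst this
    rcases (isCorner_iff_ends _ _ (m j)).1 (G.isCorner_of_mem_ends hu) with h | h
    · obtain ⟨rfl, rfl⟩ := (eq_of_selected_of_mem hs hu).1 h
      obtain ⟨rfl, rfl⟩ := (eq_of_selected_of_mem hs' hu').1 h
      rfl
    · obtain ⟨rfl, rfl⟩ := (eq_of_selected_of_mem hs hu).2 h
      obtain ⟨rfl, rfl⟩ := (eq_of_selected_of_mem hs' hu').2 h
      rfl
  | succ n ih =>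
    obtain ⟨h2, -⟩ := G.mem_ends_of_isCorner hi (by omega) (G.isCorner_of_mem_ends hu)
        (G.isCorner_of_mem_ends hu')
    rw [← hε i hi (by omega)] at h2
    rcases units_eq_or_eq_neg (m i) (ε i) with h3 | h3
    · exact (not_selected_of_lt hε hm hi (by omega) hjd h3 h2 hs' hu').elim
    · have h4 : -m i = ε i := by rw [h3, neg_neg]
      rw [← h4] at h2
      obtain ⟨rfl, rfl⟩ := (eq_of_selected_of_mem hs hu).2 h2
      have h5 := hs.2 h4.symm
      rw [h4] at hu h5 ⊢
      rw [← hε.edge_succ_sw hi (by omega)] at hu ⊢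
      exact ih (by omega) (by omega) ⟨h5, fun _ => h3⟩ hu (by omega)

theorem inc_graph_iff {e : Edge} {v : ℤ × ℤ} :
    G.graph.Inc e v ↔ e ∈ G.edgesOn 1 G.d ∧ v ∈ e.ends := by
  constructor
  · rintro ⟨y, h1, h2⟩
    exact ⟨h1, by rw [h2]; exact Sym2.mem_mk_left _ _⟩
  · rintro ⟨h1, h2⟩
    obtain ⟨y, hy⟩ := h2
    exact ⟨y, h1, hy⟩

theorem ofCode_mem_matchings (hε : G.IsSigns ε) (hm : Admissible G.d ε m) :
    G.ofCode ε m ∈ G.matchings := by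
  refine ⟨ofCode_subset, ?_⟩
  rintro v ⟨e, he, hv⟩
  obtain ⟨i, c, σ, hi, hid, rfl⟩ := G.mem_edgesOn_iff.1 he
  obtain ⟨j, c', τ, hj, hjd, hs, hu⟩ := exists_selected hε hm hi hid (G.isCorner_of_mem_ends hv)
  refine ⟨G.edge j c' τ, ⟨⟨j, c', τ, hj, hjd, rfl, hs⟩,
    inc_graph_iff.2 ⟨G.mem_edgesOn_iff.2 ⟨j, c', τ, hj, hjd, rfl⟩, hu⟩⟩, ?_⟩
  rintro f ⟨⟨k, c₁, ρ, hk, hkd, rfl, hs'⟩, hf⟩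
  have hu' := (inc_graph_iff.1 hf).2
  rcases le_total k j with h | h
  · exact edge_eq_of_selected hε hm hk h hjd hs' hs hu' hu
  · exact (edge_eq_of_selected hε hm hj h hkd hs hs' hu hu').symm

/-- This reduces later equalities of matchings to one inclusion. -/
theorem eq_of_subset_of_mem_matchings {P Q : Set Edge} (hP : P ∈ G.matchings)
    (hQ : Q ∈ G.matchings) (h : P ⊆ Q) : P = Q := by
  refine h.antisymm fun e he => ?_
  have he' := hQ.1 he
  have hv : e.base ∈ e.ends := Sym2.mem_mk_left _ _
  obtain ⟨f, ⟨hf, hfi⟩, -⟩ := hP.2 e.base ⟨e, he', hv⟩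
  have := (hQ.2 e.base ⟨e, he', hv⟩).unique ⟨he, inc_graph_iff.2 ⟨he', hv⟩⟩ ⟨h hf, hfi⟩
  rwa [this]

/-- The north/east edge of sign `-ε i` belongs to tile i alone, so its membership shows the value `m
i`. This is how codes are read off from matchings. -/
theorem ne_mem_ofCode_iff (hε : G.IsSigns ε) {i : ℕ} (hi : 1 ≤ i) (hid : i ≤ G.d) :
    G.edge i .ne (-ε i) ∈ G.ofCode ε m ↔ m i = ε i := by
  rw [edge_mem_ofCode hε hi hid]
  simp [Selected]

theorem matching_unique {P : Set Edge} (hP : P ∈ G.matchings) {e f : Edge} {u : ℤ × ℤ}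
    (he : e ∈ P) (hf : f ∈ P) (hu : u ∈ e.ends) (hu' : u ∈ f.ends) : e = f :=
  (hP.2 u ⟨e, hP.1 he, hu⟩).unique ⟨he, inc_graph_iff.2 ⟨hP.1 he, hu⟩⟩
    ⟨hf, inc_graph_iff.2 ⟨hP.1 hf, hu'⟩⟩

theorem matching_exists {P : Set Edge} (hP : P ∈ G.matchings) {i : ℕ} {u : ℤ × ℤ}
    (hi : 1 ≤ i) (hid : i ≤ G.d) (hu : IsCorner (G.tile i) u) :
    ∃ j c σ, 1 ≤ j ∧ j ≤ G.d ∧ G.edge j c σ ∈ P ∧ u ∈ (G.edge j c σ).ends := by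
  have : ∃ c σ, u ∈ (G.edge i c σ).ends := by
    rcases (isCorner_iff_ends _ _ 1).1 hu with h | h
    · exact ⟨_, _, h⟩
    · exact ⟨_, _, h⟩
  obtain ⟨c, σ, h⟩ := this
  obtain ⟨f, ⟨hf, hfi⟩, -⟩ :=
    hP.2 u ⟨G.edge i c σ, G.mem_edgesOn_iff.2 ⟨i, c, σ, hi, hid, rfl⟩, h⟩
  obtain ⟨j, c', τ, h1, h2, rfl⟩ := G.mem_edgesOn_iff.1 (hP.1 hf)
  exact ⟨j, c', τ, h1, h2, hf, (inc_graph_iff.1 hfi).2⟩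

end SnakeGraph
end SnakeCalculus

/-! ### Every perfect matching of a snake graph has a code -/

namespace SnakeCalculus

theorem Edge.ends_injective {e f : Edge} (h : e.ends = f.ends) : e = f := by
  obtain ⟨⟨a, b⟩, x⟩ := e
  obtain ⟨⟨c, d⟩, y⟩ := f
  have h' := Sym2.eq_iff.1 h
  cases x <;> cases y <;>
    simp [Edge.base, Edge.tip, Dir.vec] at h' ⊢ <;> omega

/-- The side `c` of sign `σ` is one of the two edges chosen by the `i`-th tile. -/
def Chosen (m : ℕ → ℤˣ) (i : ℕ) : Corner → ℤˣ → Prop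
  | .sw, σ => m i = σ
  | .ne, σ => m i = -σ

namespace SnakeGraph

variable {G : SnakeGraph} {ε m : ℕ → ℤˣ} {P : Set Edge}

theorem isCorner_of_le_of_le {i j k : ℕ} {u : ℤ × ℤ} (hi : 1 ≤ i) (hij : i ≤ j) (hjk : j ≤ k)
    (h1 : IsCorner (G.tile i) u) (h2 : IsCorner (G.tile k) u) : IsCorner (G.tile j) u := by
  induction j, hij using Nat.le_induction with
  | base => exact h1
  | succ n hn ih =>
    exact (G.mem_ends_of_isCorner (by omega) (by omega) (ih (by omega)) h2).2

/-- The first `n` tiles. -/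
def initial (G : SnakeGraph) (n : ℕ) (hn : 1 ≤ n) : SnakeGraph := ⟨n, hn, G.step⟩

/-- The first `n` tiles choose all edges of `P` on them, and the choices are admissible. -/
structure ChosenUpTo (G : SnakeGraph) (P : Set Edge) (ε m : ℕ → ℤˣ) (n : ℕ) : Prop where
  first : m 0 = -ε 0
  chosen : ∀ i c σ, 1 ≤ i → i ≤ n → G.edge i c σ ∈ P → Chosen m i c σ
  step : ∀ i, 1 ≤ i → i < n → m i = ε i → m (i + 1) = ε i

/-- The code of the first `n` tiles. -/
def truncate (ε m : ℕ → ℤˣ) (n i : ℕ) : ℤˣ := if i ≤ n then m i else ε n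

theorem truncate_of_le {n i : ℕ} (h : i ≤ n) : truncate ε m n i = m i := if_pos h

theorem truncate_succ {n : ℕ} : truncate ε m n (n + 1) = ε n := if_neg (by omega)

/-- Allows the existence and uniqueness results to be applied to the first n tiles as a snake graph
of their own. -/
theorem ChosenUpTo.admissible {n : ℕ} (h : ChosenUpTo G P ε m n) :
    Admissible n ε (truncate ε m n) where
  first := by rw [truncate_of_le (by omega), h.first]
  last := truncate_succ
  step i h1 h2 h3 := by
    rw [truncate_of_le (by omega)] at h3 ⊢
    exact h.step i h1 h2 h3

theorem IsSigns.initial (hε : G.IsSigns ε) {n : ℕ} (hn : 1 ≤ n) (hd : n ≤ G.d) :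
    (G.initial n hn).IsSigns ε := fun i h1 h2 => hε i h1 (lt_of_lt_of_le h2 hd)

theorem ChosenUpTo.selected {n : ℕ} (h : ChosenUpTo G P ε m n) (hε : G.IsSigns ε)
    (hd : n ≤ G.d) {i : ℕ} {c : Corner} {σ : ℤˣ} (hi : 1 ≤ i) (hin : i ≤ n)
    (hP : G.edge i c σ ∈ P) : Selected ε (truncate ε m n) i c σ := by
  have h0 := h.chosen i c σ hi hin hP
  cases c
  · refine ⟨by rw [truncate_of_le hin]; exact h0, fun hσ => ?_⟩
    rw [truncate_of_le (by omega)]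
    obtain ⟨k, rfl⟩ := Nat.exists_eq_add_of_le' hi
    rw [Nat.add_sub_cancel] at hσ ⊢
    rcases Nat.eq_zero_or_pos k with rfl | hk
    · rw [h.first, hσ]
    · subst hσ
      rw [hε.edge_succ_sw hk (by omega)] at hP
      exact h.chosen k .ne _ hk (by omega) hP
  · refine ⟨by rw [truncate_of_le hin]; exact h0, fun hσ => ?_⟩
    rcases hin.eq_or_lt with rfl | hlt
    · rw [truncate_succ, hσ]
    · rw [truncate_of_le (by omega)]
      subst hσ
      rw [← hε.edge_succ_sw hi (by omega)] at hP
      exact h.chosen (i + 1) .sw _ (by omega) hlt hP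

/-- The truncated code selects an edge at u that differs from e_n. Its other end point w lies off
e_n, so P matches w within the first n tiles. That edge of P is selected as well, and by uniqueness
at w it is the edge found at u. -/
theorem ChosenUpTo.exists_mem {n : ℕ} (h : ChosenUpTo G P ε m n) (hε : G.IsSigns ε)
    (hP : P ∈ G.matchings) (hn : 1 ≤ n) (hd : n < G.d) (hm : m n = ε n) {u : ℤ × ℤ}
    (hu : u ∈ (G.edge n .ne (ε n)).ends) :
    ∃ j c σ, 1 ≤ j ∧ j ≤ n ∧ G.edge j c σ ∈ P ∧ u ∈ (G.edge j c σ).ends := by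
  have hε' := hε.initial hn hd.le
  obtain ⟨j, c, σ, hj, hjn, hs, hu'⟩ := exists_selected hε' h.admissible hn le_rfl
    (G.isCorner_of_mem_ends hu)
  change u ∈ (G.edge j c σ).ends at hu'
  change j ≤ n at hjn
  refine ⟨j, c, σ, hj, hjn, ?_, hu'⟩
  have hne : G.edge j c σ ≠ G.edge n .ne (ε n) := by
    intro he
    have := selected_of_edge_eq hε' hj hn hjn le_rfl he hs
    have h1 := this.1
    rw [truncate_of_le le_rfl, hm] at h1
    exact units_ne_neg _ h1
  obtain ⟨w, hw⟩ := hu'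
  have hwj : w ∈ (G.edge j c σ).ends := by rw [hw]; exact Sym2.mem_mk_right _ _
  have hwn : w ∉ (G.edge n .ne (ε n)).ends := by
    intro hwn
    apply hne
    apply Edge.ends_injective
    have huw : u ≠ w := by
      rintro rfl
      have h0 : (G.edge j c σ).ends = s(u, u) := hw
      cases c
      · rw [edge, ends_sideOfSign_sw] at h0
        rcases Sym2.eq_iff.1 h0 with h0 | h0 <;>
          exact sideVertex_ne_self _ _ (h0.2.trans h0.1.symm)
      · rw [edge, ends_sideOfSign_ne] at h0
        rcases Sym2.eq_iff.1 h0 with h0 | h0 <;>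
          exact sideVertex_ne_top _ _ (h0.1.trans h0.2.symm)
    rw [hw, ((Sym2.mem_and_mem_iff huw).1 ⟨hu, hwn⟩)]
  obtain ⟨k, c', τ, hk, hkd, hkP, hwk⟩ := matching_exists hP hj (by omega)
    (G.isCorner_of_mem_ends hwj)
  have hkn : k ≤ n := by
    by_contra hlt
    push Not at hlt
    have h1 := isCorner_of_le_of_le hj hjn hlt.le (G.isCorner_of_mem_ends hwj)
      (G.isCorner_of_mem_ends hwk)
    have h2 := (G.mem_ends_of_isCorner hn hlt h1 (G.isCorner_of_mem_ends hwk)).1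
    rw [← hε n hn hd] at h2
    exact hwn h2
  have hs' := h.selected hε hd.le hk hkn hkP
  have : G.edge j c σ = G.edge k c' τ := by
    rcases le_total j k with h1 | h1
    · exact edge_eq_of_selected hε' h.admissible hj h1 hkn hs hs' hwj hwk
    · exact (edge_eq_of_selected hε' h.admissible hk h1 hjn hs' hs hwk hwj).symm
  rwa [this]

/-- Otherwise the n-th tile chooses e_n, the truncated code selects it, and uniqueness at u
identifies the given edge with e_n. -/
theorem ChosenUpTo.eq_of_mem {n : ℕ} (h : ChosenUpTo G P ε m n) (hε : G.IsSigns ε)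
    (hn : 1 ≤ n) (hd : n < G.d) {j : ℕ} {c : Corner} {σ : ℤˣ} {u : ℤ × ℤ}
    (hj : 1 ≤ j) (hjn : j ≤ n) (hjP : G.edge j c σ ∈ P) (huj : u ∈ (G.edge j c σ).ends)
    (hu : u ∈ (G.edge n .ne (ε n)).ends) (hne : G.edge j c σ ≠ G.edge n .ne (ε n)) :
    m n = ε n := by
  by_contra hm
  have hm' := units_eq_neg_iff_ne.2 hm
  have hs := h.selected hε hd.le hj hjn hjP
  exact hne (edge_eq_of_selected (hε.initial hn hd.le) h.admissible hj hjn le_rfl hs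
    ⟨by rw [truncate_of_le le_rfl, hm'], fun _ => truncate_succ⟩ huj hu)

open Classical in
/-- The code of a perfect matching. -/
noncomputable def code (G : SnakeGraph) (ε : ℕ → ℤˣ) (P : Set Edge) (i : ℕ) : ℤˣ :=
  if i = 0 then -ε 0
  else if G.d < i then ε G.d
  else if G.edge i .sw (-ε (i - 1)) ∈ P then -ε (i - 1) else ε (i - 1)

/-- Every edge of a tile other than the opposite one meets the given edge of P. -/
theorem chosen_of_sw_mem (hP : P ∈ G.matchings) {i : ℕ} (hi : 1 ≤ i)
    (h : G.edge i .sw (m i) ∈ P) {c : Corner} {σ : ℤˣ} (h' : G.edge i c σ ∈ P) :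
    Chosen m i c σ := by
  by_contra hc
  have key : ∃ u, u ∈ (G.edge i .sw (m i)).ends ∧ u ∈ (G.edge i c σ).ends := by
    cases c
    · exact ⟨G.tile i, by simp [edge, ends_sideOfSign_sw], by simp [edge, ends_sideOfSign_sw]⟩
    · have : m i = σ := by
        by_contra h0
        exact hc (units_eq_neg_iff_ne.2 h0)
      rw [this]
      exact ⟨sideVertex (G.tile i) σ, by simp [edge, ends_sideOfSign_sw],
        by simp [edge, ends_sideOfSign_ne]⟩
  obtain ⟨u, h1, h2⟩ := key
  obtain ⟨h3, ⟨-, h4⟩ | ⟨h4, -⟩ | ⟨-, -, h4, -⟩⟩ :=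
    G.edge_eq_edge hi hi (matching_unique hP h h' h1 h2)
  · subst h4; exact hc h3
  · cases h4
  · omega

-- Induction over the tiles. If P contains the south/west boundary edge of tile n + 1, this edge
-- fixes the choice, and `m n = ε n` is impossible because P would then match both end points of e_n
-- earlier. Otherwise the tile receives the value `ε n`, and the critical case is that P contains
-- its north/east edge of sign `ε n`. Its southwest corner must then be matched before tile n + 1,
-- hence so must both end points of e_n, one of which lies on that north/east edge.
open Classical in
theorem chosenUpTo_code (hε : G.IsSigns ε) (hP : P ∈ G.matchings) (n : ℕ) (hn : n ≤ G.d) :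
    ChosenUpTo G P ε (G.code ε P) n := by
  have h0 : G.code ε P 0 = -ε 0 := if_pos rfl
  induction n with
  | zero => exact ⟨h0, fun i _ _ h1 h2 => by omega, fun i h1 h2 => by omega⟩
  | succ n ih =>
    have ih := ih (by omega)
    have hval : G.code ε P (n + 1) =
        if G.edge (n + 1) .sw (-ε n) ∈ P then -ε n else ε n := by
      rw [code, if_neg (by omega), if_neg (by omega), Nat.add_sub_cancel]
    by_cases hx : G.edge (n + 1) .sw (-ε n) ∈ P
    · rw [if_pos hx] at hval
      refine ⟨h0, fun i c σ h1 h2 h3 => ?_, fun i h1 h2 h3 => ?_⟩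
      · rcases h2.eq_or_lt with rfl | h2
        · exact chosen_of_sw_mem hP h1 (by rwa [hval]) h3
        · exact ih.chosen i c σ h1 (by omega) h3
      · rcases Nat.lt_or_ge i n with h4 | h4
        · exact ih.step i h1 h4 h3
        · have : i = n := by omega
          subst this
          have hu : G.tile (i + 1) ∈ (G.edge i .ne (ε i)).ends := by
            rw [← hε.edge_succ_sw h1 (by omega), edge, ends_sideOfSign_sw]
            exact Sym2.mem_mk_left _ _
          obtain ⟨j, c, σ, hj, hjn, hjP, huj⟩ := ih.exists_mem hε hP h1 (by omega) h3 hu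
          have := matching_unique hP hjP hx huj (by simp [edge, ends_sideOfSign_sw])
          obtain ⟨h5, ⟨h4, -⟩ | ⟨-, -, h4, h6⟩ | ⟨-, h4, -⟩⟩ :=
            G.edge_eq_edge hj (by omega) this
          · omega
          · have : j = i := by omega
            subst this
            rw [← hε j hj (by omega), h5] at h6
            exact absurd h6 (units_neg_ne _)
          · cases h4
    · rw [if_neg hx] at hval
      refine ⟨h0, fun i c σ h1 h2 h3 => ?_, fun i h1 h2 h3 => ?_⟩
      · rcases h2.eq_or_lt with rfl | h2
        swap
        · exact ih.chosen i c σ h1 (by omega) h3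
        by_contra hc
        cases c
        · have : σ = -ε n := by
            rw [units_eq_neg_iff_ne]
            rintro rfl
            exact hc hval
          exact hx (this ▸ h3)
        · have : σ = ε n := by
            by_contra h
            apply hc
            change G.code ε P (n + 1) = -σ
            rw [hval, units_eq_neg_iff_ne.2 h, neg_neg]
          subst this
          have hW : sideVertex (G.tile (n + 1)) (ε n) ∈ (G.edge (n + 1) .ne (ε n)).ends := by
            rw [edge, ends_sideOfSign_ne]; exact Sym2.mem_mk_left _ _
          have hsw : G.edge (n + 1) .sw (ε n) ∉ P := by
            intro h4
            have := chosen_of_sw_mem (m := G.code ε P) hP h1 (by rwa [hval]) h3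
            exact hc this
          have hA : G.tile (n + 1) ∈ (G.edge (n + 1) .sw (ε n)).ends := by
            rw [edge, ends_sideOfSign_sw]; exact Sym2.mem_mk_left _ _
          have hA' : ∀ σ, G.tile (n + 1) ∉ (G.edge (n + 1) .ne σ).ends := by
            intro σ h4
            rw [edge, ends_sideOfSign_ne, Sym2.mem_iff] at h4
            rcases h4 with h4 | h4
            · exact sideVertex_ne_self _ _ h4.symm
            · simp [Prod.ext_iff] at h4
          obtain ⟨k, c, τ, hk, hkd, hkP, huk⟩ := matching_exists hP h1 hn
            (G.isCorner_of_mem_ends hA)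
          rcases lt_trichotomy k (n + 1) with hlt | rfl | hgt
          · have hnε := hε n (by omega) (by omega)
            have hen := hε.edge_succ_sw (i := n) (by omega) (by omega)
            have hmn : G.code ε P n = ε n := by
              refine ih.eq_of_mem hε (by omega) (by omega) hk (by omega) hkP huk ?_ ?_
              · rw [← hen]; exact hA
              · intro h4
                rw [h4, ← hen] at hkP
                exact hsw hkP
            obtain ⟨j, c', ρ, hj, hjn, hjP, huj⟩ := ih.exists_mem hε hP (by omega) (by omega)
              hmn (u := sideVertex (G.tile (n + 1)) (ε n)) (by
                rw [← hen, edge, ends_sideOfSign_sw]; exact Sym2.mem_mk_right _ _)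
            obtain ⟨-, ⟨h4, -⟩ | ⟨-, h4, -⟩ | ⟨-, -, h4, -⟩⟩ :=
              G.edge_eq_edge hj (by omega) (matching_unique hP hjP h3 huj hW)
            · omega
            · cases h4
            · omega
          · cases c
            · rcases units_eq_or_eq_neg τ (ε n) with rfl | rfl
              · exact hsw hkP
              · exact hx hkP
            · exact hA' _ huk
          · exact hA' _ (G.mem_ends_of_isCorner h1 hgt (G.isCorner_of_mem_ends hA)
              (G.isCorner_of_mem_ends huk)).1
      · rcases Nat.lt_or_ge i n with h4 | h4
        · exact ih.step i h1 h4 h3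
        · have : i = n := by omega
          subst this
          exact hval

theorem code_admissible (hε : G.IsSigns ε) (hP : P ∈ G.matchings) :
    Admissible G.d ε (G.code ε P) := by
  have h := chosenUpTo_code hε hP G.d le_rfl
  refine ⟨h.first, ?_, h.step⟩
  rw [code, if_neg (by omega), if_pos (by omega)]

theorem ofCode_code (hε : G.IsSigns ε) (hP : P ∈ G.matchings) :
    G.ofCode ε (G.code ε P) = P := by
  refine (eq_of_subset_of_mem_matchings hP (ofCode_mem_matchings hε (code_admissible hε hP))
    fun e he => ?_).symm
  obtain ⟨i, c, σ, hi, hid, rfl⟩ := G.mem_edgesOn_iff.1 (hP.1 he)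
  have h := (chosenUpTo_code hε hP G.d le_rfl).selected hε le_rfl hi hid he
  refine ⟨i, c, σ, hi, hid, rfl, ?_⟩
  have ha := code_admissible hε hP
  have ht : ∀ j ≤ G.d + 1, truncate ε (G.code ε P) G.d j = G.code ε P j := by
    intro j hj
    rcases Nat.lt_or_ge G.d j with h1 | h1
    · have : j = G.d + 1 := by omega
      subst this
      rw [truncate_succ, ha.last]
    · exact truncate_of_le h1
  cases c <;> simp only [Selected] at h ⊢
  · rwa [ht _ (by omega), ht _ (by omega)] at h
  · rwa [ht _ (by omega), ht _ (by omega)] at h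

theorem exists_code (hε : G.IsSigns ε) (hP : P ∈ G.matchings) :
    ∃ m, Admissible G.d ε m ∧ P = G.ofCode ε m :=
  ⟨_, code_admissible hε hP, (ofCode_code hε hP).symm⟩

/-- The auxiliary values of the signs and codes beyond the tiles have no influence: at each end the
convention makes the second condition in `Selected` automatic. -/
theorem ofCode_congr {ε' m' : ℕ → ℤˣ} (hε : G.IsSigns ε) (hε' : G.IsSigns ε')
    (hm : Admissible G.d ε m) (hm' : Admissible G.d ε' m')
    (h : ∀ i, 1 ≤ i → i ≤ G.d → m i = m' i) : G.ofCode ε m = G.ofCode ε' m' := by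
  refine eq_of_subset_of_mem_matchings (ofCode_mem_matchings hε hm)
    (ofCode_mem_matchings hε' hm') ?_
  rintro e ⟨i, c, σ, hi, hid, rfl, hs⟩
  refine ⟨i, c, σ, hi, hid, rfl, ?_⟩
  cases c
  · refine ⟨(h i hi hid).symm.trans hs.1, fun hσ => ?_⟩
    obtain ⟨k, rfl⟩ := Nat.exists_eq_add_of_le' hi
    rw [Nat.add_sub_cancel] at hσ ⊢
    rcases Nat.eq_zero_or_pos k with rfl | hk
    · rw [hm'.first, hσ]
    · rw [← h k hk (by omega)]
      refine hs.2 ?_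
      rw [← hσ, Nat.add_sub_cancel, hε k hk (by omega), hε' k hk (by omega)]
  · refine ⟨(h i hi hid).symm.trans hs.1, fun hσ => ?_⟩
    rcases hid.eq_or_lt with rfl | hk
    · rw [hm'.last, hσ]
    · rw [← h (i + 1) (by omega) hk]
      refine hs.2 ?_
      rw [← hσ, hε i hi hk, hε' i hi hk]

end SnakeGraph
end SnakeCalculus

/-! ### Edges of a band graph, and matchings after glueing -/

namespace SnakeCalculus

namespace BandGraph

variable {B : BandGraph}

/-- The sign of the interior edge between the `j`-th tile and the next; the tiles are counted
cyclically. -/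
def cyclicSgn (B : BandGraph) (j : ℕ) : ℤˣ := B.sgn (j % B.p)

theorem cyclicSgn_periodic (B : BandGraph) : Function.Periodic B.cyclicSgn B.p := by
  intro j
  simp [cyclicSgn]

theorem isSigns_cut (B : BandGraph) (k : ℕ) :
    (B.cut k).IsSigns (fun i => B.cyclicSgn (k + i)) := fun i hi _ =>
  (SnakeGraph.sgn_ofSigns B.p B.one_le_p (fun i => B.sgn ((k + i) % B.p)) i hi).symm

theorem isSigns_cut_zero (B : BandGraph) : (B.cut 0).IsSigns B.cyclicSgn := by
  have h := B.isSigns_cut 0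
  simpa using h

open Classical in
/-- A lattice edge, with the two copies of the glueing edge identified. -/
noncomputable def representative (B : BandGraph) : B.BEdge → Edge :=
  Quot.lift (fun e => if e = B.glueFirst then B.glueLast else e) (by
    rintro e f ⟨rfl, rfl⟩
    by_cases h : B.glueLast = B.glueFirst <;> simp [h])

open Classical in
theorem representative_mk (e : Edge) :
    B.representative (Quot.mk _ e) = if e = B.glueFirst then B.glueLast else e := rfl

theorem cut_edge_eq_glueFirst {n : ℕ} {c : Corner} {σ : ℤˣ}
    (h : (B.cut 0).edge (n + 1) c σ = B.glueFirst) : n = 0 ∧ c = .sw ∧ σ = B.sgn 0 := by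
  obtain ⟨h1, ⟨h2, h3⟩ | ⟨-, -, h2, -⟩ | ⟨-, h2, -⟩⟩ :=
    (B.cut 0).edge_eq_edge (Nat.le_add_left 1 n) le_rfl h
  · exact ⟨by omega, h3, h1⟩
  · omega
  · cases h2

theorem cut_edge_eq_glueLast {n : ℕ} {c : Corner} {σ : ℤˣ} (hn : n < B.p)
    (h : (B.cut 0).edge (n + 1) c σ = B.glueLast) : n + 1 = B.p ∧ c = .ne ∧ σ = B.sgn 0 := by
  obtain ⟨h1, ⟨h2, h3⟩ | ⟨-, h2, -⟩ | ⟨-, -, h2, -⟩⟩ :=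
    (B.cut 0).edge_eq_edge (Nat.le_add_left 1 n) B.one_le_p h
  · exact ⟨h2, h3, h1⟩
  · cases h2
  · omega

theorem edge_congr {n n' : ℕ} (h : n ≡ n' [MOD B.p]) (c : Corner) (σ : ℤˣ) :
    B.edge n c σ = B.edge n' c σ := by
  unfold edge
  rw [show n % B.p = n' % B.p from h]

/-- Inside the cut snake graph this is the common edge of two tiles; at the last tile it is the
glueing relation. -/
theorem edge_succ_sw (n : ℕ) :
    B.edge (n + 1) .sw (B.cyclicSgn (n + 1)) = B.edge n .ne (B.cyclicSgn (n + 1)) := by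
  have hlt := Nat.mod_lt n B.one_le_p
  rcases Nat.lt_or_ge (n % B.p + 1) B.p with h | h
  · have h1 : (n + 1) % B.p = n % B.p + 1 := by
      rw [Nat.add_mod, Nat.mod_eq_of_lt (a := 1) (by omega), Nat.mod_eq_of_lt h]
    have h2 := (B.isSigns_cut_zero).edge_succ_sw (i := n % B.p + 1) (by omega) h
    unfold edge cyclicSgn at *
    rw [h1, Nat.mod_eq_of_lt h] at *
    rw [h2]
  · have h0 : n % B.p + 1 = B.p := by omega
    have h1 : (n + 1) % B.p = 0 := by
      rw [← Nat.mod_add_mod, h0, Nat.mod_self]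
    unfold edge cyclicSgn
    rw [h1, h0]
    exact Quot.sound ⟨rfl, rfl⟩

/-- Cyclic version of `SnakeGraph.edge_eq_edge`. Since `representative` is defined on the quotient,
an equality of glued edges becomes one of lattice edges, with cases according to which of the two is
the first glueing edge. -/
theorem edge_eq_edge {n n' : ℕ} {c c' : Corner} {σ τ : ℤˣ}
    (h : B.edge n c σ = B.edge n' c' τ) :
    σ = τ ∧ ((n ≡ n' [MOD B.p] ∧ c = c') ∨
      (c = .ne ∧ c' = .sw ∧ n' ≡ n + 1 [MOD B.p] ∧ σ = B.cyclicSgn (n + 1)) ∨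
      (c = .sw ∧ c' = .ne ∧ n ≡ n' + 1 [MOD B.p] ∧ σ = B.cyclicSgn (n' + 1))) := by
  have hlt := Nat.mod_lt n B.one_le_p
  have hlt' := Nat.mod_lt n' B.one_le_p
  have glue : ∀ {m : ℕ}, m % B.p + 1 = B.p → m + 1 ≡ 0 [MOD B.p] := by
    intro m hm
    rw [Nat.ModEq, ← Nat.mod_add_mod, hm, Nat.mod_self, Nat.zero_mod]
  have hr := congrArg B.representative h
  unfold edge at hr
  rw [representative_mk, representative_mk] at hr
  split_ifs at hr with h1 h2 h2
  · obtain ⟨h3, rfl, rfl⟩ := cut_edge_eq_glueFirst h1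
    obtain ⟨h4, rfl, rfl⟩ := cut_edge_eq_glueFirst h2
    exact ⟨rfl, Or.inl ⟨h3.trans h4.symm, rfl⟩⟩
  · obtain ⟨h3, rfl, rfl⟩ := cut_edge_eq_glueFirst h1
    obtain ⟨h4, rfl, rfl⟩ := cut_edge_eq_glueLast hlt' hr.symm
    have h5 := glue h4
    refine ⟨rfl, Or.inr (Or.inr ⟨rfl, rfl, ?_, ?_⟩)⟩
    · exact (show n ≡ 0 [MOD B.p] from by rw [Nat.ModEq, h3, Nat.zero_mod]).trans h5.symm
    · rw [cyclicSgn, show (n' + 1) % B.p = 0 from Eq.trans h5 (Nat.zero_mod _)]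
  · obtain ⟨h3, rfl, rfl⟩ := cut_edge_eq_glueFirst h2
    obtain ⟨h4, rfl, rfl⟩ := cut_edge_eq_glueLast hlt hr
    have h5 := glue h4
    refine ⟨rfl, Or.inr (Or.inl ⟨rfl, rfl, ?_, ?_⟩)⟩
    · exact (show n' ≡ 0 [MOD B.p] from by rw [Nat.ModEq, h3, Nat.zero_mod]).trans h5.symm
    · rw [cyclicSgn, show (n + 1) % B.p = 0 from Eq.trans h5 (Nat.zero_mod _)]
  · have key : ∀ {a b : ℕ}, b % B.p < B.p → b % B.p + 1 = a % B.p + 1 + 1 →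
        b ≡ a + 1 [MOD B.p] ∧ (B.cut 0).sgn (a % B.p + 1) = B.cyclicSgn (a + 1) := by
      intro a b hb hab
      have h3 : (a + 1) % B.p = b % B.p := by
        rw [← Nat.mod_add_mod, show a % B.p + 1 = b % B.p by omega, Nat.mod_mod]
      refine ⟨h3.symm, ?_⟩
      rw [← B.isSigns_cut_zero _ (by omega) (show a % B.p + 1 < B.p by omega)]
      rw [cyclicSgn, cyclicSgn, Nat.mod_add_mod]
    obtain ⟨h3, ⟨h4, h5⟩ | ⟨h4, h5, h6, h7⟩ | ⟨h4, h5, h6, h7⟩⟩ :=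
      (B.cut 0).edge_eq_edge (Nat.le_add_left 1 _) (Nat.le_add_left 1 _) hr
    · exact ⟨h3, Or.inl ⟨by rw [Nat.ModEq]; omega, h5⟩⟩
    · have := key hlt' h6
      exact ⟨h3, Or.inr (Or.inl ⟨h4, h5, this.1, h7.trans this.2⟩)⟩
    · have := key hlt h6
      exact ⟨h3, Or.inr (Or.inr ⟨h4, h5, this.1, h7.trans this.2⟩)⟩

/-- The cyclic sequence `m` describes a good matching of the band graph. -/
structure Admissible (B : BandGraph) (m : ℕ → ℤˣ) : Prop where
  periodic : Function.Periodic m B.p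
  step : ∀ i, m i = B.cyclicSgn i → m (i + 1) = B.cyclicSgn i

/-- The set of edges which are chosen in all tiles containing them. -/
def ofCode (B : BandGraph) (m : ℕ → ℤˣ) : Set B.BEdge :=
  {x | ∃ j c σ, x = B.edge j c σ ∧ Selected B.cyclicSgn m (j + 1) c σ}

variable {m : ℕ → ℤˣ}

theorem _root_.Function.Periodic.congr_nat {α : Type*} {f : ℕ → α} {p : ℕ}
    (h : Function.Periodic f p) {i j : ℕ} (hij : i ≡ j [MOD p]) : f i = f j := by
  rw [← h.map_mod_nat, ← h.map_mod_nat j, hij]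

theorem selected_congr (hm : Function.Periodic m B.p) {i j : ℕ} (hij : i ≡ j [MOD B.p])
    (c : Corner) (σ : ℤˣ) :
    Selected B.cyclicSgn m (i + 1) c σ ↔ Selected B.cyclicSgn m (j + 1) c σ := by
  have h2 : i + 1 ≡ j + 1 [MOD B.p] := hij.add_right 1
  have h3 : i + 1 + 1 ≡ j + 1 + 1 [MOD B.p] := h2.add_right 1
  cases c <;> simp only [Selected, Nat.add_sub_cancel]
  · rw [hm.congr_nat h2, hm.congr_nat hij, B.cyclicSgn_periodic.congr_nat hij]
  · rw [hm.congr_nat h2, hm.congr_nat h3, B.cyclicSgn_periodic.congr_nat h2]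

theorem edge_mem_ofCode (hm : Function.Periodic m B.p) {i : ℕ} {c : Corner} {σ : ℤˣ} :
    B.edge i c σ ∈ B.ofCode m ↔ Selected B.cyclicSgn m (i + 1) c σ := by
  constructor
  · rintro ⟨j, c', τ, h, hs⟩
    obtain ⟨rfl, ⟨h1, rfl⟩ | ⟨rfl, rfl, h1, h2⟩ | ⟨rfl, rfl, h1, h2⟩⟩ := edge_eq_edge h
    · exact (selected_congr hm h1 _ _).2 hs
    · rw [selected_congr hm h1] at hs
      exact ⟨hs.2 h2.symm, fun _ => hs.1⟩
    · rw [selected_congr hm h1]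
      exact ⟨hs.2 h2.symm, fun _ => hs.1⟩
  · intro h
    exact ⟨i, c, σ, rfl, h⟩

theorem ne_mem_ofCode_iff (hm : Function.Periodic m B.p) {i : ℕ} :
    B.edge i .ne (-B.cyclicSgn (i + 1)) ∈ B.ofCode m ↔ m (i + 1) = B.cyclicSgn (i + 1) := by
  rw [edge_mem_ofCode hm]
  simp [Selected]

theorem inc_graph_iff {e : B.BEdge} {v : B.Vert} :
    B.graph.Inc e v ↔ e ∈ B.graph.edgeSet ∧ v ∈ B.ends e := by
  constructor
  · rintro ⟨y, h1, h2⟩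
    exact ⟨h1, by rw [h2]; exact Sym2.mem_mk_left _ _⟩
  · rintro ⟨h1, h2⟩
    obtain ⟨y, hy⟩ := h2
    exact ⟨y, h1, hy⟩

theorem mem_ends_mk_iff {e : Edge} {v : B.Vert} :
    v ∈ B.ends (Quot.mk _ e) ↔ ∃ u ∈ e.ends, Quot.mk _ u = v := Sym2.mem_map

open Classical in
/-- Removing one end edge `e₀` from a perfect matching, where the end points `x`, `y` of `e₀` are
glued to the end points `x'`, `y'` of the other end edge. -/
theorem isPerfectMatching_image {Q : Set Edge} {e₀ : Edge} (hQ : Q ∈ (B.cut 0).matchings)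
    (he₀ : e₀ ∈ Q) {x y x' y' : ℤ × ℤ} (hends : e₀.ends = s(x, y)) (hxy : x ≠ y)
    (hx' : x' ∉ e₀.ends) (hy' : y' ≠ y)
    (hxV : x' ∈ (B.cut 0).graph.vertexSet) (hyV : y' ∈ (B.cut 0).graph.vertexSet)
    (hrel : ∀ u v, B.VertexRel u v → (u = x ∧ v = x') ∨ (u = y ∧ v = y') ∨
      (u = x' ∧ v = x) ∨ (u = y' ∧ v = y))
    (hx : (Quot.mk _ x : B.Vert) = Quot.mk _ x') (hy : (Quot.mk _ y : B.Vert) = Quot.mk _ y') :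
    IsPerfectMatching B.graph (Quot.mk _ '' (Q \ {e₀})) := by
  have hq : ∀ u, ∃ q, u ∈ (B.cut 0).graph.vertexSet → q ∈ Q ∧ u ∈ q.ends := by
    intro u
    by_cases h : u ∈ (B.cut 0).graph.vertexSet
    · obtain ⟨q, ⟨h1, h2⟩, -⟩ := hQ.2 u h
      exact ⟨q, fun _ => ⟨h1, (SnakeGraph.inc_graph_iff.1 h2).2⟩⟩
    · exact ⟨e₀, fun h' => absurd h' h⟩
  choose q hq using hq
  have hqu : ∀ u f, f ∈ Q → u ∈ f.ends → q u = f := by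
    intro u f hf hu
    have hu' := hq u ⟨f, hQ.1 hf, hu⟩
    exact SnakeGraph.matching_unique hQ hu'.1 hf hu'.2 hu
  have hmem : ∀ u, u ∈ e₀.ends ↔ u = x ∨ u = y := by
    intro u; rw [hends, Sym2.mem_iff]
  -- H assigns to a vertex the remaining edge of Q that covers its class. The end points x and y of
  -- the removed edge receive the edge of the vertex they are glued to. For a single tile `y' = x`
  -- can occur; then x', x and y form one class, and x' decides.
  let H : ℤ × ℤ → B.BEdge := fun u => Quot.mk _ <|
    if u = x then q x' else if u = y then (if y' = x then q x' else q y') else q u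
  have hx'1 : x' ≠ x := fun h => hx' ((hmem _).2 (Or.inl h))
  have hx'2 : x' ≠ y := fun h => hx' ((hmem _).2 (Or.inr h))
  have Hx : H x = H x' := by simp [H, hx'1, hx'2]
  have Hy : H y = H y' := by
    by_cases h : y' = x <;> simp [H, h, hxy.symm, hy']
  have Hlift : ∀ u v, B.VertexRel u v → H u = H v := by
    intro u v huv
    rcases hrel u v huv with ⟨rfl, rfl⟩ | ⟨rfl, rfl⟩ | ⟨rfl, rfl⟩ | ⟨rfl, rfl⟩
    exacts [Hx, Hy, Hx.symm, Hy.symm]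
  have Hf : ∀ f ∈ Q, f ≠ e₀ → ∀ u ∈ f.ends, H u = Quot.mk _ f := by
    intro f hf hne u hu
    have h : u ∉ e₀.ends := fun h => hne (SnakeGraph.matching_unique hQ hf he₀ hu h)
    rw [hmem] at h
    push Not at h
    simp [H, h.1, h.2, hqu u f hf hu]
  have hne : ∀ u, u ∈ (B.cut 0).graph.vertexSet → u ∉ e₀.ends → q u ≠ e₀ :=
    fun u hu h1 h2 => h1 (h2 ▸ (hq u hu).2)
  refine ⟨?_, ?_⟩
  · rintro _ ⟨f, hf, rfl⟩
    exact ⟨f, hQ.1 hf.1, rfl⟩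
  rintro _ ⟨u, hu, rfl⟩
  have hex : ∃ f ∈ Q, f ≠ e₀ ∧ ∃ w ∈ f.ends, (Quot.mk _ w : B.Vert) = Quot.mk _ u := by
    have hx1 := hq x' hxV
    by_cases h : u ∈ e₀.ends
    · rcases (hmem u).1 h with rfl | rfl
      · exact ⟨q x', hx1.1, hne _ hxV hx', x', hx1.2, hx.symm⟩
      · by_cases h1 : y' = x
        · exact ⟨q x', hx1.1, hne _ hxV hx', x', hx1.2, by rw [hy, h1, hx]⟩
        · have hy1 := hq y' hyV
          refine ⟨q y', hy1.1, hne _ hyV ?_, y', hy1.2, hy.symm⟩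
          rw [hmem]
          push Not
          exact ⟨h1, hy'⟩
    · have hu1 := hq u hu
      exact ⟨q u, hu1.1, hne _ hu h, u, hu1.2, rfl⟩
  obtain ⟨f, hf, hfe, w, hw, hwu⟩ := hex
  refine ⟨Quot.mk _ f, ⟨⟨f, ⟨hf, hfe⟩, rfl⟩, inc_graph_iff.2 ⟨⟨f, hQ.1 hf, rfl⟩,
    mem_ends_mk_iff.2 ⟨w, hw, hwu⟩⟩⟩, ?_⟩
  rintro _ ⟨⟨f', ⟨hf', hfe'⟩, rfl⟩, hi⟩
  obtain ⟨w', hw', hwu'⟩ := mem_ends_mk_iff.1 (inc_graph_iff.1 hi).2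
  rw [← Hf f hf hfe w hw, ← Hf f' hf' hfe' w' hw']
  -- Since H is constant on glued vertices, it descends to the band graph, and two edges at the same
  -- glued vertex coincide.
  have := congrArg (Quot.lift H Hlift) (hwu'.trans hwu.symm)
  exact this

theorem ofCut_zero {Q : Set Edge} (hQ : Q ⊆ (B.cut 0).edgesOn 1 B.p) :
    B.ofCut 0 Q = Quot.mk _ '' Q := by
  ext x
  constructor
  · rintro ⟨i, c, σ, hi, he, rfl⟩
    refine ⟨_, he, ?_⟩
    rw [edge, Nat.zero_add, Nat.mod_eq_of_lt hi]
  · rintro ⟨e, he, rfl⟩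
    obtain ⟨j, c, σ, h1, h2, rfl⟩ := (B.cut 0).mem_edgesOn_iff.1 (hQ he)
    obtain ⟨i, rfl⟩ := Nat.exists_eq_add_of_le' h1
    refine ⟨i, c, σ, h2, he, ?_⟩
    rw [edge, Nat.zero_add, Nat.mod_eq_of_lt h2]

/-- Removing an end edge of a perfect matching gives a perfect matching of the band graph. -/
theorem isPerfectMatching_ofCut_zero {Q : Set Edge} {e₀ : Edge}
    (hQ : Q ∈ (B.cut 0).matchings) (he₀ : e₀ ∈ Q)
    (h : e₀ = B.glueFirst ∨ e₀ = B.glueLast) :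
    IsPerfectMatching B.graph (B.ofCut 0 (Q \ {e₀})) := by
  rw [ofCut_zero (fun e he => hQ.1 he.1)]
  have hp := B.one_le_p
  have hF : B.glueFirst ∈ (B.cut 0).edgesOn 1 B.p :=
    (B.cut 0).mem_edgesOn_iff.2 ⟨1, _, _, le_rfl, hp, rfl⟩
  have hL : B.glueLast ∈ (B.cut 0).edgesOn 1 B.p :=
    (B.cut 0).mem_edgesOn_iff.2 ⟨B.p, _, _, hp, le_rfl, rfl⟩
  have hmkb : (Quot.mk _ B.glueFirst.base : B.Vert) = Quot.mk _ B.glueLast.base :=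
    Quot.sound (Or.inl ⟨rfl, rfl⟩)
  have hmkt : (Quot.mk _ B.glueFirst.tip : B.Vert) = Quot.mk _ B.glueLast.tip :=
    Quot.sound (Or.inr ⟨rfl, rfl⟩)
  have hFb : B.glueFirst.base = (B.cut 0).tile 1 := base_sideOfSign_sw _ _
  have hFt : B.glueFirst.tip = sideVertex ((B.cut 0).tile 1) (B.sgn 0) := tip_sideOfSign_sw _ _
  have hLb : B.glueLast.base = sideVertex ((B.cut 0).tile B.p) (B.sgn 0) :=
    base_sideOfSign_ne _ _
  have hLt : B.glueLast.tip = (B.cut 0).tile B.p + (1, 1) := tip_sideOfSign_ne _ _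
  -- The end points of the first glueing edge have levels 0 and 1, those of the last one p and p +
  -- 1. All required inequalities of vertices follow from levels.
  have s1 := (B.cut 0).tile_sum 1 le_rfl
  have s2 := (B.cut 0).tile_sum B.p hp
  have s3 := sideVertex_sum ((B.cut 0).tile 1) (B.sgn 0)
  have s4 := sideVertex_sum ((B.cut 0).tile B.p) (B.sgn 0)
  rw [← hFt, ← hFb] at s3
  rw [← hFb] at s1
  rw [← hLb] at s4
  have s5 : B.glueLast.tip.1 + B.glueLast.tip.2 =
      ((B.cut 0).tile B.p).1 + ((B.cut 0).tile B.p).2 + 2 := by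
    rw [hLt]; simp only [Prod.fst_add, Prod.snd_add]; ring
  have ne_of : ∀ {u v : ℤ × ℤ}, u.1 + u.2 ≠ v.1 + v.2 → u ≠ v := by
    rintro u v h rfl; exact h rfl
  have memb : ∀ e : Edge, e.base ∈ e.ends := fun e => Sym2.mem_mk_left _ _
  have memt : ∀ e : Edge, e.tip ∈ e.ends := fun e => Sym2.mem_mk_right _ _
  rcases h with rfl | rfl
  -- The tip plays the role of x because for p = 1 it is also the base of the last glueing edge;
  -- then x' is off `e₀` and `y' ≠ y` in all cases.
  · refine isPerfectMatching_image hQ he₀ (x := B.glueFirst.tip) (y := B.glueFirst.base)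
      (x' := B.glueLast.tip) (y' := B.glueLast.base) Sym2.eq_swap
      (ne_of (by omega)) ?_ (ne_of (by omega)) ⟨_, hL, memt _⟩ ⟨_, hL, memb _⟩ ?_ hmkt hmkb
    · intro h
      rcases Sym2.mem_iff.1 h with h | h
      · exact ne_of (by omega) h
      · exact ne_of (by omega) h
    · rintro u v (⟨rfl, rfl⟩ | ⟨rfl, rfl⟩) <;> simp
  · refine isPerfectMatching_image hQ he₀ (x := B.glueLast.base) (y := B.glueLast.tip)
      (x' := B.glueFirst.base) (y' := B.glueFirst.tip) rfl
      (ne_of (by omega)) ?_ (ne_of (by omega)) ⟨_, hF, memb _⟩ ⟨_, hF, memt _⟩ ?_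
      hmkb.symm hmkt.symm
    · intro h
      rcases Sym2.mem_iff.1 h with h | h
      · exact ne_of (by omega) h
      · exact ne_of (by omega) h
    · rintro u v (⟨rfl, rfl⟩ | ⟨rfl, rfl⟩) <;> simp

end BandGraph
end SnakeCalculus

/-! ### Good matchings of a band graph as periodic codes -/

namespace SnakeCalculus
namespace BandGraph

variable {B : BandGraph}

/-- Cutting the band graph along `e_k` and removing one of the copies of `e_k`. -/
theorem ofCut_diff_eq_ofCode {k : ℕ} {m μ : ℕ → ℤˣ} {e₀ : Edge}
    (hm : Function.Periodic m B.p)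
    (hμ : SnakeCalculus.Admissible B.p (fun i => B.cyclicSgn (k + i)) μ)
    (hmμ : ∀ i, 1 ≤ i → i ≤ B.p → m (k + i) = μ i)
    (he₀ : (e₀ = (B.cut k).edge 1 .sw (B.cyclicSgn k) ∧ μ 1 = B.cyclicSgn k) ∨
      (e₀ = (B.cut k).edge B.p .ne (B.cyclicSgn k) ∧ μ B.p = -B.cyclicSgn k)) :
    B.ofCut k ((B.cut k).ofCode (fun i => B.cyclicSgn (k + i)) μ \ {e₀}) = B.ofCode m := by
  have hp := B.one_le_p
  have hε := B.isSigns_cut k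
  have hper : B.cyclicSgn (k + B.p) = B.cyclicSgn k := B.cyclicSgn_periodic k
  have hmper : m (k + B.p) = m k := hm k
  have hmp : m k = μ B.p := hmper.symm.trans (hmμ _ hp le_rfl)
  have h1p : m (k + 1) = μ 1 := hmμ _ le_rfl hp
  have hfirst : μ 0 = -B.cyclicSgn k := hμ.first
  have hlast : μ (B.p + 1) = B.cyclicSgn k := hμ.last.trans hper
  have hmem : ∀ {i c σ}, i < B.p →
      ((B.cut k).edge (i + 1) c σ ∈ (B.cut k).ofCode (fun i => B.cyclicSgn (k + i)) μ ↔
        Selected (fun i => B.cyclicSgn (k + i)) μ (i + 1) c σ) := fun hi =>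
    SnakeGraph.edge_mem_ofCode hε (by omega) hi
  ext x
  constructor
  · rintro ⟨i, c, σ, hi, ⟨he, hne⟩, rfl⟩
    rw [edge_mem_ofCode hm]
    rw [hmem hi] at he
    cases c
    · refine ⟨(hmμ (i + 1) (by omega) hi).trans he.1, fun hσ => ?_⟩
      rw [Nat.add_sub_cancel] at hσ ⊢
      rcases Nat.eq_zero_or_pos i with rfl | h0
      · rw [Nat.add_zero] at hσ ⊢
        subst hσ
        rcases he₀ with ⟨rfl, -⟩ | ⟨rfl, h2⟩
        · exact absurd rfl hne
        · rw [hmp, h2]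
      · rw [hmμ i h0 hi.le]
        exact he.2 hσ
    · refine ⟨(hmμ (i + 1) (by omega) hi).trans he.1, fun hσ => ?_⟩
      rcases Nat.lt_or_ge (i + 1) B.p with h0 | h0
      · have := hmμ (i + 2) (by omega) h0
        exact this.trans (he.2 hσ)
      · have hip : i + 1 = B.p := by omega
        have h3 : k + i + 1 = k + B.p := by omega
        rw [h3, hper] at hσ
        subst hσ
        have h4 : m (k + i + 1 + 1) = μ 1 := by
          rw [h3, show k + B.p + 1 = (k + 1) + B.p by ring, hm, h1p]
        rcases he₀ with ⟨rfl, h2⟩ | ⟨rfl, -⟩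
        · rw [h4, h2]
        · rw [hip] at hne
          exact absurd rfl hne
  · rintro ⟨j, c, σ, rfl, hs⟩
    have hj : ∃ i < B.p, j ≡ k + i [MOD B.p] := by
      -- Modulo p, the number `(B.p - 1) * k` stands for -k without leaving the natural numbers.
      refine ⟨(j + (B.p - 1) * k) % B.p, Nat.mod_lt _ hp, ?_⟩
      have h1 : k + (j + (B.p - 1) * k) = j + B.p * k := by
        obtain ⟨q, hq⟩ := Nat.exists_eq_add_of_le' hp
        rw [hq, Nat.add_sub_cancel]; ring
      have h2 : k + (j + (B.p - 1) * k) % B.p ≡ k + (j + (B.p - 1) * k) [MOD B.p] :=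
        (Nat.mod_modEq _ _).add_left k
      rw [h1] at h2
      refine Nat.ModEq.symm (h2.trans ?_)
      simp [Nat.ModEq]
    obtain ⟨i, hi, hji⟩ := hj
    rw [selected_congr hm hji] at hs
    rw [edge_congr hji]
    have hsel : Selected (fun i => B.cyclicSgn (k + i)) μ (i + 1) c σ := by
      cases c
      · refine ⟨(hmμ (i + 1) (by omega) hi).symm.trans hs.1, fun hσ => ?_⟩
        rw [Nat.add_sub_cancel] at hσ ⊢
        rcases Nat.eq_zero_or_pos i with rfl | h0
        · rw [hfirst, ← hσ]; rfl
        · rw [← hmμ i h0 hi.le]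
          exact hs.2 hσ
      · refine ⟨(hmμ (i + 1) (by omega) hi).symm.trans hs.1, fun hσ => ?_⟩
        rcases Nat.lt_or_ge (i + 1) B.p with h0 | h0
        · have := hmμ (i + 2) (by omega) h0
          exact this.symm.trans (hs.2 hσ)
        · have hip : i + 1 = B.p := by omega
          rw [hip] at hσ ⊢
          rw [hlast, ← hσ]
          exact hper.symm
    -- If the edge found is the removed copy of e_k, the copy at the other end is used instead. It
    -- is selected because the periodic code chooses e_k on both sides.
    by_cases hne : (B.cut k).edge (i + 1) c σ = e₀
    swap
    · exact ⟨i, c, σ, hi, ⟨(hmem hi).2 hsel, hne⟩, rfl⟩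
    rcases he₀ with ⟨rfl, h2⟩ | ⟨rfl, h2⟩
    · obtain ⟨rfl, ⟨h4, rfl⟩ | ⟨-, -, h4, -⟩ | ⟨-, h4, -⟩⟩ :=
        (B.cut k).edge_eq_edge (Nat.le_add_left 1 i) le_rfl hne
      · have : i = 0 := by omega
        subst this
        obtain ⟨q, hq⟩ := Nat.exists_eq_add_of_le' hp
        have hm1 : μ B.p = -B.cyclicSgn k := by rw [← hmp]; exact hs.2 rfl
        refine ⟨q, .ne, B.cyclicSgn k, by omega, ⟨(hmem (by omega)).2 ?_, ?_⟩, ?_⟩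
        · rw [← hq]
          exact ⟨hm1, fun _ => hlast⟩
        · intro h
          obtain ⟨-, ⟨-, h⟩ | ⟨-, -, h, -⟩ | ⟨h, -⟩⟩ :=
            (B.cut k).edge_eq_edge (Nat.le_add_left 1 q) le_rfl h
          · cases h
          · omega
          · cases h
        · have h5 := B.edge_succ_sw (k + q)
          rw [show k + q + 1 = k + B.p by omega, hper] at h5
          rw [← h5]
          exact edge_congr (by simp [Nat.ModEq]) _ _
      · omega
      · cases h4
    · obtain ⟨rfl, ⟨h4, rfl⟩ | ⟨-, h4, -⟩ | ⟨-, -, h4, -⟩⟩ :=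
        (B.cut k).edge_eq_edge (Nat.le_add_left 1 i) hp hne
      · have h3 : k + i + 1 = k + B.p := by omega
        have hm1 : μ 1 = B.cyclicSgn k := by
          rw [← h1p, ← hm, show k + 1 + B.p = k + i + 1 + 1 by omega]
          exact hs.2 (by rw [h3, hper])
        refine ⟨0, .sw, B.cyclicSgn k, hp, ⟨(hmem hp).2 ⟨hm1, fun _ => hfirst⟩, ?_⟩, ?_⟩
        · intro h
          obtain ⟨-, ⟨-, h⟩ | ⟨h, -⟩ | ⟨-, -, h, -⟩⟩ :=
            (B.cut k).edge_eq_edge (Nat.le_add_left 1 0) hp h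
          · cases h
          · cases h
          · omega
        · have h5 := B.edge_succ_sw (k + i)
          rw [h3, hper] at h5
          rw [← h5]
          exact edge_congr (by simp [Nat.ModEq]) _ _
      · cases h4
      · omega

theorem Admissible.cut {m : ℕ → ℤˣ} (h : B.Admissible m) :
    SnakeCalculus.Admissible B.p B.cyclicSgn
      (fun i => if i = 0 then -B.cyclicSgn 0 else if i ≤ B.p then m i else B.cyclicSgn 0) where
  first := if_pos rfl
  last := by
    have h1 : B.cyclicSgn B.p = B.cyclicSgn 0 := by
      have := B.cyclicSgn_periodic 0
      rwa [Nat.zero_add] at this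
    simp [h1]
  step i h1 h2 h3 := by
    have h4 : i ≠ 0 := by omega
    simp only [h4, h2.le, if_true, if_false] at h3
    simp only [show i + 1 ≠ 0 by omega, show i + 1 ≤ B.p by omega, if_true, if_false]
    exact h.step i h3

/-- Cut at e_0. If `m 0` equals the sign of e_0, admissibility makes the first tile choose its copy
of e_0; otherwise the last tile chooses its copy. Either copy is an end edge and is selected, so it
can serve as the removed edge `e₀`. -/
theorem ofCode_mem_matchings {m : ℕ → ℤˣ} (h : B.Admissible m) : B.ofCode m ∈ B.matchings := by
  have hp := B.one_le_p
  set μ : ℕ → ℤˣ :=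
    fun i => if i = 0 then -B.cyclicSgn 0 else if i ≤ B.p then m i else B.cyclicSgn 0 with hμdef
  have hμ : SnakeCalculus.Admissible B.p B.cyclicSgn μ := h.cut
  have hm : ∀ i, 1 ≤ i → i ≤ B.p → μ i = m i := by
    intro i h1 h2
    simp [hμdef, show i ≠ 0 by omega, h2]
  have hε := B.isSigns_cut_zero
  have hε' : (fun i => B.cyclicSgn (0 + i)) = B.cyclicSgn := by funext i; rw [Nat.zero_add]
  have h0p : m B.p = m 0 := by
    have := h.periodic 0
    rwa [Nat.zero_add] at this
  have hsgn : B.cyclicSgn 0 = B.sgn 0 := by simp [cyclicSgn]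
  have hQ := SnakeGraph.ofCode_mem_matchings hε hμ
  have key : ∃ e₀, (e₀ = (B.cut 0).edge 1 .sw (B.cyclicSgn 0) ∧ μ 1 = B.cyclicSgn 0) ∨
      (e₀ = (B.cut 0).edge B.p .ne (B.cyclicSgn 0) ∧ μ B.p = -B.cyclicSgn 0) := by
    rcases units_eq_or_eq_neg (m 0) (B.cyclicSgn 0) with h1 | h1
    · exact ⟨_, Or.inl ⟨rfl, by rw [hm 1 le_rfl hp]; exact h.step 0 h1⟩⟩
    · exact ⟨_, Or.inr ⟨rfl, by rw [hm B.p hp le_rfl, h0p, h1]⟩⟩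
  obtain ⟨e₀, he₀⟩ := key
  have hmem : e₀ ∈ (B.cut 0).ofCode B.cyclicSgn μ := by
    rcases he₀ with ⟨rfl, h1⟩ | ⟨rfl, h1⟩
    · exact (SnakeGraph.edge_mem_ofCode hε le_rfl hp).2 ⟨h1, fun _ => hμ.first⟩
    · refine (SnakeGraph.edge_mem_ofCode hε hp le_rfl).2 ⟨h1, fun h2 => ?_⟩
      rw [← h2]
      exact hμ.last
  have heq := ofCut_diff_eq_ofCode (k := 0) (m := m) (μ := μ) (e₀ := e₀) h.periodic
    (by rw [hε']; exact hμ) (fun i h1 h2 => by rw [Nat.zero_add, hm i h1 h2]) he₀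
  rw [hε'] at heq
  have hend : e₀ = B.glueFirst ∨ e₀ = B.glueLast := by
    rw [hsgn] at he₀
    exact he₀.imp And.left And.left
  refine ⟨heq ▸ isPerfectMatching_ofCut_zero hQ hmem hend, 0, hp, _, hQ, e₀, hmem, hend, heq.symm⟩

/-- The code of the cut snake graph is continued periodically. The admissibility rule across e_k is
not part of that code; it is supplied by the end edge `e₀` in Q. -/
theorem exists_code {P : Set B.BEdge} (hP : P ∈ B.matchings) :
    ∃ m, B.Admissible m ∧ P = B.ofCode m := by
  obtain ⟨-, k, hk, Q, hQ, e₀, he, hend, rfl⟩ := hP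
  have hp := B.one_le_p
  have hε := B.isSigns_cut k
  obtain ⟨μ, hμ, rfl⟩ := SnakeGraph.exists_code hε hQ
  have hsgn : B.sgn k = B.cyclicSgn k := by rw [cyclicSgn, Nat.mod_eq_of_lt hk]
  have hper : B.cyclicSgn (k + B.p) = B.cyclicSgn k := B.cyclicSgn_periodic k
  rw [hsgn] at hend
  have he₀ : (e₀ = (B.cut k).edge 1 .sw (B.cyclicSgn k) ∧ μ 1 = B.cyclicSgn k) ∨
      (e₀ = (B.cut k).edge B.p .ne (B.cyclicSgn k) ∧ μ B.p = -B.cyclicSgn k) := by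
    rcases hend with rfl | rfl
    · exact Or.inl ⟨rfl, ((SnakeGraph.edge_mem_ofCode hε le_rfl hp).1 he).1⟩
    · exact Or.inr ⟨rfl, ((SnakeGraph.edge_mem_ofCode hε hp le_rfl).1 he).1⟩
  -- The argument of μ is the index i between 1 and p with k + i congruent to j.
  let m : ℕ → ℤˣ := fun j => μ ((j + (B.p - 1 - k)) % B.p + 1)
  have hm : Function.Periodic m B.p := by
    intro j
    simp only [m]
    rw [show j + B.p + (B.p - 1 - k) = j + (B.p - 1 - k) + B.p by ring, Nat.add_mod_right]
  have hmμ : ∀ i, 1 ≤ i → i ≤ B.p → m (k + i) = μ i := by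
    intro i h1 h2
    simp only [m]
    rw [show k + i + (B.p - 1 - k) = (i - 1) + B.p by omega, Nat.add_mod_right,
      Nat.mod_eq_of_lt (by omega), Nat.sub_add_cancel h1]
  refine ⟨m, ⟨hm, fun j => ?_⟩, ofCut_diff_eq_ofCode hm hμ hmμ he₀⟩
  have hj : ∃ i, 1 ≤ i ∧ i ≤ B.p ∧ j ≡ k + i [MOD B.p] := by
    refine ⟨(j + (B.p - 1 - k)) % B.p + 1, by omega, Nat.mod_lt _ hp, ?_⟩
    have h2 : k + ((j + (B.p - 1 - k)) % B.p + 1) ≡ k + ((j + (B.p - 1 - k)) + 1) [MOD B.p] :=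
      ((Nat.mod_modEq _ _).add_right 1).add_left k
    rw [show k + ((j + (B.p - 1 - k)) + 1) = j + B.p by omega] at h2
    refine Nat.ModEq.symm (h2.trans ?_)
    simp [Nat.ModEq]
  obtain ⟨i, h1, h2, hji⟩ := hj
  rw [hm.congr_nat hji, hm.congr_nat (hji.add_right 1), B.cyclicSgn_periodic.congr_nat hji,
    hmμ i h1 h2]
  intro h3
  rcases h2.eq_or_lt with rfl | hlt
  · rw [hper] at h3 ⊢
    rw [show k + B.p + 1 = (k + 1) + B.p by ring, hm, hmμ 1 le_rfl hp]
    rcases he₀ with ⟨-, h4⟩ | ⟨-, h4⟩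
    · exact h4
    · exact absurd (h3.symm.trans h4) (units_ne_neg _)
  · rw [Nat.add_assoc, hmμ (i + 1) (by omega) hlt]
    exact hμ.step i h1 hlt h3

end BandGraph
end SnakeCalculus

/-! ### Periodicity of signs along the overlap -/

namespace SnakeCalculus

/-- The effect of a lattice motion on the direction of steps. -/
def Dir.map (r : Bool) : Dir → Dir
  | .east => if r then .north else .east
  | .north => if r then .east else .north

theorem motion_add_vec (r : Bool) (v q : ℤ × ℤ) (x : Dir) :
    motion r v (q + x.vec) = motion r v q + (x.map r).vec := by
  cases r <;> cases x <;> simp [motion, Dir.map, Dir.vec, Prod.ext_iff] <;> ring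

theorem Dir.vec_injective {x y : Dir} (h : x.vec = y.vec) : x = y := by
  cases x <;> cases y <;> simp [Dir.vec] at h ⊢

namespace SnakeGraph

variable (G : SnakeGraph)

/-- The sign of e_i is (-1)^i up to a factor given by the direction of the step. Moving p tiles on
contributes (-1)^p, and reflection exchanges the two directions, hence changes the sign. -/
theorem step_map_iff (r : Bool) (p i : ℕ) (hi : 1 ≤ i) :
    G.step (i + p) = (G.step i).map r ↔
      G.sgn (i + p) = (if r then -(p : ℤ).negOnePow else (p : ℤ).negOnePow) * G.sgn i := by
  rw [G.sgn_eq i hi, G.sgn_eq (i + p) (by omega)]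
  have h : ((i + p : ℕ) : ℤ).negOnePow = (p : ℤ).negOnePow * (i : ℤ).negOnePow := by
    rw [Nat.cast_add, Int.negOnePow_add, mul_comm]
  rw [h]
  generalize (p : ℤ).negOnePow = a
  generalize (i : ℤ).negOnePow = b
  cases r <;> cases G.step i <;> cases G.step (i + p) <;>
    simp [Dir.map]

variable {G}

theorem tile_add_succ {r : Bool} {v : ℤ × ℤ} {p i : ℕ} (hi : 1 ≤ i)
    (h : G.tile (i + p) = motion r v (G.tile i)) :
    G.tile (i + 1 + p) = motion r v (G.tile (i + 1)) ↔ G.step (i + p) = (G.step i).map r := by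
  rw [show i + 1 + p = i + p + 1 by ring, G.tile_succ i hi, G.tile_succ (i + p) (by omega), h,
    motion_add_vec, add_right_inj]
  exact ⟨Dir.vec_injective, fun h => by rw [h]⟩

theorem tile_add_of_succ {r : Bool} {v : ℤ × ℤ} {p i : ℕ} (hi : 1 ≤ i)
    (h : G.tile (i + 1 + p) = motion r v (G.tile (i + 1)))
    (hs : G.step (i + p) = (G.step i).map r) : G.tile (i + p) = motion r v (G.tile i) := by
  rw [show i + 1 + p = i + p + 1 by ring, G.tile_succ i hi, G.tile_succ (i + p) (by omega), hs,
    motion_add_vec] at h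
  exact add_right_cancel h

end SnakeGraph

namespace SelfCrossing

variable (X : SelfCrossing)

/-- The motion multiplies all signs in the overlap by one factor δ, and δ = 1 has to be shown.
Maximality says that the comparison by δ fails just beyond an end. Inserting a crossing condition
for that end and the condition `crossing_mid` gives δ = 1. If the overlap reaches both ends,
`sign_compatible` takes over. -/
theorem sgn_periodic {i : ℕ} (hs : X.s ≤ i) (ht : i < X.t) : X.G.sgn (i + X.p) = X.G.sgn i := by
  set δ : ℤˣ := if X.r then -(X.p : ℤ).negOnePow else (X.p : ℤ).negOnePow with hδ
  have hs1 := X.one_le_s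
  have hss := X.s_lt_s'
  have hst := X.s'_lt_t
  have hp : X.s' - X.s = X.p := rfl
  have hov := X.overlap
  rw [hp] at hov
  have h1 : ∀ j, X.s ≤ j → j < X.t → X.G.sgn (j + X.p) = δ * X.G.sgn j := by
    intro j h1 h2
    rw [← X.G.step_map_iff X.r X.p j (by omega),
      ← SnakeGraph.tile_add_succ (by omega) (hov j h1 h2.le)]
    exact hov (j + 1) (by omega) h2
  suffices δ = 1 by rw [h1 i hs ht, this, one_mul]
  have hL : 1 < X.s → X.G.sgn (X.s' - 1) = -(δ * X.G.sgn (X.s - 1)) := by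
    intro h2
    obtain ⟨q, hq⟩ := Nat.exists_eq_add_of_le' hs1
    have h3 := X.maximal_left
    have hs' : X.s' - 1 = q + X.p := by omega
    have hsq : X.s - 1 = q := by omega
    rw [hs', hsq] at h3 ⊢
    rw [units_eq_neg_iff_ne, Ne, ← X.G.step_map_iff X.r X.p q (by omega)]
    intro h4
    exact h3 ⟨h2, SnakeGraph.tile_add_of_succ (by omega)
      (by rw [← hq]; exact hov X.s le_rfl (by omega)) h4⟩
  have hR : X.t + X.p < X.G.d → X.G.sgn (X.t + X.p) = -(δ * X.G.sgn X.t) := by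
    intro h2
    have h3 := X.maximal_right
    rw [hp] at h3
    rw [units_eq_neg_iff_ne, Ne, ← X.G.step_map_iff X.r X.p X.t (by omega),
      ← SnakeGraph.tile_add_succ (by omega) (hov X.t (by omega) le_rfl)]
    intro h4
    rw [show X.t + 1 + X.p = X.t + X.p + 1 by ring] at h4
    exact h3 ⟨h2, h4⟩
  have hends := X.crossing_ends
  have hmid := X.crossing_mid
  have hd := X.t'_le_d
  rw [hp] at hends hd
  by_cases h2 : 1 < X.s ∨ X.t + X.p < X.G.d
  · rcases hends h2 with ⟨h3, h4⟩ | ⟨h3, h4⟩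
    · have h5 := hL h3
      rw [← hmid, h4] at h5
      revert h5
      generalize X.G.sgn X.t = a
      generalize δ = b
      revert a b; decide
    · have h5 := hR h3
      rw [← hmid] at h4
      rw [h4] at h5
      revert h5
      generalize X.G.sgn (X.t + X.p) = a
      generalize δ = b
      revert a b; decide
  · push Not at h2
    have h3 := X.sign_compatible (by omega) (by rw [hp]; omega)
    have h4 := h1 X.s le_rfl (by omega)
    rw [show X.s + X.p = X.s' by omega, h3] at h4
    revert h4
    generalize X.G.sgn X.s = a
    generalize δ = b
    revert a b; decide

/-- The sign of the glueing edge of the band graph. -/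
def bandSign : ℤˣ := X.G.sgn (X.s' - 1)

/-- The motion preserves signs inside the overlap but does not extend to the left, so the sign must
change there. -/
theorem sgn_pred_s (h : 1 < X.s) : X.G.sgn (X.s - 1) = -X.bandSign := by
  have hss := X.s_lt_s'
  have hst := X.s'_lt_t
  have hp : X.s' - X.s = X.p := rfl
  have hper := X.sgn_periodic le_rfl (by omega)
  obtain ⟨q, hq⟩ := Nat.exists_eq_add_of_le' X.one_le_s
  have h3 := X.maximal_left
  have hs' : X.s' - 1 = q + X.p := by omega
  have hsq : X.s - 1 = q := by omega
  have hov := X.overlap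
  rw [hp] at hov
  have h5 : X.G.sgn (X.s + X.p) =
      (if X.r then -(X.p : ℤ).negOnePow else (X.p : ℤ).negOnePow) * X.G.sgn X.s := by
    rw [← X.G.step_map_iff X.r X.p X.s X.one_le_s,
      ← SnakeGraph.tile_add_succ X.one_le_s (hov X.s le_rfl (by omega))]
    exact hov (X.s + 1) (by omega) (by omega)
  have h6 : X.G.sgn (q + X.p) ≠
      (if X.r then -(X.p : ℤ).negOnePow else (X.p : ℤ).negOnePow) * X.G.sgn q := by
    rw [Ne, ← X.G.step_map_iff X.r X.p q (by omega)]
    intro h4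
    rw [hs', hsq] at h3
    exact h3 ⟨h, SnakeGraph.tile_add_of_succ (by omega)
      (by rw [← hq]; exact hov X.s le_rfl (by omega)) h4⟩
  rw [bandSign, hs', hsq]
  rw [hper] at h5
  revert h5 h6
  generalize (if X.r then -(X.p : ℤ).negOnePow else (X.p : ℤ).negOnePow) = a
  generalize X.G.sgn (q + X.p) = b
  generalize X.G.sgn q = c
  generalize X.G.sgn X.s = e
  revert a b c e; decide

/-- The signs of the interior edges of `G`. If `s = 1`, then the edge `a` is regarded as an
interior edge `e_0`. -/
def sgn1 (i : ℕ) : ℤˣ := if i = 0 then -X.bandSign else X.G.sgn i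

/-- The signs of the interior edges of `G3`. -/
def sgn3 (i : ℕ) : ℤˣ := if i < X.s then X.sgn1 i else X.sgn1 (i + X.p)

/-- The signs of the interior edges of `G56`. -/
def sgn56 (i : ℕ) : ℤˣ := if i < X.s then X.sgn1 i else X.sgn1 (i + 2 * X.p)

theorem isSigns1 : X.G.IsSigns X.sgn1 := fun i hi _ => if_neg (by omega)

/-- `G3` changes from one copy of the overlap to the other at t, and `sgn3` already at s. On the
tiles in between periodicity makes both choices equal. -/
theorem isSigns3 : X.G3.IsSigns X.sgn3 := by
  intro i hi hd
  have hss := X.s_lt_s'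
  have hst := X.s'_lt_t
  have h := SnakeGraph.sgn_ofSigns (X.G.d - X.p) (by have := X.p_eq; omega)
    (fun i => if i < X.t then X.G.sgn i else X.G.sgn (i + X.p)) i hi
  change X.G3.sgn i = _ at h
  rw [h]
  simp only [sgn3, sgn1, show i ≠ 0 by omega, show i + X.p ≠ 0 by omega, if_false]
  split_ifs with h1 h2 h2
  · rfl
  · omega
  · exact X.sgn_periodic (by omega) h2
  · rfl

/-- As for `G3`: periodicity replaces the shift by p between s and t - p by the shift by 2p. -/
theorem isSigns56 : X.G56.IsSigns X.sgn56 := by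
  intro i hi hd
  have hss := X.s_lt_s'
  have hst := X.s'_lt_t
  have hp : X.s' - X.s = X.p := rfl
  have h := SnakeGraph.sgn_ofSigns (X.G.d - 2 * X.p) (by have := X.p_eq; omega)
    (fun i => if i < X.s then X.G.sgn i
      else if i < X.t - X.p then X.G.sgn (i + X.p) else X.G.sgn (i + 2 * X.p)) i hi
  change X.G56.sgn i = _ at h
  rw [h]
  simp only [sgn56, sgn1, show i ≠ 0 by omega, show i + 2 * X.p ≠ 0 by omega, if_false]
  split_ifs with h1 h2
  · rfl
  · rw [two_mul, ← Nat.add_assoc]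
    exact X.sgn_periodic (by omega) (by omega)
  · rfl

theorem sgn1_pred_s : X.sgn1 (X.s - 1) = -X.bandSign := by
  unfold sgn1
  split_ifs with h
  · rfl
  · exact X.sgn_pred_s (by omega)

theorem sgn1_periodic {i : ℕ} (h1 : X.s ≤ i) (h2 : i ≤ X.s + X.p) :
    X.sgn1 (i + X.p) = X.sgn1 i := by
  have hs := X.one_le_s
  have hp := X.p_eq
  have ht := X.s'_lt_t
  rw [sgn1, sgn1, if_neg (by omega), if_neg (by omega)]
  exact X.sgn_periodic h1 (by omega)

theorem sgn1_glue : X.sgn1 (X.s + X.p - 1) = X.bandSign := by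
  have hs := X.one_le_s
  have hp := X.p_eq
  rw [sgn1, if_neg (by omega), bandSign, hp.1]

theorem aSign_eq : X.aSign = -X.bandSign := rfl

/-- In `G4` the tile G_s is number 1, so e_i is number i + 1 - s, and e_{s'-1} is number p, that is
0. The index s - 1 is excluded because the edge a has the sign opposite to the glueing edge. -/
theorem cyclicSgn_eq {i : ℕ} (h1 : X.s ≤ i + 1) (h2 : i < X.s + 2 * X.p) (h3 : i + 1 ≠ X.s) :
    X.G4.cyclicSgn (i + 1 - X.s) = X.sgn1 i := by
  have hs := X.one_le_s
  have hp := X.p_eq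
  have key : ∀ j, X.s ≤ j → j < X.s + X.p → X.G4.cyclicSgn (j + 1 - X.s) = X.sgn1 j := by
    intro j h4 h5
    rcases Nat.lt_or_ge (j + 1) (X.s + X.p) with h6 | h6
    · unfold BandGraph.cyclicSgn
      have h7 : (j + 1 - X.s) % X.G4.p = j + 1 - X.s := Nat.mod_eq_of_lt (by change _ < X.p; omega)
      rw [h7]
      change (if j + 1 - X.s = 0 then X.G.sgn (X.s' - 1) else X.G.sgn (X.s - 1 + (j + 1 - X.s))) = _
      rw [if_neg (by omega), sgn1, if_neg (by omega)]
      congr 1; omega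
    · have h7 : j + 1 - X.s = X.G4.p := by change _ = X.p; omega
      have h8 : j = X.s + X.p - 1 := by omega
      rw [h7, BandGraph.cyclicSgn, Nat.mod_self, h8, sgn1_glue]
      rfl
  rcases Nat.lt_or_ge i (X.s + X.p) with h4 | h4
  · exact key i (by omega) h4
  · obtain ⟨j, rfl⟩ := Nat.exists_eq_add_of_le' (show X.p ≤ i by omega)
    rw [X.sgn1_periodic (by omega) (by omega), ← key j (by omega) (by omega),
      show j + X.p + 1 - X.s = j + 1 - X.s + X.p by omega]
    exact X.G4.cyclicSgn_periodic _

theorem cyclicSgn_zero : X.G4.cyclicSgn 0 = X.bandSign := by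
  simp [BandGraph.cyclicSgn, G4, bandSign]

end SelfCrossing
end SnakeCalculus

/-! ### Splicing codes, and images of edges in the two parts -/

namespace SnakeCalculus
namespace SelfCrossing

variable (X : SelfCrossing)

theorem G3_d : X.G3.d = X.G.d - X.p := rfl

theorem G56_d : X.G56.d = X.G.d - 2 * X.p := rfl

theorem G4_p : X.G4.p = X.p := rfl

/-- The code `m` is `n` on the tiles `k + 1, …, k + p`, and `m₃` on the other tiles. -/
structure Splice (k : ℕ) (m m₃ n : ℕ → ℤˣ) : Prop where
  left : ∀ i, i ≤ k → m i = m₃ i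
  mid : ∀ i, k < i → i ≤ k + X.p → m i = n (i + 1 - X.s)
  right : ∀ i, k < i → i ≤ X.G3.d + 1 → m (i + X.p) = m₃ i

variable {X}

theorem sgn3_of_le {k i : ℕ} (hk : X.IsWindow k) (hi : i ≤ k) : X.sgn3 i = X.sgn1 i := by
  have hp := X.p_eq
  unfold sgn3
  split_ifs with h
  · rfl
  · exact X.sgn1_periodic (by omega) (by unfold IsWindow at hk; omega)

theorem sgn3_of_ge {i : ℕ} (hi : X.s ≤ i) : X.sgn3 i = X.sgn1 (i + X.p) := if_neg (by omega)

theorem cyclicSgn_of_ge {i : ℕ} (h1 : X.s ≤ i) (h2 : i < X.s + 2 * X.p) :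
    X.G4.cyclicSgn (i - X.s + 1) = X.sgn1 i := by
  rw [← X.cyclicSgn_eq (by omega) h2 (by omega)]
  congr 1; omega

theorem cyclicSgn_window {k : ℕ} (hk : X.IsWindow k) :
    X.G4.cyclicSgn (k + 1 - X.s) = X.sgn1 (k + X.p) := by
  have hp := X.p_eq
  unfold IsWindow at hk
  rw [← X.cyclicSgn_eq (i := k + X.p) (by omega) (by omega) (by omega),
    show k + X.p + 1 - X.s = k + 1 - X.s + X.p by omega]
  exact (X.G4.cyclicSgn_periodic _).symm

variable {k : ℕ} {m m₃ n : ℕ → ℤˣ}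

theorem Splice.n_window (h : X.Splice k m m₃ n) (hk : X.IsWindow k)
    (hn : Function.Periodic n X.p) : n (k + 1 - X.s) = m (k + X.p) := by
  have hp := X.p_eq
  unfold IsWindow at hk
  rw [h.mid (k + X.p) (by omega) le_rfl, show k + X.p + 1 - X.s = k + 1 - X.s + X.p by omega]
  exact (hn _).symm

/-- Away from the cuts a tile has the same neighbours in G as in the corresponding part. Only an
edge shared with a tile beyond a cut can be selected differently; the same holds in the next two
lemmas. -/
theorem Splice.selected_left (h : X.Splice k m m₃ n) (hk : X.IsWindow k) {i : ℕ} {c : Corner}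
    {σ : ℤˣ} (hi : 1 ≤ i) (hik : i ≤ k) (hne : ¬(i = k ∧ c = .ne ∧ σ = X.sgn1 k)) :
    Selected X.sgn1 m i c σ ↔ Selected X.sgn3 m₃ i c σ := by
  cases c <;> simp only [Selected]
  · rw [h.left i hik, h.left (i - 1) (by omega), sgn3_of_le hk (i := i - 1) (by omega)]
  · rw [h.left i hik, sgn3_of_le hk hik]
    rcases hik.eq_or_lt with rfl | hlt
    · have : X.sgn1 i ≠ σ := fun h => hne ⟨rfl, rfl, h.symm⟩
      simp [this]
    · rw [h.left (i + 1) hlt]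

theorem Splice.selected_right (h : X.Splice k m m₃ n) (hk : X.IsWindow k) {i : ℕ} {c : Corner}
    {σ : ℤˣ} (hik : k < i) (hid : i ≤ X.G3.d) (hne : ¬(i = k + 1 ∧ c = .sw)) :
    Selected X.sgn1 m (i + X.p) c σ ↔ Selected X.sgn3 m₃ i c σ := by
  have hp := X.p_eq
  unfold IsWindow at hk
  cases c <;> simp only [Selected]
  · have h1 : i ≠ k + 1 := fun h => hne ⟨h, rfl⟩
    rw [h.right i hik (by omega), show i + X.p - 1 = i - 1 + X.p by omega,
      h.right (i - 1) (by omega) (by omega), sgn3_of_ge (by omega)]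
  · rw [h.right i hik (by omega), show i + X.p + 1 = i + 1 + X.p by omega,
      h.right (i + 1) (by omega) (by omega), sgn3_of_ge (by omega)]

theorem Splice.selected_mid (h : X.Splice k m m₃ n) (hk : X.IsWindow k) {i : ℕ} {c : Corner}
    {σ : ℤˣ} (hik : k < i) (hid : i ≤ k + X.p) (hne : ¬(i = k + 1 ∧ c = .sw))
    (hne' : ¬(i = k + X.p ∧ c = .ne ∧ σ = X.sgn1 (k + X.p))) :
    Selected X.sgn1 m i c σ ↔ Selected X.G4.cyclicSgn n (i - X.s + 1) c σ := by
  have hp := X.p_eq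
  unfold IsWindow at hk
  cases c <;> simp only [Selected]
  · have h1 : i ≠ k + 1 := fun h => hne ⟨h, rfl⟩
    rw [h.mid i hik hid, h.mid (i - 1) (by omega) (by omega), Nat.add_sub_cancel,
      ← cyclicSgn_of_ge (i := i - 1) (by omega) (by omega),
      show i + 1 - X.s = i - X.s + 1 by omega, show i - 1 + 1 - X.s = i - X.s by omega,
      show i - 1 - X.s + 1 = i - X.s by omega]
  · rw [h.mid i hik hid, cyclicSgn_of_ge (by omega) (by omega),
      show i + 1 - X.s = i - X.s + 1 by omega]
    rcases hid.eq_or_lt with rfl | hlt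
    · have : X.sgn1 (k + X.p) ≠ σ := fun h => hne' ⟨rfl, rfl, h.symm⟩
      simp [this]
    · rw [h.mid (i + 1) (by omega) (by omega),
        show i + 1 + 1 - X.s = i - X.s + 1 + 1 by omega]

/-- The edges at the two places where `G` is cut: the south/west edges of `G_{k+1}` and
`G_{k+p+1}`. -/
def IsJunction (X : SelfCrossing) (k : ℕ) (e : Edge) : Prop :=
  ∃ σ, e = X.G.edge (k + 1) .sw σ ∨ e = X.G.edge (k + X.p + 1) .sw σ

theorem not_isJunction (hk : X.IsWindow k) {i : ℕ} {c : Corner} {σ : ℤˣ} (hi : 1 ≤ i)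
    (h1 : ¬((i = k + 1 ∨ i = k + X.p + 1) ∧ c = .sw))
    (h2 : ¬(i = k ∧ c = .ne ∧ σ = X.sgn1 k))
    (h3 : ¬(i = k + X.p ∧ c = .ne ∧ σ = X.sgn1 (k + X.p))) :
    ¬X.IsJunction k (X.G.edge i c σ) := by
  have hp := X.p_eq
  unfold IsWindow at hk
  rintro ⟨τ, h | h⟩
  · obtain ⟨rfl, ⟨h4, rfl⟩ | ⟨rfl, -, h4, h5⟩ | ⟨-, h4, -⟩⟩ := X.G.edge_eq_edge hi (by omega) h
    · exact h1 ⟨Or.inl h4, rfl⟩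
    · have : i = k := by omega
      subst this
      exact h2 ⟨rfl, rfl, by rw [X.isSigns1 i hi (by omega)]; exact h5⟩
    · cases h4
  · obtain ⟨rfl, ⟨h4, rfl⟩ | ⟨rfl, -, h4, h5⟩ | ⟨-, h4, -⟩⟩ := X.G.edge_eq_edge hi (by omega) h
    · exact h1 ⟨Or.inr h4, rfl⟩
    · have : i = k + X.p := by omega
      subst this
      exact h3 ⟨rfl, rfl, by rw [X.isSigns1 _ hi (by omega)]; exact h5⟩
    · cases h4

/-- The set `S` consists of the edges of `P` on the tiles `k + 1, …, k + p` and possibly some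
junction edges. -/
structure IsCut (X : SelfCrossing) (k : ℕ) (P S : Set Edge) : Prop where
  subset : S ⊆ P
  inside : ∀ i c σ, k < i → i ≤ k + X.p → X.G.edge i c σ ∈ P →
    ¬X.IsJunction k (X.G.edge i c σ) → X.G.edge i c σ ∈ S
  outside : ∀ i c σ, 1 ≤ i → i ≤ k ∨ k + X.p < i → X.G.edge i c σ ∈ S →
    X.IsJunction k (X.G.edge i c σ)

variable {S : Set Edge}

/-- By the preceding comparisons only the edges at the junction need attention, and these are the
subject of `hJ`. The edge e_k, seen as a north/east edge of tile k, is first rewritten as a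
south/west edge of tile k + 1. -/
theorem IsCut.toG3_eq (hk : X.IsWindow k) (h : X.Splice k m m₃ n)
    (hS : X.IsCut k (X.G.ofCode X.sgn1 m) S)
    (hJ : ∀ σ, (X.G.edge (k + 1) .sw σ ∈ X.G.ofCode X.sgn1 m \ S ∨
      X.G.edge (k + X.p + 1) .sw σ ∈ X.G.ofCode X.sgn1 m \ S) ↔
        Selected X.sgn3 m₃ (k + 1) .sw σ) :
    X.toG3 k (X.G.ofCode X.sgn1 m \ S) = X.G3.ofCode X.sgn3 m₃ := by
  have hp := X.p_eq
  have hd := X.G3_d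
  have hk' := hk
  unfold IsWindow at hk'
  have hJ3 : ∀ σ, X.G3.edge (k + 1) .sw σ ∈ X.G3.ofCode X.sgn3 m₃ ↔
      Selected X.sgn3 m₃ (k + 1) .sw σ := fun σ =>
    SnakeGraph.edge_mem_ofCode X.isSigns3 (by omega) (by omega)
  have hkk := sgn3_of_le hk (le_refl k)
  have hglue : 1 ≤ k → X.G.edge k .ne (X.sgn1 k) = X.G.edge (k + 1) .sw (X.sgn1 k) := fun h =>
    (X.isSigns1.edge_succ_sw h (by omega)).symm
  have hglue3 : 1 ≤ k → X.G3.edge k .ne (X.sgn1 k) = X.G3.edge (k + 1) .sw (X.sgn1 k) := by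
    intro h
    rw [← hkk]
    exact (X.isSigns3.edge_succ_sw h (by omega)).symm
  ext e
  constructor
  · rintro ⟨i, c, σ, hi, hid, he, ⟨h1, rfl⟩ | ⟨h1, rfl⟩⟩
    · rcases h1 with h1 | ⟨rfl, rfl⟩
      · by_cases hc : i = k ∧ c = .ne ∧ σ = X.sgn1 k
        · obtain ⟨rfl, rfl, rfl⟩ := hc
          rw [hglue hi] at he
          rw [hglue3 hi]
          exact (hJ3 _).2 ((hJ _).1 (Or.inl he))
        · have h2 := (SnakeGraph.edge_mem_ofCode X.isSigns1 hi hid).1 he.1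
          exact (SnakeGraph.edge_mem_ofCode X.isSigns3 hi (by omega)).2
            ((h.selected_left hk hi h1 hc).1 h2)
      · exact (hJ3 _).2 ((hJ _).1 (Or.inl he))
    · obtain ⟨j, rfl⟩ := Nat.exists_eq_add_of_le' (show X.p ≤ i by omega)
      rw [Nat.add_sub_cancel]
      by_cases hc : j = k + 1 ∧ c = .sw
      · obtain ⟨rfl, rfl⟩ := hc
        rw [show k + 1 + X.p = k + X.p + 1 by ring] at he
        exact (hJ3 _).2 ((hJ _).1 (Or.inr he))
      · have h2 := (SnakeGraph.edge_mem_ofCode X.isSigns1 hi hid).1 he.1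
        exact (SnakeGraph.edge_mem_ofCode X.isSigns3 (by omega) (by omega)).2
          ((h.selected_right hk (by omega) (by omega) hc).1 h2)
  · rintro ⟨j, c, σ, hj, hjd, rfl, hs⟩
    have hjun : ∀ τ, Selected X.sgn3 m₃ (k + 1) .sw τ →
        X.G3.edge (k + 1) .sw τ ∈ X.toG3 k (X.G.ofCode X.sgn1 m \ S) := by
      intro τ hτ
      rcases (hJ τ).2 hτ with h1 | h1
      · exact ⟨k + 1, .sw, τ, by omega, by omega, h1, Or.inl ⟨Or.inr ⟨rfl, rfl⟩, rfl⟩⟩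
      · refine ⟨k + X.p + 1, .sw, τ, by omega, by omega, h1, Or.inr ⟨by omega, ?_⟩⟩
        congr 1; omega
    rcases Nat.lt_or_ge k j with h1 | h1
    · by_cases hc : j = k + 1 ∧ c = .sw
      · obtain ⟨rfl, rfl⟩ := hc
        exact hjun σ hs
      · refine ⟨j + X.p, c, σ, by omega, by omega, ⟨?_, fun hS' => ?_⟩, Or.inr ⟨by omega, ?_⟩⟩
        · exact (SnakeGraph.edge_mem_ofCode X.isSigns1 (by omega) (by omega)).2
            ((h.selected_right hk h1 hjd hc).2 hs)
        · refine not_isJunction hk (by omega) ?_ (by omega) (by omega)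
            (hS.outside _ _ _ (by omega) (Or.inr (by omega)) hS')
          rintro ⟨h2 | h2, h3⟩
          · omega
          · exact hc ⟨by omega, h3⟩
        · rw [Nat.add_sub_cancel]
    · by_cases hc : j = k ∧ c = .ne ∧ σ = X.sgn1 k
      · obtain ⟨rfl, rfl, rfl⟩ := hc
        rw [hglue3 hj]
        refine hjun _ ⟨hs.2 hkk, fun _ => ?_⟩
        rw [Nat.add_sub_cancel]
        exact hs.1
      · refine ⟨j, c, σ, hj, by omega, ⟨?_, fun hS' => ?_⟩, Or.inl ⟨Or.inl h1, rfl⟩⟩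
        · exact (SnakeGraph.edge_mem_ofCode X.isSigns1 hj (by omega)).2
            ((h.selected_left hk hj h1 hc).2 hs)
        · exact not_isJunction hk hj (by omega) hc (by omega)
            (hS.outside _ _ _ hj (Or.inl h1) hS')

/-- The counterpart for `G4`. Since `toG4` reads only tiles before s' + p, for k = s' - 1 a junction
edge of tile k + p + 1 is seen only if it is e_{k+p}, which also belongs to tile k + p; hence
`hlast`. -/
theorem IsCut.toG4_eq (hk : X.IsWindow k) (h : X.Splice k m m₃ n)
    (hn : Function.Periodic n X.p) (hS : X.IsCut k (X.G.ofCode X.sgn1 m) S)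
    (hJ : ∀ σ, (X.G.edge (k + 1) .sw σ ∈ S ∨ X.G.edge (k + X.p + 1) .sw σ ∈ S) ↔
        Selected X.G4.cyclicSgn n (k + 1 - X.s + 1) .sw σ)
    (hlast : ∀ σ, X.G.edge (k + X.p + 1) .sw σ ∈ S → k + 1 < X.s' ∨ σ = X.sgn1 (k + X.p)) :
    X.toG4 S = X.G4.ofCode n := by
  have hp := X.p_eq
  have hs1 := X.one_le_s
  have hk' := hk
  unfold IsWindow at hk'
  have hn' : Function.Periodic n X.G4.p := hn
  have hJ4 : ∀ σ, X.G4.edge (k + 1 - X.s) .sw σ ∈ X.G4.ofCode n ↔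
      Selected X.G4.cyclicSgn n (k + 1 - X.s + 1) .sw σ := fun σ =>
    BandGraph.edge_mem_ofCode hn'
  have hcyc := cyclicSgn_window hk
  have hwrap : ∀ c σ, X.G4.edge (k + X.p + 1 - X.s) c σ = X.G4.edge (k + 1 - X.s) c σ := by
    intro c σ
    refine BandGraph.edge_congr ?_ _ _
    rw [show k + X.p + 1 - X.s = k + 1 - X.s + X.p by omega]
    simp [Nat.ModEq, G4_p]
  have hglueR : X.G4.edge (k + X.p - X.s) .ne (X.sgn1 (k + X.p)) =
      X.G4.edge (k + 1 - X.s) .sw (X.sgn1 (k + X.p)) := by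
    rw [← hwrap, show k + X.p + 1 - X.s = k + X.p - X.s + 1 by omega,
      ← cyclicSgn_of_ge (i := k + X.p) (by omega) (by omega)]
    exact (BandGraph.edge_succ_sw _).symm
  have hglueL : X.s ≤ k → X.G4.edge (k - X.s) .ne (X.sgn1 k) =
      X.G4.edge (k + 1 - X.s) .sw (X.sgn1 k) := by
    intro h
    rw [show k + 1 - X.s = k - X.s + 1 by omega,
      ← cyclicSgn_of_ge (i := k) (by omega) (by omega)]
    exact (BandGraph.edge_succ_sw _).symm
  ext x
  constructor
  · rintro ⟨i, c, σ, hi, hid, he, rfl⟩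
    by_cases hj : X.IsJunction k (X.G.edge i c σ)
    · obtain ⟨τ, hj | hj⟩ := hj
      · have he' := he
        rw [hj] at he'
        obtain ⟨rfl, ⟨rfl, rfl⟩ | ⟨rfl, -, h4, h5⟩ | ⟨-, h4, -⟩⟩ :=
          X.G.edge_eq_edge (by omega) (by omega) hj
        · exact (hJ4 _).2 ((hJ _).1 (Or.inl he))
        · have : i = k := by omega
          subst this
          rw [← X.isSigns1 i (by omega) (by omega)] at h5
          subst h5
          rw [hglueL hi]
          exact (hJ4 _).2 ((hJ _).1 (Or.inl he'))
        · cases h4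
      · have he' := he
        rw [hj] at he'
        obtain ⟨rfl, ⟨rfl, rfl⟩ | ⟨rfl, -, h4, h5⟩ | ⟨-, h4, -⟩⟩ :=
          X.G.edge_eq_edge (by omega) (by omega) hj
        · rw [hwrap]
          exact (hJ4 _).2 ((hJ _).1 (Or.inr he))
        · have : i = k + X.p := by omega
          subst this
          rw [← X.isSigns1 _ (by omega) (by omega)] at h5
          subst h5
          rw [hglueR]
          exact (hJ4 _).2 ((hJ _).1 (Or.inr he'))
        · cases h4
    · have hin : k < i ∧ i ≤ k + X.p := by
        by_contra hc
        exact hj (hS.outside i c σ (by omega) (by omega) he)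
      rw [BandGraph.edge_mem_ofCode hn']
      refine (h.selected_mid hk hin.1 hin.2 ?_ ?_).1
        ((SnakeGraph.edge_mem_ofCode X.isSigns1 (by omega) (by omega)).1 (hS.subset he))
      · rintro ⟨rfl, rfl⟩
        exact hj ⟨σ, Or.inl rfl⟩
      · rintro ⟨rfl, rfl, rfl⟩
        refine hj ⟨X.sgn1 (k + X.p), Or.inr ?_⟩
        exact (X.isSigns1.edge_succ_sw (by omega) (by omega)).symm
  · rintro ⟨j, c, σ, rfl, hs⟩
    have hj : ∃ i, k < i ∧ i ≤ k + X.p ∧ j ≡ i - X.s [MOD X.p] := by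
      refine ⟨k + 1 + (j + (X.p - 1) * (k + 1 - X.s)) % X.p, by omega, ?_, ?_⟩
      · have := Nat.mod_lt (j + (X.p - 1) * (k + 1 - X.s)) hp.2.1
        omega
      · have h2 : (k + 1 - X.s) + (j + (X.p - 1) * (k + 1 - X.s)) % X.p ≡
            (k + 1 - X.s) + (j + (X.p - 1) * (k + 1 - X.s)) [MOD X.p] :=
          (Nat.mod_modEq _ _).add_left _
        rw [show (k + 1 - X.s) + (j + (X.p - 1) * (k + 1 - X.s)) % X.p =
          k + 1 + (j + (X.p - 1) * (k + 1 - X.s)) % X.p - X.s by omega] at h2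
        refine Nat.ModEq.symm (h2.trans ?_)
        obtain ⟨q, hq⟩ := Nat.exists_eq_add_of_le' hp.2.1
        have : (k + 1 - X.s) + (j + (X.p - 1) * (k + 1 - X.s)) = j + X.p * (k + 1 - X.s) := by
          rw [hq, Nat.add_sub_cancel]; ring
        rw [this]
        simp [Nat.ModEq]
    obtain ⟨i, h1, h2, hji⟩ := hj
    rw [BandGraph.selected_congr hn' hji] at hs
    rw [BandGraph.edge_congr hji]
    have hjun : ∀ τ, Selected X.G4.cyclicSgn n (k + 1 - X.s + 1) .sw τ →
        X.G4.edge (k + 1 - X.s) .sw τ ∈ X.toG4 S := by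
      intro τ hτ
      rcases (hJ τ).2 hτ with h3 | h3
      · exact ⟨k + 1, .sw, τ, by omega, by omega, h3, rfl⟩
      · rcases hlast τ h3 with h4 | rfl
        · exact ⟨k + X.p + 1, .sw, τ, by omega, by omega, h3, (hwrap _ _).symm⟩
        · rw [X.isSigns1.edge_succ_sw (by omega) (by omega)] at h3
          exact ⟨k + X.p, .ne, _, by omega, by omega, h3, hglueR.symm⟩
    by_cases hc : i = k + 1 ∧ c = .sw
    · obtain ⟨rfl, rfl⟩ := hc
      rw [show k + 1 - X.s + 1 = k + 1 - X.s + 1 from rfl] at hs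
      exact hjun σ hs
    by_cases hc' : i = k + X.p ∧ c = .ne ∧ σ = X.sgn1 (k + X.p)
    · obtain ⟨rfl, rfl, rfl⟩ := hc'
      rw [hglueR]
      refine hjun _ ⟨?_, fun _ => ?_⟩
      · have h3 := hs.2 (cyclicSgn_of_ge (by omega) (by omega))
        rw [show k + X.p - X.s + 1 + 1 = k + 1 - X.s + 1 + X.p by omega, hn] at h3
        exact h3
      · have h3 := hs.1
        rw [show k + X.p - X.s + 1 = k + 1 - X.s + X.p by omega, hn] at h3
        rw [Nat.add_sub_cancel]
        exact h3
    · have h3 := (h.selected_mid hk h1 h2 hc hc').2 hs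
      refine ⟨i, c, σ, by omega, by omega, hS.inside _ _ _ h1 h2 ?_ ?_, rfl⟩
      · exact (SnakeGraph.edge_mem_ofCode X.isSigns1 (by omega) (by omega)).2 h3
      · refine not_isJunction hk (by omega) ?_ (by omega) hc'
        rintro ⟨h4 | h4, h5⟩
        · exact hc ⟨h4, h5⟩
        · omega

end SelfCrossing
end SnakeCalculus

/-! ### Windows and their end edges -/

namespace SnakeCalculus
namespace SelfCrossing

variable {X : SelfCrossing} {k : ℕ} {m m₃ n : ℕ → ℤˣ} {S : Set Edge}

theorem sgn_add_p (X : SelfCrossing) (k : ℕ) : X.G.sgn (k + X.p) = X.sgn1 (k + X.p) := by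
  have hp := X.p_eq
  rw [sgn1, if_neg (by omega)]

theorem endL_eq (X : SelfCrossing) (k : ℕ) :
    X.endL k = X.G.edge (k + 1) .sw (X.sgn1 (k + X.p)) := by
  rw [endL, sgn_add_p]

theorem endR_eq_ne (X : SelfCrossing) (k : ℕ) :
    X.endR k = X.G.edge (k + X.p) .ne (X.sgn1 (k + X.p)) := by
  rw [endR, SnakeGraph.interiorEdge_eq, sgn_add_p]

theorem endR_eq (X : SelfCrossing) (k : ℕ) :
    X.endR k = X.G.edge (k + X.p + 1) .sw (X.sgn1 (k + X.p)) := by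
  have hp := X.p_eq
  rw [endR, SnakeGraph.interiorEdge_eq_sw _ _ (by omega), sgn_add_p]

theorem mem_window_iff {e : Edge} :
    e ∈ X.window k ↔ ∃ i c σ, k < i ∧ i ≤ k + X.p ∧ e = X.G.edge i c σ :=
  X.G.mem_edgesOn_iff

theorem edge_mem_window_left (hk : X.IsWindow k) {i : ℕ} {c : Corner} {σ : ℤˣ} (hi : 1 ≤ i)
    (hik : i ≤ k) : X.G.edge i c σ ∈ X.window k ↔ i = k ∧ c = .ne ∧ σ = X.sgn1 k := by
  have hp := X.p_eq
  unfold IsWindow at hk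
  rw [mem_window_iff]
  constructor
  · rintro ⟨j, c', τ, h1, h2, h⟩
    obtain ⟨rfl, ⟨h3, -⟩ | ⟨rfl, -, h3, h4⟩ | ⟨-, -, h3, -⟩⟩ := X.G.edge_eq_edge hi (by omega) h
    · omega
    · have : i = k := by omega
      subst this
      exact ⟨rfl, rfl, by rw [X.isSigns1 i hi (by omega)]; exact h4⟩
    · omega
  · rintro ⟨rfl, rfl, rfl⟩
    exact ⟨i + 1, .sw, _, by omega, by omega, (X.isSigns1.edge_succ_sw hi (by omega)).symm⟩

theorem edge_mem_window_right (hk : X.IsWindow k) {i : ℕ} {c : Corner} {σ : ℤˣ}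
    (hik : k + X.p < i) : X.G.edge i c σ ∈ X.window k ↔
      i = k + X.p + 1 ∧ c = .sw ∧ σ = X.sgn1 (k + X.p) := by
  have hp := X.p_eq
  unfold IsWindow at hk
  rw [mem_window_iff]
  constructor
  · rintro ⟨j, c', τ, h1, h2, h⟩
    obtain ⟨rfl, ⟨h3, -⟩ | ⟨-, -, h3, -⟩ | ⟨rfl, -, h3, h4⟩⟩ :=
      X.G.edge_eq_edge (by omega) (by omega) h
    · omega
    · omega
    · have : j = k + X.p := by omega
      subst this
      exact ⟨h3, rfl, by rw [X.isSigns1 _ (by omega) (by omega)]; exact h4⟩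
  · rintro ⟨rfl, rfl, rfl⟩
    exact ⟨k + X.p, .ne, _, by omega, by omega,
      X.isSigns1.edge_succ_sw (by omega) (by omega)⟩

theorem endL_mem_iff (hk : X.IsWindow k) : X.endL k ∈ X.G.ofCode X.sgn1 m ↔
    m (k + 1) = X.sgn1 (k + X.p) ∧
      (X.sgn1 k = X.sgn1 (k + X.p) → m k = -X.sgn1 (k + X.p)) := by
  have hp := X.p_eq
  unfold IsWindow at hk
  rw [endL_eq, SnakeGraph.edge_mem_ofCode X.isSigns1 (by omega) (by omega)]
  rfl

theorem endR_mem_iff (hk : X.IsWindow k) : X.endR k ∈ X.G.ofCode X.sgn1 m ↔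
    m (k + X.p + 1) = X.sgn1 (k + X.p) ∧ m (k + X.p) = -X.sgn1 (k + X.p) := by
  have hp := X.p_eq
  unfold IsWindow at hk
  rw [endR_eq, SnakeGraph.edge_mem_ofCode X.isSigns1 (by omega) (by omega)]
  simp [Selected]

theorem endL_ne_endR (X : SelfCrossing) (k : ℕ) : X.endL k ≠ X.endR k := by
  have hp := X.p_eq
  rw [endL_eq, endR_eq]
  intro h
  obtain ⟨-, ⟨h, -⟩ | ⟨h, -⟩ | ⟨-, h, -⟩⟩ := X.G.edge_eq_edge (by omega) (by omega) h
  · omega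
  · cases h
  · cases h

theorem endL_mem_window (X : SelfCrossing) (k : ℕ) : X.endL k ∈ X.window k := by
  have hp := X.p_eq
  exact mem_window_iff.2 ⟨k + 1, _, _, by omega, by omega, X.endL_eq k⟩

theorem endR_mem_window (X : SelfCrossing) (k : ℕ) : X.endR k ∈ X.window k := by
  have hp := X.p_eq
  exact mem_window_iff.2 ⟨k + X.p, _, _, by omega, by omega, X.endR_eq_ne k⟩

theorem isCut_of_window (hk : X.IsWindow k)
    (h1 : S ⊆ X.G.ofCode X.sgn1 m ∩ X.window k)
    (h2 : ∀ e ∈ X.G.ofCode X.sgn1 m ∩ X.window k, e ≠ X.endL k → e ≠ X.endR k → e ∈ S) :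
    X.IsCut k (X.G.ofCode X.sgn1 m) S where
  subset e he := (h1 he).1
  inside i c σ h3 h4 h5 h6 := by
    refine h2 _ ⟨h5, mem_window_iff.2 ⟨i, c, σ, h3, h4, rfl⟩⟩ (fun h => h6 ?_) (fun h => h6 ?_)
    · exact ⟨_, Or.inl (h.trans (X.endL_eq k))⟩
    · exact ⟨_, Or.inr (h.trans (X.endR_eq k))⟩
  outside i c σ hi h3 h4 := by
    have hp := X.p_eq
    have h5 := (h1 h4).2
    rcases h3 with h3 | h3
    · obtain ⟨rfl, rfl, rfl⟩ := (edge_mem_window_left hk hi h3).1 h5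
      unfold IsWindow at hk
      exact ⟨_, Or.inl (X.isSigns1.edge_succ_sw hi (by omega)).symm⟩
    · obtain ⟨rfl, rfl, rfl⟩ := (edge_mem_window_right hk h3).1 h5
      exact ⟨_, Or.inr rfl⟩

theorem selected_junction_mem (hk : X.IsWindow k) (σ : ℤˣ) :
    (X.G.edge (k + 1) .sw σ ∈ X.G.ofCode X.sgn1 m ↔
      m (k + 1) = σ ∧ (X.sgn1 k = σ → m k = -σ)) ∧
    (X.G.edge (k + X.p + 1) .sw σ ∈ X.G.ofCode X.sgn1 m ↔
      m (k + X.p + 1) = σ ∧ (X.sgn1 (k + X.p) = σ → m (k + X.p) = -σ)) := by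
  have hp := X.p_eq
  unfold IsWindow at hk
  rw [SnakeGraph.edge_mem_ofCode X.isSigns1 (by omega) (by omega),
    SnakeGraph.edge_mem_ofCode X.isSigns1 (by omega) (by omega)]
  exact ⟨Iff.rfl, Iff.rfl⟩

theorem Splice.selected3_junction (h : X.Splice k m m₃ n) (hk : X.IsWindow k) (σ : ℤˣ) :
    Selected X.sgn3 m₃ (k + 1) .sw σ ↔ m (k + X.p + 1) = σ ∧ (X.sgn1 k = σ → m k = -σ) := by
  have hp := X.p_eq
  have hd := X.G3_d
  have hk' := hk
  unfold IsWindow at hk'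
  have h1 := h.right (k + 1) (by omega) (by omega)
  rw [show k + 1 + X.p = k + X.p + 1 by ring] at h1
  simp only [Selected, Nat.add_sub_cancel]
  rw [← h1, ← h.left k le_rfl, sgn3_of_le hk le_rfl]

theorem Splice.selected4_junction (h : X.Splice k m m₃ n) (hk : X.IsWindow k)
    (hn : Function.Periodic n X.p) (σ : ℤˣ) :
    Selected X.G4.cyclicSgn n (k + 1 - X.s + 1) .sw σ ↔
      m (k + 1) = σ ∧ (X.sgn1 (k + X.p) = σ → m (k + X.p) = -σ) := by
  have hp := X.p_eq
  have hk' := hk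
  unfold IsWindow at hk'
  have h1 := h.mid (k + 1) (by omega) (by omega)
  rw [show k + 1 + 1 - X.s = k + 1 - X.s + 1 by omega] at h1
  simp only [Selected, Nat.add_sub_cancel]
  rw [← h1, h.n_window hk hn, cyclicSgn_window hk]

/-- Only the two end edges can be distributed freely, and `h3`, `h4` prescribe how. Junction edges
of the opposite sign are placed by position: the one at tile k + 1 goes to S, the one at tile k + p
+ 1 does not. For k = s - 1 the former is a, and `ha` says that tile s - 1 chooses a as soon as one
of these two tiles chooses its copy. -/
theorem images_of_window (hk : X.IsWindow k) (h : X.Splice k m m₃ n)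
    (hn : Function.Periodic n X.p)
    (h1 : S ⊆ X.G.ofCode X.sgn1 m ∩ X.window k)
    (h2 : ∀ e ∈ X.G.ofCode X.sgn1 m ∩ X.window k, e ≠ X.endL k → e ≠ X.endR k → e ∈ S)
    (h3 : (X.endL k ∈ X.G.ofCode X.sgn1 m \ S ∨ X.endR k ∈ X.G.ofCode X.sgn1 m \ S) ↔
      m (k + X.p + 1) = X.sgn1 (k + X.p) ∧
        (X.sgn1 k = X.sgn1 (k + X.p) → m k = -X.sgn1 (k + X.p)))
    (h4 : (X.endL k ∈ S ∨ X.endR k ∈ S) ↔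
      m (k + 1) = X.sgn1 (k + X.p) ∧ m (k + X.p) = -X.sgn1 (k + X.p))
    (ha : X.sgn1 k = -X.sgn1 (k + X.p) →
      m (k + 1) = -X.sgn1 (k + X.p) ∨ m (k + X.p + 1) = -X.sgn1 (k + X.p) →
        m k = X.sgn1 (k + X.p)) :
    X.toG3 k (X.G.ofCode X.sgn1 m \ S) = X.G3.ofCode X.sgn3 m₃ ∧
      X.toG4 S = X.G4.ofCode n := by
  have hp := X.p_eq
  have hcut := isCut_of_window hk h1 h2
  have hk' := hk
  unfold IsWindow at hk'
  have hR : X.G.edge (k + X.p + 1) .sw (-X.sgn1 (k + X.p)) ∉ S := by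
    intro h5
    exact units_neg_ne _ ((edge_mem_window_right hk (by omega)).1 (h1 h5).2).2.2
  have hne : ∀ i j, 1 ≤ i → 1 ≤ j → X.G.edge i .sw (-X.sgn1 (k + X.p)) ≠
      X.G.edge j .sw (X.sgn1 (k + X.p)) := by
    intro i j hi hj h5
    exact units_neg_ne _ (X.G.edge_eq_edge hi hj h5).1
  have hL : X.G.edge (k + 1) .sw (-X.sgn1 (k + X.p)) ∈ S ↔
      X.G.edge (k + 1) .sw (-X.sgn1 (k + X.p)) ∈ X.G.ofCode X.sgn1 m := by
    refine ⟨fun h5 => (h1 h5).1, fun h5 => h2 _ ⟨h5, ?_⟩ ?_ ?_⟩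
    · exact mem_window_iff.2 ⟨k + 1, _, _, by omega, by omega, rfl⟩
    · rw [endL_eq]; exact hne _ _ (by omega) (by omega)
    · rw [endR_eq]; exact hne _ _ (by omega) (by omega)
  have hPm := selected_junction_mem (m := m) hk (-X.sgn1 (k + X.p))
  refine ⟨hcut.toG3_eq hk h fun σ => ?_, hcut.toG4_eq hk h hn (fun σ => ?_) fun σ h5 => ?_⟩
  · rw [h.selected3_junction hk]
    rcases units_eq_or_eq_neg σ (X.sgn1 (k + X.p)) with rfl | rfl
    · rw [← endL_eq, ← endR_eq]
      exact h3
    · rw [neg_neg] at hPm ⊢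
      have h5 : X.G.edge (k + 1) .sw (-X.sgn1 (k + X.p)) ∉ X.G.ofCode X.sgn1 m \ S :=
        fun h5 => h5.2 (hL.2 h5.1)
      have h6 : X.sgn1 (k + X.p) ≠ -X.sgn1 (k + X.p) := units_ne_neg _
      rw [or_iff_right h5, Set.mem_sdiff, and_iff_left hR, hPm.2]
      exact ⟨fun h7 => ⟨h7.1, fun h8 => ha h8 (Or.inr h7.1)⟩, fun h7 => ⟨h7.1, fun h8 => absurd h8 h6⟩⟩
  · rw [h.selected4_junction hk hn]
    rcases units_eq_or_eq_neg σ (X.sgn1 (k + X.p)) with rfl | rfl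
    · rw [← endL_eq, ← endR_eq, h4]
      simp
    · rw [neg_neg] at hPm ⊢
      have h6 : X.sgn1 (k + X.p) ≠ -X.sgn1 (k + X.p) := units_ne_neg _
      rw [or_iff_left hR, hL, hPm.1]
      exact ⟨fun h7 => ⟨h7.1, fun h8 => absurd h8 h6⟩, fun h7 => ⟨h7.1, fun h8 => ha h8 (Or.inl h7.1)⟩⟩
  · rcases units_eq_or_eq_neg σ (X.sgn1 (k + X.p)) with rfl | rfl
    · exact Or.inr rfl
    · exact absurd h5 hR

/-! ### The cut positions of a matching in terms of its code -/

theorem edge_mem {i : ℕ} {c : Corner} {σ : ℤˣ} (h1 : 1 ≤ i) (h2 : i ≤ X.G.d)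
    (h : Selected X.sgn1 m i c σ) : X.G.edge i c σ ∈ X.G.ofCode X.sgn1 m :=
  (SnakeGraph.edge_mem_ofCode X.isSigns1 h1 h2).2 h

/-- Tile k + p + 1 decides the side on which the end points of e_{k+p} are matched: inside if it
chooses e_{k+p}, beyond otherwise. In the first case the walk to the left cannot leave the window,
because `endL k` belongs to the matching. -/
theorem endR_matchedBy_window (hk : X.IsWindow k)
    (hL : X.endL k ∈ X.G.ofCode X.sgn1 m) (h : m (k + X.p + 1) = X.sgn1 (k + X.p)) :
    MatchedBy (X.G.ofCode X.sgn1 m) (X.window k) (X.endR k) := by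
  have hp := X.p_eq
  have hk' := hk
  unfold IsWindow at hk'
  intro u hu
  rcases units_eq_or_eq_neg (m (k + X.p)) (X.sgn1 (k + X.p)) with h1 | h1
  · rw [endR_eq_ne] at hu
    rcases (isCorner_iff_ends _ _ (m (k + X.p))).1 (X.G.isCorner_of_mem_ends hu) with h2 | h2
    · rcases SnakeGraph.exists_selected_left X.isSigns1 (l := k) (by omega) (by omega) h2 with
        ⟨j, c, σ, h3, h4, h5, h6⟩ | ⟨h3, h4, -⟩
      · exact ⟨_, edge_mem (by omega) (by omega) h5,
          mem_window_iff.2 ⟨j, c, σ, h3, h4, rfl⟩, h6⟩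
      · rw [endL_mem_iff hk] at hL
        have h5 := h4.symm.trans hL.1
        rw [h3] at hL
        exact absurd (h5.symm.trans (hL.2 h5)) (units_ne_neg _)
    · refine ⟨X.G.edge (k + X.p) .ne (-m (k + X.p)),
        edge_mem (by omega) (by omega) ⟨by rw [neg_neg], fun h3 => ?_⟩,
        mem_window_iff.2 ⟨k + X.p, .ne, _, by omega, by omega, rfl⟩, h2⟩
      exact absurd (h1.trans h3) (units_ne_neg _)
  · exact ⟨_, (endR_mem_iff hk).2 ⟨h, h1⟩, X.endR_mem_window k, hu⟩

theorem not_matchedBy {P W : Set Edge} {e : Edge} (hP : P ∈ X.G.matchings)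
    {u : ℤ × ℤ} (hu : u ∈ e.ends) {f : Edge} (hf : f ∈ P) (hfW : f ∉ W) (huf : u ∈ f.ends) :
    ¬MatchedBy P W e := by
  intro h
  obtain ⟨g, hg, hgW, hug⟩ := h u hu
  rw [SnakeGraph.matching_unique hP hg hf hug huf] at hgW
  exact hfW hgW

theorem endR_matchedBy_compl (hk : X.IsWindow k) (hm : Admissible X.G.d X.sgn1 m)
    (h : m (k + X.p + 1) = -X.sgn1 (k + X.p)) :
    MatchedBy (X.G.ofCode X.sgn1 m) (X.window k)ᶜ (X.endR k) := by
  have hp := X.p_eq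
  have hk' := hk
  unfold IsWindow at hk'
  intro u hu
  rw [endR_eq] at hu
  have key : ∀ j c σ, k + X.p + 1 ≤ j → j ≤ X.G.d → Selected X.sgn1 m j c σ →
      u ∈ (X.G.edge j c σ).ends → ∃ f ∈ X.G.ofCode X.sgn1 m, f ∈ (X.window k)ᶜ ∧ u ∈ f.ends := by
    intro j c σ h1 h2 h3 h4
    refine ⟨_, edge_mem (by omega) h2 h3, fun h5 => ?_, h4⟩
    obtain ⟨rfl, rfl, rfl⟩ := (edge_mem_window_right hk (by omega)).1 h5
    exact units_ne_neg _ (h3.1.symm.trans h)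
  rcases (isCorner_iff_ends _ _ (m (k + X.p + 1))).1 (X.G.isCorner_of_mem_ends hu) with h2 | h2
  · refine key (k + X.p + 1) .sw _ le_rfl (by omega) ⟨rfl, fun h3 => ?_⟩ h2
    rw [Nat.add_sub_cancel, h] at h3
    exact absurd h3 (units_ne_neg _)
  · rcases SnakeGraph.exists_selected_right X.isSigns1 (r := X.G.d) (by omega) (by omega) le_rfl
      h2 with ⟨j, c, σ, h3, h4, h5, h6⟩ | ⟨-, h4, -⟩
    · exact key j c σ h3 h4 h5 h6
    · exact absurd (hm.last.symm.trans h4) (units_ne_neg _)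

theorem endL_matchedBy_window (hk : X.IsWindow k) (hR : X.endR k ∈ X.G.ofCode X.sgn1 m)
    (h : m (k + 1) = -X.sgn1 (k + X.p))
    (ha : X.sgn1 k = -X.sgn1 (k + X.p) → m k = X.sgn1 (k + X.p)) :
    MatchedBy (X.G.ofCode X.sgn1 m) (X.window k) (X.endL k) := by
  have hp := X.p_eq
  have hk' := hk
  unfold IsWindow at hk'
  intro u hu
  rw [endL_eq] at hu
  rcases (isCorner_iff_ends _ _ (m (k + 1))).1 (X.G.isCorner_of_mem_ends hu) with h2 | h2
  · refine ⟨X.G.edge (k + 1) .sw (m (k + 1)),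
      edge_mem (by omega) (by omega) ⟨rfl, fun h3 => ?_⟩,
      mem_window_iff.2 ⟨k + 1, .sw, _, by omega, by omega, rfl⟩, h2⟩
    rw [Nat.add_sub_cancel, h] at h3
    rw [Nat.add_sub_cancel, h, neg_neg]
    exact ha h3
  · rcases SnakeGraph.exists_selected_right X.isSigns1 (r := k + X.p) (by omega) (by omega)
      (by omega) h2 with ⟨j, c, σ, h3, h4, h5, h6⟩ | ⟨-, h4, -⟩
    · exact ⟨_, edge_mem (by omega) (by omega) h5,
        mem_window_iff.2 ⟨j, c, σ, by omega, h4, rfl⟩, h6⟩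
    · exact absurd (((endR_mem_iff hk).1 hR).1.symm.trans h4) (units_ne_neg _)

/-- If `m k = ε k`, then the end points of `e_k` are matched before `e_k`. -/
theorem exists_mem_compl_window (hk : X.IsWindow k) (hm : Admissible X.G.d X.sgn1 m)
    (hk1 : 1 ≤ k) (h : m k = X.sgn1 k) {u : ℤ × ℤ}
    (hu : u ∈ (X.G.edge (k + 1) .sw (X.sgn1 k)).ends) :
    ∃ f ∈ X.G.ofCode X.sgn1 m, f ∈ (X.window k)ᶜ ∧ u ∈ f.ends := by
  have hp := X.p_eq
  have hk' := hk
  unfold IsWindow at hk'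
  rw [X.isSigns1.edge_succ_sw hk1 (by omega)] at hu
  have key : ∀ j c σ, 1 ≤ j → j ≤ k → Selected X.sgn1 m j c σ →
      u ∈ (X.G.edge j c σ).ends → ∃ f ∈ X.G.ofCode X.sgn1 m, f ∈ (X.window k)ᶜ ∧ u ∈ f.ends := by
    intro j c σ h1 h2 h3 h4
    refine ⟨_, edge_mem h1 (by omega) h3, fun h5 => ?_, h4⟩
    obtain ⟨rfl, rfl, rfl⟩ := (edge_mem_window_left hk h1 h2).1 h5
    exact units_ne_neg _ (h.symm.trans h3.1)
  rcases (isCorner_iff_ends _ _ (m k)).1 (X.G.isCorner_of_mem_ends hu) with h2 | h2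
  · rcases SnakeGraph.exists_selected_left X.isSigns1 (l := 0) hk1 (by omega) h2 with
        ⟨j, c, σ, h3, h4, h5, h6⟩ | ⟨h3, -⟩
    · exact key j c σ h3 h4 h5 h6
    · exact absurd (hm.first.symm.trans h3) (units_neg_ne _)
  · refine key k .ne _ hk1 le_rfl ⟨by rw [neg_neg], fun h3 => ?_⟩ h2
    exact absurd (h.trans h3) (units_ne_neg _)

/-- The condition on the end points of `endR k` is automatic: whether or not tile k + p + 1 chooses
that edge, both end points are matched on one side. -/
theorem suitable_endL_iff (hk : X.IsWindow k) (hm : Admissible X.G.d X.sgn1 m) :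
    X.Suitable (X.G.ofCode X.sgn1 m) k (X.endL k) (X.endR k) ↔
      X.endL k ∈ X.G.ofCode X.sgn1 m := by
  refine ⟨And.left, fun h => ⟨h, ?_⟩⟩
  rcases units_eq_or_eq_neg (m (k + X.p + 1)) (X.sgn1 (k + X.p)) with h1 | h1
  · exact Or.inl (endR_matchedBy_window hk h h1)
  · exact Or.inr (endR_matchedBy_compl hk hm h1)

theorem tile_mem_ends_sw (G : SnakeGraph) (i : ℕ) (σ : ℤˣ) :
    G.tile i ∈ (G.edge i .sw σ).ends := by
  rw [SnakeGraph.edge, ends_sideOfSign_sw]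
  exact Sym2.mem_mk_left _ _

theorem sgn1_window (hk : X.IsWindow k) :
    X.sgn1 k = X.sgn1 (k + X.p) ∧ X.s ≤ k ∨ X.sgn1 k = -X.sgn1 (k + X.p) ∧ k + 1 = X.s := by
  have hp := X.p_eq
  have hs := X.one_le_s
  have hk' := hk
  unfold IsWindow at hk'
  rcases Nat.lt_or_ge k X.s with h | h
  · have : k = X.s - 1 := by omega
    subst this
    rw [X.sgn1_pred_s, show X.s - 1 + X.p = X.s + X.p - 1 by omega, X.sgn1_glue]
    exact Or.inr ⟨rfl, by omega⟩
  · exact Or.inl ⟨(X.sgn1_periodic h (by omega)).symm, h⟩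

/-- On the left the condition can fail, but only when `endL k` is not the interior edge e_k, that is
for k = s - 1. If tile s - 1 does not choose a, the southwest corner of G_s is matched outside the
window and the other end point of `endL k` inside. -/
theorem suitable_endR_iff (hk : X.IsWindow k) (hm : Admissible X.G.d X.sgn1 m)
    (hL : X.endL k ∉ X.G.ofCode X.sgn1 m) :
    X.Suitable (X.G.ofCode X.sgn1 m) k (X.endR k) (X.endL k) ↔
      X.endR k ∈ X.G.ofCode X.sgn1 m ∧
        (X.sgn1 k = -X.sgn1 (k + X.p) → m k = X.sgn1 (k + X.p)) := by
  have hp := X.p_eq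
  have hs1 := X.one_le_s
  have hk' := hk
  unfold IsWindow at hk'
  rw [endL_mem_iff hk] at hL
  constructor
  · rintro ⟨hR, h⟩
    refine ⟨hR, fun h1 => ?_⟩
    by_contra h2
    have h3 : m k = X.sgn1 k := by
      rw [h1]; exact units_eq_neg_iff_ne.2 h2
    have hk1 : 1 ≤ k := by
      by_contra h0
      have : k = 0 := by omega
      subst this
      exact units_ne_neg _ (h3.symm.trans hm.first)
    have h4 : m (k + 1) = -X.sgn1 (k + X.p) := h1 ▸ hm.step_le (by omega) h3
    obtain ⟨f, hf, hfW, huf⟩ := exists_mem_compl_window hk hm hk1 h3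
      (tile_mem_ends_sw X.G (k + 1) _)
    have hP := SnakeGraph.ofCode_mem_matchings X.isSigns1 hm
    rcases h with h | h
    · exact not_matchedBy hP (by rw [endL_eq]; exact tile_mem_ends_sw _ _ _) hf hfW huf h
    · have hu : sideVertex (X.G.tile (k + 1)) (X.sgn1 (k + X.p)) ∈ (X.endL k).ends := by
        rw [endL_eq, SnakeGraph.edge, ends_sideOfSign_sw]
        exact Sym2.mem_mk_right _ _
      have hu' : sideVertex (X.G.tile (k + 1)) (X.sgn1 (k + X.p)) ∈
          (X.G.edge (k + 1) .ne (-m (k + 1))).ends := by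
        rw [h4, neg_neg, SnakeGraph.edge, ends_sideOfSign_ne]
        exact Sym2.mem_mk_left _ _
      rcases SnakeGraph.exists_selected_right X.isSigns1 (r := k + X.p) (by omega) (by omega)
        (by omega) hu' with ⟨j, c, σ, h5, h6, h7, h8⟩ | ⟨-, h6, -⟩
      · exact not_matchedBy (W := (X.window k)ᶜ) hP hu (edge_mem (by omega) (by omega) h7)
          (fun h9 => h9 (mem_window_iff.2 ⟨j, c, σ, by omega, h6, rfl⟩)) h8 h
      · exact units_ne_neg _ (((endR_mem_iff hk).1 hR).1.symm.trans h6)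
  · rintro ⟨hR, ha⟩
    refine ⟨hR, ?_⟩
    rcases units_eq_or_eq_neg (m (k + 1)) (X.sgn1 (k + X.p)) with h1 | h1
    · have h2 : X.sgn1 k = X.sgn1 (k + X.p) ∧ m k ≠ -X.sgn1 (k + X.p) := by
        by_contra h3
        exact hL ⟨h1, fun h4 => by_contra fun h5 => h3 ⟨h4, h5⟩⟩
      have h3 : m k = X.sgn1 k := by
        rw [h2.1]
        exact (units_eq_or_eq_neg _ _).resolve_right h2.2
      have hk1 : 1 ≤ k := by
        by_contra h0
        have : k = 0 := by omega
        subst this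
        exact units_ne_neg _ (h3.symm.trans hm.first)
      refine Or.inr fun u hu => exists_mem_compl_window hk hm hk1 h3 ?_
      rwa [h2.1, ← endL_eq]
    · exact Or.inl (endL_matchedBy_window hk hR h1 ha)

/-- The code of a matching for which `k` is a cut position. -/
def CodeCut (X : SelfCrossing) (m : ℕ → ℤˣ) (k : ℕ) : Prop :=
  (m (k + 1) = X.sgn1 (k + X.p) ∧ (X.sgn1 k = X.sgn1 (k + X.p) → m k = -X.sgn1 (k + X.p))) ∨
    ((m (k + X.p + 1) = X.sgn1 (k + X.p) ∧ m (k + X.p) = -X.sgn1 (k + X.p)) ∧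
      (X.sgn1 k = -X.sgn1 (k + X.p) → m k = X.sgn1 (k + X.p)))

/-- If `endL k` is in the matching, the first alternative suffices, so the criterion for `endR k` is
needed only in its absence. -/
theorem mem_cutPositions_iff (hm : Admissible X.G.d X.sgn1 m) :
    k ∈ X.cutPositions (X.G.ofCode X.sgn1 m) ↔ X.IsWindow k ∧ X.CodeCut m k := by
  refine and_congr_right fun hk => ?_
  rw [suitable_endL_iff hk hm, CodeCut, ← endL_mem_iff hk, ← endR_mem_iff hk]
  by_cases hL : X.endL k ∈ X.G.ofCode X.sgn1 m
  · simp [hL]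
  · rw [suitable_endR_iff hk hm hL]

end SelfCrossing
end SnakeCalculus

/-! ### Cutting a matching agrees with cutting its code -/

namespace SnakeCalculus
namespace SelfCrossing

variable {X : SelfCrossing} {k : ℕ} {m m₃ n : ℕ → ℤˣ} {S : Set Edge}

open Classical in
/-- The part of a matching belonging to `G4`, if it is cut at position `k`. -/
noncomputable def partAt (X : SelfCrossing) (P : Set Edge) (k : ℕ) : Set Edge :=
  if X.Suitable P k (X.endL k) (X.endR k) then X.cutPart P k (X.endL k) (X.endR k)
  else X.cutPart P k (X.endR k) (X.endL k)

theorem cutPart_subset (X : SelfCrossing) (P : Set Edge) (k : ℕ) (e e' : Edge) :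
    X.cutPart P k e e' ⊆ P ∩ X.window k := by
  unfold cutPart
  split_ifs
  · exact Set.sdiff_subset
  · exact subset_rfl

theorem mem_cutPart {P : Set Edge} {e e' f : Edge} (hf : f ∈ P ∩ X.window k) (hne : f ≠ e) :
    f ∈ X.cutPart P k e e' := by
  unfold cutPart
  split_ifs
  · exact ⟨hf, hne⟩
  · exact hf

theorem partAt_subset (X : SelfCrossing) (P : Set Edge) (k : ℕ) :
    X.partAt P k ⊆ P ∩ X.window k := by
  unfold partAt
  split_ifs <;> exact X.cutPart_subset _ _ _ _

theorem mem_partAt {P : Set Edge} {f : Edge} (hf : f ∈ P ∩ X.window k)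
    (hL : f ≠ X.endL k) (hR : f ≠ X.endR k) : f ∈ X.partAt P k := by
  unfold partAt
  split_ifs
  · exact mem_cutPart hf hL
  · exact mem_cutPart hf hR

/-- Cutting a matching at a cut position. -/
theorem images_partAt (hk : X.IsWindow k) (h : X.Splice k m m₃ n)
    (hm : Admissible X.G.d X.sgn1 m) (hn : Function.Periodic n X.p) (hc : X.CodeCut m k) :
    X.toG3 k (X.G.ofCode X.sgn1 m \ X.partAt (X.G.ofCode X.sgn1 m) k) =
        X.G3.ofCode X.sgn3 m₃ ∧
      X.toG4 (X.partAt (X.G.ofCode X.sgn1 m) k) = X.G4.ofCode n := by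
  have hp := X.p_eq
  have hk' := hk
  unfold IsWindow at hk'
  have hLR := X.endL_ne_endR k
  have hLW := X.endL_mem_window k
  have hRW := X.endR_mem_window k
  have hP := SnakeGraph.ofCode_mem_matchings X.isSigns1 hm
  have hstepk := hm.step_le (i := k) (by omega)
  have hstepR := hm.step_le (i := k + X.p) (by omega)
  have hLi := endL_mem_iff (m := m) hk
  have hRi := endR_mem_iff (m := m) hk
  have h6 : X.sgn1 (k + X.p) ≠ -X.sgn1 (k + X.p) := units_ne_neg _
  refine images_of_window hk h hn (X.partAt_subset _ _) (fun f hf => mem_partAt hf) ?_ ?_ ?_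
  -- The end edges outside S have to represent the glued edge in `G3`. With `endL k` in the
  -- matching, it stays outside S exactly if tile k + p + 1 chooses `endR k`; in the remaining case
  -- the roles of the two ends are exchanged.
  · unfold partAt
    by_cases hL : X.endL k ∈ X.G.ofCode X.sgn1 m
    · rw [if_pos ((suitable_endL_iff hk hm).2 hL)]
      rw [hLi] at hL
      unfold cutPart
      rcases units_eq_or_eq_neg (m (k + X.p + 1)) (X.sgn1 (k + X.p)) with h1 | h1
      · rw [if_pos (endR_matchedBy_window hk (hLi.2 hL) h1)]
        exact ⟨fun _ => ⟨h1, hL.2⟩, fun _ => Or.inl ⟨hLi.2 hL, fun h2 => h2.2 rfl⟩⟩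
      · have hR : X.endR k ∉ X.G.ofCode X.sgn1 m := by
          rw [hRi, h1]
          exact fun h2 => h6 h2.1.symm
        rw [if_neg]
        · refine ⟨?_, fun h2 => absurd (h2.1.symm.trans h1) h6⟩
          rintro (h2 | h2)
          · exact absurd ⟨h2.1, hLW⟩ h2.2
          · exact absurd h2.1 hR
        · obtain ⟨f, hf, hfW, huf⟩ := endR_matchedBy_compl hk hm h1 (X.endR k).base
            (Sym2.mem_mk_left _ _)
          exact not_matchedBy hP (Sym2.mem_mk_left _ _) hf hfW huf
    · rw [if_neg (fun h2 => hL ((suitable_endL_iff hk hm).1 h2))]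
      have hc' := hc.resolve_left (fun h2 => hL (hLi.2 h2))
      have hR := hRi.2 hc'.1
      unfold cutPart
      rcases units_eq_or_eq_neg (m (k + 1)) (X.sgn1 (k + X.p)) with h1 | h1
      -- Tile k + 1 chooses `endL k`, yet this edge is not selected. So it is the interior edge e_k,
      -- refused by tile k, and its end points are matched outside the window.
      · have h2 : X.sgn1 k = X.sgn1 (k + X.p) ∧ m k ≠ -X.sgn1 (k + X.p) := by
          by_contra h3
          exact hL (hLi.2 ⟨h1, fun h4 => by_contra fun h5 => h3 ⟨h4, h5⟩⟩)
        have h3 : m k = X.sgn1 k := by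
          rw [h2.1]
          exact (units_eq_or_eq_neg _ _).resolve_right h2.2
        have hk1 : 1 ≤ k := by
          by_contra h0
          have : k = 0 := by omega
          subst this
          exact units_ne_neg _ (h3.symm.trans hm.first)
        rw [if_neg]
        · refine ⟨?_, fun h4 => absurd (h4.2 h2.1) h2.2⟩
          rintro (h4 | h4)
          · exact absurd h4.1 hL
          · exact absurd ⟨h4.1, hRW⟩ h4.2
        · have hu : X.G.tile (k + 1) ∈ (X.endL k).ends := by
            rw [endL_eq]; exact tile_mem_ends_sw _ _ _
          obtain ⟨f, hf, hfW, huf⟩ := exists_mem_compl_window hk hm hk1 h3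
            (tile_mem_ends_sw X.G (k + 1) _)
          exact not_matchedBy hP hu hf hfW huf
      · rw [if_pos (endL_matchedBy_window hk hR h1 hc'.2)]
        refine ⟨fun _ => ⟨hc'.1.1, fun h2 => ?_⟩, fun _ => Or.inr ⟨hR, fun h2 => h2.2 rfl⟩⟩
        by_contra h3
        have h4 := (units_eq_or_eq_neg _ _).resolve_right h3
        rw [h4, ← h2] at hstepk
        exact units_ne_neg _ ((hstepk rfl).symm.trans (h2 ▸ h1))
  -- The same cases for the end edges inside S, which have to represent the glueing edge of `G4`.
  · unfold partAt
    by_cases hL : X.endL k ∈ X.G.ofCode X.sgn1 m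
    · rw [if_pos ((suitable_endL_iff hk hm).2 hL)]
      rw [hLi] at hL
      unfold cutPart
      rcases units_eq_or_eq_neg (m (k + X.p + 1)) (X.sgn1 (k + X.p)) with h1 | h1
      · rw [if_pos (endR_matchedBy_window hk (hLi.2 hL) h1)]
        constructor
        · rintro (h2 | h2)
          · exact absurd rfl h2.2
          · exact ⟨hL.1, (hRi.1 h2.1.1).2⟩
        · rintro ⟨-, h2⟩
          exact Or.inr ⟨⟨hRi.2 ⟨h1, h2⟩, hRW⟩, hLR.symm⟩
      · rw [if_neg]
        · refine ⟨fun _ => ⟨hL.1, ?_⟩, fun _ => Or.inl ⟨hLi.2 hL, hLW⟩⟩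
          by_contra h3
          have h4 := (units_eq_or_eq_neg _ _).resolve_right h3
          exact h6 ((hstepR h4).symm.trans h1)
        · obtain ⟨f, hf, hfW, huf⟩ := endR_matchedBy_compl hk hm h1 (X.endR k).base
            (Sym2.mem_mk_left _ _)
          exact not_matchedBy hP (Sym2.mem_mk_left _ _) hf hfW huf
    · rw [if_neg (fun h2 => hL ((suitable_endL_iff hk hm).1 h2))]
      have hc' := hc.resolve_left (fun h2 => hL (hLi.2 h2))
      have hR := hRi.2 hc'.1
      unfold cutPart
      rcases units_eq_or_eq_neg (m (k + 1)) (X.sgn1 (k + X.p)) with h1 | h1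
      · have h2 : X.sgn1 k = X.sgn1 (k + X.p) ∧ m k ≠ -X.sgn1 (k + X.p) := by
          by_contra h3
          exact hL (hLi.2 ⟨h1, fun h4 => by_contra fun h5 => h3 ⟨h4, h5⟩⟩)
        have h3 : m k = X.sgn1 k := by
          rw [h2.1]
          exact (units_eq_or_eq_neg _ _).resolve_right h2.2
        have hk1 : 1 ≤ k := by
          by_contra h0
          have : k = 0 := by omega
          subst this
          exact units_ne_neg _ (h3.symm.trans hm.first)
        rw [if_neg]
        · exact ⟨fun _ => ⟨h1, hc'.1.2⟩, fun _ => Or.inr ⟨hR, hRW⟩⟩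
        · have hu : X.G.tile (k + 1) ∈ (X.endL k).ends := by
            rw [endL_eq]; exact tile_mem_ends_sw _ _ _
          obtain ⟨f, hf, hfW, huf⟩ := exists_mem_compl_window hk hm hk1 h3
            (tile_mem_ends_sw X.G (k + 1) _)
          exact not_matchedBy hP hu hf hfW huf
      · rw [if_pos (endL_matchedBy_window hk hR h1 hc'.2)]
        constructor
        · rintro (h2 | h2)
          · exact absurd h2.1.1 hL
          · exact absurd rfl h2.2
        · rintro ⟨h2, -⟩
          exact absurd (h2.symm.trans h1) h6
  · intro h1 _
    rcases hc with ⟨h2, -⟩ | ⟨-, h2⟩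
    · by_contra h3
      have h4 := units_eq_neg_iff_ne.2 h3
      rw [← h1] at h4
      have h5 := hstepk h4
      rw [h1, h2] at h5
      exact h6 h5
    · exact h2 h1

open Classical in
/-- Cutting off the first tiles of the overlap, if the matching is not cut there by `e_{s'-1}`. -/
theorem images_boundaryPart (hk : X.IsWindow k) (hks : k + 1 = X.s) (h : X.Splice k m m₃ n)
    (hn : Function.Periodic n X.p)
    (h1 : m (k + 1) = -X.bandSign) (h2 : m (k + X.p + 1) = -X.bandSign) :
    X.toG3 k (X.G.ofCode X.sgn1 m \ X.boundaryPart (X.G.ofCode X.sgn1 m)) =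
        X.G3.ofCode X.sgn3 m₃ ∧
      X.toG4 (X.boundaryPart (X.G.ofCode X.sgn1 m)) = X.G4.ofCode n := by
  have hp := X.p_eq
  have hk' := hk
  unfold IsWindow at hk'
  have hs := X.one_le_s
  have e1 : X.sgn1 (k + X.p) = X.bandSign := by
    rw [show k + X.p = X.s + X.p - 1 by omega, X.sgn1_glue]
  have e2 : X.sgn1 k = -X.bandSign := by
    rw [show k = X.s - 1 by omega, X.sgn1_pred_s]
  have h6 : X.bandSign ≠ -X.bandSign := units_ne_neg _
  have hL : X.endL k ∉ X.G.ofCode X.sgn1 m := by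
    rw [endL_mem_iff hk, e1, h1]
    exact fun h => h6 h.1.symm
  have hR : X.endR k ∉ X.G.ofCode X.sgn1 m := by
    rw [endR_mem_iff hk, e1, h2]
    exact fun h => h6 h.1.symm
  have hW : X.G.edgesOn X.s (X.s' - 1) = X.window k := by
    rw [window, hks, show X.s' - 1 = k + X.p by omega]
  have ha : X.a = X.G.edge (k + 1) .sw (-X.bandSign) := by rw [a, aSign_eq, hks]
  have hac : X.aCopy = X.G.edge (k + X.p + 1) .sw (-X.bandSign) := by
    rw [aCopy, aSign_eq, show X.s' = k + X.p + 1 by omega]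
  have hai : X.a ∈ X.G.ofCode X.sgn1 m ↔ m k = X.bandSign := by
    rw [ha, (selected_junction_mem hk _).1, h1, e2, neg_neg]
    simp
  unfold boundaryPart
  rw [hW]
  split_ifs with hA
  · refine images_of_window hk h hn subset_rfl (fun e he _ _ => he) ?_ ?_ ?_
    · rw [h2, e1]
      refine ⟨?_, fun h3 => absurd h3.1.symm h6⟩
      rintro (h3 | h3)
      · exact absurd h3.1 hL
      · exact absurd h3.1 hR
    · rw [h1, e1]
      refine ⟨?_, fun h3 => absurd h3.1.symm h6⟩
      rintro (h3 | h3)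
      · exact absurd h3.1 hL
      · exact absurd h3.1 hR
    · rw [e1]
      exact fun _ _ => hai.1 hA
  -- Tile s chooses a but the matching omits it, so no south/west edge of G_s is present. The copy
  -- of a at G_{s'} is present and supplies the edge a of `G4`; consequently `G3` must not receive
  -- it.
  · rw [hai] at hA
    have hacP : X.aCopy ∈ X.G.ofCode X.sgn1 m := by
      rw [hac, (selected_junction_mem hk _).2, h2, e1]
      exact ⟨rfl, fun h3 => absurd h3 h6⟩
    have hapL : ∀ σ, X.G.edge (k + 1) .sw σ ∉ X.G.ofCode X.sgn1 m := by
      intro σ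
      rcases units_eq_or_eq_neg σ X.bandSign with rfl | rfl
      · rw [← e1, ← endL_eq]; exact hL
      · rw [← ha, hai]; exact hA
    have hcut : X.IsCut k (X.G.ofCode X.sgn1 m)
        (X.G.ofCode X.sgn1 m ∩ (X.window k ∪ {X.aCopy})) := by
      have h0 := isCut_of_window (S := X.G.ofCode X.sgn1 m ∩ X.window k) hk subset_rfl
        (fun e he _ _ => he)
      refine ⟨Set.inter_subset_left, fun i c σ h3 h4 h5 h7 => ?_, fun i c σ h3 h4 h5 => ?_⟩
      · have := h0.inside i c σ h3 h4 h5 h7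
        exact ⟨this.1, Or.inl this.2⟩
      · rcases h5.2 with h7 | h7
        · exact h0.outside i c σ h3 h4 ⟨h5.1, h7⟩
        · exact ⟨_, Or.inr (h7.trans hac)⟩
    refine ⟨hcut.toG3_eq hk h fun σ => ?_, hcut.toG4_eq hk h hn (fun σ => ?_) fun σ _ =>
      Or.inl (by omega)⟩
    · rw [h.selected3_junction hk, h2, e2]
      refine ⟨?_, ?_⟩
      · rintro (h3 | h3)
        · exact absurd h3.1 (hapL σ)
        · rcases units_eq_or_eq_neg σ X.bandSign with rfl | rfl
          · rw [← e1, ← endR_eq] at h3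
            exact absurd h3.1 hR
          · rw [← hac] at h3
            exact absurd ⟨h3.1, Or.inr rfl⟩ h3.2
      · rintro ⟨rfl, h3⟩
        rw [neg_neg] at h3
        exact absurd (h3 rfl) hA
    · rw [h.selected4_junction hk hn, h1, e1]
      refine ⟨?_, ?_⟩
      · rintro (h3 | h3)
        · exact absurd h3.1 (hapL σ)
        · rcases units_eq_or_eq_neg σ X.bandSign with rfl | rfl
          · rw [← e1, ← endR_eq] at h3
            exact absurd h3.1 hR
          · exact ⟨rfl, fun h4 => absurd h4 h6⟩
      · rintro ⟨rfl, -⟩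
        rw [← hac]
        exact Or.inr ⟨hacP, Or.inr rfl⟩

theorem boundaryPart_subset (hks : k + 1 = X.s) (P : Set Edge) :
    X.boundaryPart P ⊆ P ∩ (X.window k ∪ {e | k + 1 = X.s ∧ e = X.aCopy}) ∧
      P ∩ X.window k ⊆ X.boundaryPart P := by
  have hp := X.p_eq
  have hW : X.G.edgesOn X.s (X.s' - 1) = X.window k := by
    rw [window, hks, show X.s' - 1 = k + X.p by omega]
  unfold boundaryPart
  rw [hW]
  split_ifs
  · exact ⟨fun e he => ⟨he.1, Or.inl he.2⟩, subset_rfl⟩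
  · exact ⟨fun e he => ⟨he.1, he.2.imp id fun h => ⟨hks, h⟩⟩,
      fun e he => ⟨he.1, Or.inl he.2⟩⟩

theorem isSplice_of_images (hm : Admissible X.G.d X.sgn1 m)
    (h1 : S ⊆ X.G.ofCode X.sgn1 m ∩ (X.window k ∪ {e | k + 1 = X.s ∧ e = X.aCopy}))
    (h2 : ∀ e ∈ X.G.ofCode X.sgn1 m ∩ X.window k, e ≠ X.endL k → e ≠ X.endR k → e ∈ S)
    (hk : X.IsWindow k) {Q : Set Edge × Set X.G4.BEdge}
    (h3 : X.toG3 k (X.G.ofCode X.sgn1 m \ S) = Q.1) (h4 : X.toG4 S = Q.2) :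
    X.IsSplice k Q (X.G.ofCode X.sgn1 m) := by
  have hp := X.p_eq
  unfold IsWindow at hk
  refine ⟨SnakeGraph.ofCode_mem_matchings X.isSigns1 hm, S, fun e he => (h1 he).1,
    fun e he => (h1 he).2, ?_, h3, h4⟩
  rintro e ⟨he, heS⟩
  obtain ⟨i, c, σ, hi, hid, rfl⟩ := X.G.mem_edgesOn_iff.1 (SnakeGraph.ofCode_subset he)
  by_cases hw : X.G.edge i c σ ∈ X.window k
  · by_cases hL : X.G.edge i c σ = X.endL k
    · exact Or.inl (Or.inr hL)
    · by_cases hR : X.G.edge i c σ = X.endR k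
      -- The right end edge is also an edge of tile k + p + 1 and therefore allowed in the outer
      -- part.
      · refine Or.inr (X.G.mem_edgesOn_iff.2 ⟨k + X.p + 1, .sw, X.sgn1 (k + X.p), le_rfl, by omega, ?_⟩)
        rw [hR, endR_eq]
      · exact absurd (h2 _ ⟨he, hw⟩ hL hR) heS
  · rcases Nat.lt_or_ge k i with h5 | h5
    · rcases Nat.lt_or_ge (k + X.p) i with h6 | h6
      · exact Or.inr (X.G.mem_edgesOn_iff.2 ⟨i, c, σ, h6, hid, rfl⟩)
      · exact absurd (mem_window_iff.2 ⟨i, c, σ, h5, h6, rfl⟩) hw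
    · exact Or.inl (Or.inl (X.G.mem_edgesOn_iff.2 ⟨i, c, σ, hi, h5, rfl⟩))

-- At a cut position the cut part does it. Otherwise the rules for the three codes restrict the
-- values at the junction: for s ≤ k no end edge occurs, and S is all of the matching on the window;
-- for k = s - 1 the tiles s and s' both choose their copies of a, and S is `boundaryPart`.
set_option synthInstance.maxHeartbeats 400000 in
set_option synthInstance.maxSize 2000 in
theorem Splice.isSplice (h : X.Splice k m m₃ n) (hk : X.IsWindow k)
    (hm : Admissible X.G.d X.sgn1 m) (hm₃ : Admissible X.G3.d X.sgn3 m₃)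
    (hn : X.G4.Admissible n) :
    X.IsSplice k (X.G3.ofCode X.sgn3 m₃, X.G4.ofCode n) (X.G.ofCode X.sgn1 m) := by
  have hp := X.p_eq
  have hd := X.G3_d
  have hk' := hk
  unfold IsWindow at hk'
  have hnp : Function.Periodic n X.p := hn.periodic
  by_cases hc : X.CodeCut m k
  · have hi := images_partAt hk h hm hnp hc
    exact isSplice_of_images hm (fun e he => ⟨(X.partAt_subset _ _ he).1,
      Or.inl (X.partAt_subset _ _ he).2⟩) (fun e he => mem_partAt he) hk hi.1 hi.2
  have hc' := hc
  unfold CodeCut at hc'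
  push Not at hc'
  obtain ⟨hc1, hc2⟩ := hc'
  have hstepk := hm.step_le (i := k) (by omega)
  have hstepR := hm.step_le (i := k + X.p) (by omega)
  have hn1 := hn.step (k + 1 - X.s)
  rw [cyclicSgn_window hk, h.n_window hk hnp,
    show k + 1 - X.s + 1 = k + 1 + 1 - X.s by omega, ← h.mid (k + 1) (by omega) (by omega)] at hn1
  have h31 := hm₃.step_le (i := k) (by omega)
  rw [sgn3_of_le hk le_rfl, ← h.left k le_rfl, ← h.right (k + 1) (by omega) (by omega),
    show k + 1 + X.p = k + X.p + 1 by ring] at h31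
  rcases sgn1_window hk with ⟨e1, hks⟩ | ⟨e1, hks⟩
  · have hS : X.toG3 k (X.G.ofCode X.sgn1 m \ (X.G.ofCode X.sgn1 m ∩ X.window k)) =
        X.G3.ofCode X.sgn3 m₃ ∧ X.toG4 (X.G.ofCode X.sgn1 m ∩ X.window k) = X.G4.ofCode n := by
      refine images_of_window hk h hnp subset_rfl (fun e he _ _ => he) ?_ ?_ ?_
      · have hL : X.endL k ∉ X.G.ofCode X.sgn1 m := by
          rw [endL_mem_iff hk]
          intro h1
          obtain ⟨h2, h3⟩ := hc1 h1.1
          exact h3 (h1.2 h2)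
        have hR : X.endR k ∉ X.G.ofCode X.sgn1 m := by
          rw [endR_mem_iff hk]
          intro h1
          exact units_ne_neg _ (e1.symm.trans (hc2 h1).1)
        simp only [Set.mem_sdiff, hL, hR, false_and, or_self, false_iff]
        rw [endR_mem_iff hk] at hR
        rw [endL_mem_iff hk] at hL
        rw [e1] at hstepk h31 hL ⊢
        revert hL hR hstepk hstepR hn1 h31
        generalize m (k + 1) = x1
        generalize m k = x2
        generalize m (k + X.p + 1) = x3
        generalize m (k + X.p) = x4
        generalize X.sgn1 (k + X.p) = x5
        clear * -
        revert x1 x2 x3 x4 x5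
        decide
      · have hL : X.endL k ∉ X.G.ofCode X.sgn1 m := by
          rw [endL_mem_iff hk]
          intro h1
          obtain ⟨h2, h3⟩ := hc1 h1.1
          exact h3 (h1.2 h2)
        have hR : X.endR k ∉ X.G.ofCode X.sgn1 m := by
          rw [endR_mem_iff hk]
          intro h1
          exact units_ne_neg _ (e1.symm.trans (hc2 h1).1)
        simp only [Set.mem_inter_iff, hL, hR, false_and, or_self, false_iff]
        rw [endR_mem_iff hk] at hR
        rw [endL_mem_iff hk] at hL
        rw [e1] at hstepk h31 hL
        revert hL hR hstepk hstepR hn1 h31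
        generalize m (k + 1) = x1
        generalize m k = x2
        generalize m (k + X.p + 1) = x3
        generalize m (k + X.p) = x4
        generalize X.sgn1 (k + X.p) = x5
        clear * -
        revert x1 x2 x3 x4 x5
        decide
      · intro h1
        exact absurd (e1.symm.trans h1) (units_ne_neg _)
    exact isSplice_of_images hm (fun e he => ⟨he.1, Or.inl he.2⟩) (fun e he _ _ => he) hk hS.1 hS.2
  · have e2 : X.sgn1 (k + X.p) = X.bandSign := by
      rw [show k + X.p = X.s + X.p - 1 by omega, X.sgn1_glue]
    rw [e2] at e1 hc1 hc2 hstepR hn1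
    rw [e1] at hc1 hc2 hstepk h31
    have hh : m (k + 1) = -X.bandSign ∧ m (k + X.p + 1) = -X.bandSign := by
      revert hc1 hc2 hstepk hstepR hn1 h31
      generalize m (k + 1) = x1
      generalize m k = x2
      generalize m (k + X.p + 1) = x3
      generalize m (k + X.p) = x4
      generalize X.bandSign = x5
      clear * -
      revert x1 x2 x3 x4 x5
      decide
    have hi := images_boundaryPart hk hks h hnp hh.1 hh.2
    have hb := boundaryPart_subset hks (X.G.ofCode X.sgn1 m)
    exact isSplice_of_images hm hb.1 (fun e he _ _ => hb.2 he) hk hi.1 hi.2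

end SelfCrossing
end SnakeCalculus

/-! ### Recovering the codes from a spliced matching -/

namespace SnakeCalculus

theorem units_eq_of_iff {a b c : ℤˣ} (h : a = c ↔ b = c) : a = b := by
  revert a b c; decide

namespace SelfCrossing

variable {X : SelfCrossing} {k : ℕ} {m m₃ n : ℕ → ℤˣ} {S : Set Edge}

/-- The side of a tile which is never an interior edge. -/
theorem boundary_edge_eq {G : SnakeGraph} {ε : ℕ → ℤˣ} (hε : G.IsSigns ε) {i j : ℕ} {c : Corner}
    {σ : ℤˣ} (hi : 1 ≤ i) (hj : 1 ≤ j) (hjd : j ≤ G.d)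
    (h : G.edge i .ne (-ε i) = G.edge j c σ) : i = j ∧ c = .ne ∧ σ = -ε i := by
  obtain ⟨rfl, ⟨h1, rfl⟩ | ⟨-, rfl, h1, h2⟩ | ⟨h1, -⟩⟩ := G.edge_eq_edge hi hj h
  · exact ⟨h1, rfl, rfl⟩
  · rw [← hε i hi (by omega)] at h2
    exact absurd h2 (units_neg_ne _)
  · cases h1

theorem sgn3_eq_of_gt {i : ℕ} (hk : X.IsWindow k) (hi : k < i) :
    X.sgn3 i = X.sgn1 (i + X.p) :=
  sgn3_of_ge (by unfold IsWindow at hk; omega)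

/-- A spliced matching is determined by its parts. -/
theorem splice_of_isSplice (hk : X.IsWindow k) (hm : Admissible X.G.d X.sgn1 m)
    (hm₃ : Admissible X.G3.d X.sgn3 m₃) (hn : X.G4.Admissible n)
    (h : X.IsSplice k (X.G3.ofCode X.sgn3 m₃, X.G4.ofCode n) (X.G.ofCode X.sgn1 m)) :
    X.Splice k m m₃ n := by
  have hp := X.p_eq
  have hd := X.G3_d
  have hk' := hk
  have hs1 := X.one_le_s
  unfold IsWindow at hk'
  obtain ⟨-, S, hSP, hSW, hPS, h3, h4⟩ := h
  dsimp only at h3 h4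
  -- All values are compared through the north/east edges that are not interior. Each lies on one
  -- tile only, so its position decides whether it belongs to S.
  have hmem : ∀ i, 1 ≤ i → i ≤ X.G.d →
      (X.G.edge i .ne (-X.sgn1 i) ∈ X.G.ofCode X.sgn1 m ↔ m i = X.sgn1 i) := fun i h1 h2 =>
    SnakeGraph.ne_mem_ofCode_iff X.isSigns1 h1 h2
  have hmem3 : ∀ i, 1 ≤ i → i ≤ X.G3.d →
      (X.G3.edge i .ne (-X.sgn3 i) ∈ X.G3.ofCode X.sgn3 m₃ ↔ m₃ i = X.sgn3 i) := fun i h1 h2 =>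
    SnakeGraph.ne_mem_ofCode_iff X.isSigns3 h1 h2
  have hnb : ∀ {i j c σ}, 1 ≤ i → 1 ≤ j → j ≤ X.G.d →
      X.G.edge i .ne (-X.sgn1 i) = X.G.edge j c σ → i = j ∧ c = .ne ∧ σ = -X.sgn1 i :=
    fun h1 h2 h5 h6 => boundary_edge_eq X.isSigns1 h1 h2 h5 h6
  have hnb3 : ∀ {i j c σ}, 1 ≤ i → 1 ≤ j → j ≤ X.G3.d →
      X.G3.edge i .ne (-X.sgn3 i) = X.G3.edge j c σ → i = j ∧ c = .ne ∧ σ = -X.sgn3 i :=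
    fun h1 h2 h5 h6 => boundary_edge_eq X.isSigns3 h1 h2 h5 h6
  have hin : ∀ i, 1 ≤ i → X.G.edge i .ne (-X.sgn1 i) ∈ S → k < i ∧ i ≤ k + X.p := by
    intro i hi hiS
    rcases hSW hiS with h5 | ⟨h5, h6⟩
    · obtain ⟨j, c, σ, h6, h7, h8⟩ := mem_window_iff.1 h5
      obtain ⟨rfl, -⟩ := hnb hi (by omega) (by omega) h8
      exact ⟨h6, h7⟩
    · obtain ⟨-, h7, -⟩ := hnb hi (by omega) (by omega) h6
      cases h7
  have hout : ∀ i, 1 ≤ i → X.G.edge i .ne (-X.sgn1 i) ∈ X.G.ofCode X.sgn1 m \ S →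
      i ≤ k ∨ k + X.p < i := by
    intro i hi hiS
    rcases hPS hiS with (h5 | h5) | h5
    · obtain ⟨j, c, σ, h6, h7, h8⟩ := X.G.mem_edgesOn_iff.1 h5
      obtain ⟨rfl, -⟩ := hnb hi h6 (by omega) h8
      exact Or.inl h7
    · obtain ⟨-, h7, -⟩ := hnb hi (by omega) (by omega) (h5.trans (X.endL_eq k))
      cases h7
    · obtain ⟨j, c, σ, h6, h7, h8⟩ := X.G.mem_edgesOn_iff.1 h5
      obtain ⟨rfl, -⟩ := hnb hi (by omega) h7 h8
      exact Or.inr (by omega)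
  refine ⟨fun i hik => ?_, fun i hik hik' => ?_, fun i hik hid => ?_⟩
  · rcases Nat.eq_zero_or_pos i with rfl | hi
    · rw [hm.first, hm₃.first, sgn3_of_le hk hik]
    · have e1 := sgn3_of_le hk hik
      have h5 := hmem i hi (by omega)
      have h6 := hmem3 i hi (by omega)
      rw [e1] at h6
      refine units_eq_of_iff (h5.symm.trans (Iff.trans ?_ h6))
      rw [← h3]
      constructor
      · intro h7
        refine ⟨i, .ne, _, hi, by omega, ⟨h7, fun h8 => ?_⟩, Or.inl ⟨Or.inl hik, rfl⟩⟩
        have := hin i hi h8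
        omega
      · rintro ⟨j, c, σ, hj, hjd, hjm, ⟨h7, h8⟩ | ⟨h7, h8⟩⟩
        · rw [← e1] at h8
          obtain ⟨rfl, rfl, rfl⟩ := hnb3 hi hj (by omega) h8
          rw [e1] at hjm
          exact hjm.1
        · rw [← e1] at h8
          have := (hnb3 hi (by omega) (by omega) h8).1
          omega
  · have hcyc := cyclicSgn_of_ge (X := X) (i := i) (by omega) (by omega)
    have h5 := hmem i (by omega) (by omega)
    have h6 : X.G4.edge (i - X.s) .ne (-X.G4.cyclicSgn (i - X.s + 1)) ∈ X.G4.ofCode n ↔ _ :=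
      BandGraph.ne_mem_ofCode_iff hn.periodic
    rw [hcyc] at h6
    rw [show i + 1 - X.s = i - X.s + 1 by omega]
    refine units_eq_of_iff (h5.symm.trans (Iff.trans ?_ h6))
    rw [← h4]
    constructor
    · intro h7
      refine ⟨i, .ne, _, by omega, by omega, ?_, rfl⟩
      by_contra h8
      have := hout i (by omega) ⟨h7, h8⟩
      omega
    · rintro ⟨j, c, σ, hj, hjd, hjS, h8⟩
      obtain ⟨rfl, ⟨h9, rfl⟩ | ⟨-, -, -, h10⟩ | ⟨h9, -⟩⟩ := BandGraph.edge_eq_edge h8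
      · have h10 : X.sgn1 i = X.sgn1 j := by
          rw [← hcyc, ← cyclicSgn_of_ge hj (by omega)]
          exact X.G4.cyclicSgn_periodic.congr_nat (h9.add_right 1)
        have hjS' := hjS
        rw [h10] at hjS'
        have h11 := hin j (by omega) hjS'
        have h12 : i = j := by
          have h13 : k + 1 + (i - (k + 1)) - X.s ≡ k + 1 + (j - (k + 1)) - X.s [MOD X.p] := by
            rw [show k + 1 + (i - (k + 1)) = i by omega, show k + 1 + (j - (k + 1)) = j by omega]
            exact h9
          rw [show k + 1 + (i - (k + 1)) - X.s = (k + 1 - X.s) + (i - (k + 1)) by omega,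
            show k + 1 + (j - (k + 1)) - X.s = (k + 1 - X.s) + (j - (k + 1)) by omega] at h13
          have h14 := Nat.ModEq.add_left_cancel' _ h13
          have h15 := Nat.ModEq.eq_of_lt_of_lt h14 (by omega) (by omega)
          omega
        rw [h12] at hjS ⊢
        exact hSP hjS
      · rw [hcyc] at h10
        exact absurd h10 (units_neg_ne _)
      · cases h9
  · rcases hid.eq_or_lt with rfl | hlt
    · rw [hm₃.last, show X.G3.d + 1 + X.p = X.G.d + 1 by omega, hm.last,
        sgn3_eq_of_gt hk (by omega), show X.G3.d + X.p = X.G.d by omega]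
    · have e1 := sgn3_eq_of_gt hk hik
      have h5 := hmem (i + X.p) (by omega) (by omega)
      have h6 := hmem3 i (by omega) (by omega)
      rw [e1] at h6
      refine units_eq_of_iff (h5.symm.trans (Iff.trans ?_ h6))
      rw [← h3]
      constructor
      · intro h7
        refine ⟨i + X.p, .ne, _, by omega, by omega, ⟨h7, fun h8 => ?_⟩,
          Or.inr ⟨by omega, by rw [Nat.add_sub_cancel]⟩⟩
        have := hin _ (by omega) h8
        omega
      · rintro ⟨j, c, σ, hj, hjd, hjm, ⟨h7, h8⟩ | ⟨h7, h8⟩⟩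
        · rw [← e1] at h8
          obtain ⟨h9, h10, -⟩ := hnb3 (by omega) hj (by omega) h8
          subst h10
          rcases h7 with h7 | ⟨-, h7⟩
          · omega
          · cases h7
        · rw [← e1] at h8
          obtain ⟨rfl, rfl, rfl⟩ := hnb3 (by omega) (by omega) (by omega) h8
          rw [e1, Nat.sub_add_cancel (by omega)] at hjm
          rw [Nat.sub_add_cancel (by omega)]
          exact hjm.1

end SelfCrossing
end SnakeCalculus

/-! ### Admissibility at the junctions -/

namespace SnakeCalculus
namespace SelfCrossing

variable {X : SelfCrossing} {k : ℕ} {m m₃ n : ℕ → ℤˣ}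

/-- The condition on the codes `m₃` of `G3` and `n` of `G4` for a splice at position `k`. -/
def Junction (X : SelfCrossing) (k : ℕ) (m₃ n : ℕ → ℤˣ) : Prop :=
  (m₃ k = X.sgn1 k → n (k + 1 - X.s + 1) = X.sgn1 k) ∧
    (n (k + 1 - X.s) = X.sgn1 (k + X.p) → m₃ (k + 1) = X.sgn1 (k + X.p))

/-- The rule inside each piece is inherited. New are only the steps from k to k + 1 and from k + p
to k + p + 1, where values of the two codes meet. -/
theorem Splice.admissible_iff (h : X.Splice k m m₃ n) (hk : X.IsWindow k)
    (hm₃ : Admissible X.G3.d X.sgn3 m₃) (hn : X.G4.Admissible n) :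
    Admissible X.G.d X.sgn1 m ↔ X.Junction k m₃ n := by
  have hp := X.p_eq
  have hd := X.G3_d
  have hk' := hk
  unfold IsWindow at hk'
  have e1 : m (k + 1) = n (k + 1 - X.s + 1) := by
    rw [h.mid (k + 1) (by omega) (by omega)]; congr 1; omega
  have e2 : m (k + X.p + 1) = m₃ (k + 1) := by
    rw [← h.right (k + 1) (by omega) (by omega)]; congr 1; omega
  have e3 := h.n_window hk hn.periodic
  have e4 := h.left k le_rfl
  constructor
  · intro hm
    have h1 := hm.step_le (i := k) (by omega)
    have h2 := hm.step_le (i := k + X.p) (by omega)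
    rw [e1, e4] at h1
    rw [e2, ← e3] at h2
    exact ⟨h1, h2⟩
  · rintro ⟨h1, h2⟩
    refine ⟨?_, ?_, fun i hi hid h3 => ?_⟩
    · rw [h.left 0 (by omega), hm₃.first, sgn3_of_le hk (by omega)]
    · rw [show X.G.d + 1 = X.G3.d + 1 + X.p by omega, h.right _ (by omega) le_rfl, hm₃.last,
        sgn3_eq_of_gt hk (by omega), show X.G3.d + X.p = X.G.d by omega]
    · rcases lt_trichotomy i k with h4 | rfl | h4
      · rw [h.left i h4.le] at h3
        rw [h.left (i + 1) h4]
        rw [← sgn3_of_le hk h4.le] at h3 ⊢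
        exact hm₃.step i hi (by omega) h3
      · rw [e1]
        exact h1 (by rw [← e4, h3])
      · rcases lt_trichotomy i (k + X.p) with h5 | rfl | h5
        · have h6 := hn.step (i + 1 - X.s)
          rw [X.cyclicSgn_eq (by omega) (by omega) (by omega),
            show i + 1 - X.s + 1 = i + 1 + 1 - X.s by omega] at h6
          rw [h.mid i h4 h5.le] at h3
          rw [h.mid (i + 1) (by omega) (by omega)]
          exact h6 h3
        · rw [e2]
          exact h2 (by rw [e3, h3])
        · obtain ⟨j, rfl⟩ := Nat.exists_eq_add_of_le' (show X.p ≤ i by omega)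
          rw [h.right j (by omega) (by omega), ← sgn3_eq_of_gt hk (by omega)] at h3
          rw [show j + X.p + 1 = j + 1 + X.p by ring, h.right (j + 1) (by omega) (by omega),
            ← sgn3_eq_of_gt hk (by omega)]
          exact hm₃.step j (by omega) (by omega) h3

theorem exists_splice (X : SelfCrossing) (k : ℕ) (m₃ n : ℕ → ℤˣ) : ∃ m, X.Splice k m m₃ n := by
  refine ⟨fun i => if i ≤ k then m₃ i else if i ≤ k + X.p then n (i + 1 - X.s) else m₃ (i - X.p),
    fun i hi => if_pos hi, fun i h1 h2 => ?_, fun i h1 h2 => ?_⟩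
  · simp only [show ¬i ≤ k by omega, h2, if_true, if_false]
  · simp only [show ¬i + X.p ≤ k by omega, show ¬i + X.p ≤ k + X.p by omega, if_false,
      Nat.add_sub_cancel]

theorem Splice.eq_left {m' : ℕ → ℤˣ} (h : X.Splice k m m₃ n) (h' : X.Splice k m' m₃ n) {i : ℕ}
    (hi : i ≤ X.G.d + 1) : m i = m' i := by
  have hd := X.G3_d
  rcases Nat.lt_or_ge k i with h1 | h1
  · rcases Nat.lt_or_ge (k + X.p) i with h2 | h2
    · obtain ⟨j, rfl⟩ := Nat.exists_eq_add_of_le' (show X.p ≤ i by omega)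
      rw [h.right j (by omega) (by omega), h'.right j (by omega) (by omega)]
    · rw [h.mid i h1 h2, h'.mid i h1 h2]
  · rw [h.left i h1, h'.left i h1]

/-- The position of a splice can be moved along tiles on which the codes agree. -/
theorem splice_iff_splice {k' : ℕ} (hk : X.IsWindow k) (hk' : X.IsWindow k') (hkk : k' ≤ k)
    (hn : Function.Periodic n X.p) (h : ∀ i, k' < i → i ≤ k → m₃ i = n (i + 1 - X.s)) :
    X.Splice k m m₃ n ↔ X.Splice k' m m₃ n := by
  have hp := X.p_eq
  have hd := X.G3_d
  unfold IsWindow at hk hk'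
  have hper : ∀ i, k' < i → n (i + X.p + 1 - X.s) = n (i + 1 - X.s) := by
    intro i hi
    rw [show i + X.p + 1 - X.s = i + 1 - X.s + X.p by omega, hn]
  constructor
  · intro hS
    refine ⟨fun i hi => hS.left i (by omega), fun i h1 h2 => ?_, fun i h1 h2 => ?_⟩
    · rcases Nat.lt_or_ge k i with h3 | h3
      · exact hS.mid i h3 (by omega)
      · rw [hS.left i h3, h i h1 h3]
    · rcases Nat.lt_or_ge k i with h3 | h3
      · exact hS.right i h3 h2
      · rw [hS.mid (i + X.p) (by omega) (by omega), hper i h1, h i h1 h3]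
  · intro hS
    refine ⟨fun i hi => ?_, fun i h1 h2 => ?_, fun i h1 h2 => hS.right i (by omega) h2⟩
    · rcases Nat.lt_or_ge k' i with h3 | h3
      · rw [hS.mid i h3 (by omega), h i h3 hi]
      · exact hS.left i h3
    · rcases Nat.lt_or_ge (k' + X.p) i with h3 | h3
      · obtain ⟨j, rfl⟩ := Nat.exists_eq_add_of_le' (show X.p ≤ i by omega)
        rw [hS.right j (by omega) (by omega), hper j (by omega), h j (by omega) (by omega)]
      · exact hS.mid i (by omega) h3

theorem a3_mem_iff (X : SelfCrossing) {m₃ : ℕ → ℤˣ} : X.a3 ∈ X.G3.ofCode X.sgn3 m₃ ↔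
    m₃ X.s = -X.bandSign ∧ m₃ (X.s - 1) = X.bandSign := by
  have hp := X.p_eq
  have hd := X.G3_d
  have hs := X.one_le_s
  rw [a3, aSign_eq, SnakeGraph.edge_mem_ofCode X.isSigns3 hs (by omega)]
  have h : X.sgn3 (X.s - 1) = -X.bandSign := by
    rw [sgn3, if_pos (by omega), sgn1_pred_s]
  simp [Selected, h]

/-- Geometric splices become a local condition on codes: every splice has the spliced code, and
every admissible spliced code yields a splice. -/
theorem mem_splicePositions_iff (hm₃ : Admissible X.G3.d X.sgn3 m₃) (hn : X.G4.Admissible n) :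
    k ∈ X.splicePositions (X.G3.ofCode X.sgn3 m₃, X.G4.ofCode n) ↔
      X.IsWindow k ∧ (k + 1 = X.s' → ¬(m₃ X.s = -X.bandSign ∧ m₃ (X.s - 1) = X.bandSign)) ∧
        X.Junction k m₃ n := by
  refine and_congr_right fun hk => ?_
  rw [a3_mem_iff]
  refine and_congr_right fun _ => ?_
  constructor
  · rintro ⟨P, hP⟩
    obtain ⟨m, hm, rfl⟩ := SnakeGraph.exists_code X.isSigns1 hP.1
    exact ((splice_of_isSplice hk hm hm₃ hn hP).admissible_iff hk hm₃ hn).1 hm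
  · intro hJ
    obtain ⟨m, h⟩ := X.exists_splice k m₃ n
    have hm := (h.admissible_iff hk hm₃ hn).2 hJ
    exact ⟨_, h.isSplice hk hm hm₃ hn⟩

/-- Cutting out the tiles `k + 1, …, k + p` from a code. -/
theorem exists_cut (hk : X.IsWindow k) (hm : Admissible X.G.d X.sgn1 m)
    (h1 : m k = X.sgn1 k → m (k + X.p + 1) = X.sgn1 k)
    (h2 : m (k + X.p) = X.sgn1 (k + X.p) → m (k + 1) = X.sgn1 (k + X.p)) :
    ∃ m₃ n, X.Splice k m m₃ n ∧ Admissible X.G3.d X.sgn3 m₃ ∧ X.G4.Admissible n := by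
  have hp := X.p_eq
  have hd := X.G3_d
  have hk' := hk
  have hs1 := X.one_le_s
  unfold IsWindow at hk'
  let m₃ : ℕ → ℤˣ := fun i => if i ≤ k then m i else m (i + X.p)
  -- One period of m starting at tile k + 1, which is tile k + 1 - s + 1 of `G4`; the multiple of p
  -- - 1 subtracts this offset modulo p.
  let n : ℕ → ℤˣ := fun j => m (k + 1 + (j + (X.p - 1) * (k + 1 - X.s + 1)) % X.p)
  have hmul : (k + 1 - X.s + 1) + (X.p - 1) * (k + 1 - X.s + 1) = X.p * (k + 1 - X.s + 1) := by
    obtain ⟨q, hq⟩ := Nat.exists_eq_add_of_le' hp.2.1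
    rw [hq, Nat.add_sub_cancel]; ring
  have hnval : ∀ r, r < X.p → n (k + 1 - X.s + 1 + r) = m (k + 1 + r) := by
    intro r hr
    simp only [n]
    rw [show k + 1 - X.s + 1 + r + (X.p - 1) * (k + 1 - X.s + 1) =
      r + X.p * (k + 1 - X.s + 1) by omega, Nat.add_mul_mod_self_left, Nat.mod_eq_of_lt hr]
  have hnper : Function.Periodic n X.p := by
    intro j
    simp only [n]
    rw [show j + X.p + (X.p - 1) * (k + 1 - X.s + 1) =
      j + (X.p - 1) * (k + 1 - X.s + 1) + X.p by ring, Nat.add_mod_right]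
  have hS : X.Splice k m m₃ n := by
    refine ⟨fun i hi => (if_pos hi).symm, fun i h3 h4 => ?_, fun i h3 _ => (if_neg (by omega)).symm⟩
    have := hnval (i - (k + 1)) (by omega)
    rw [show k + 1 - X.s + 1 + (i - (k + 1)) = i + 1 - X.s by omega,
      show k + 1 + (i - (k + 1)) = i by omega] at this
    exact this.symm
  refine ⟨m₃, n, hS, ⟨?_, ?_, fun i hi hid h3 => ?_⟩, ⟨hnper, fun j => ?_⟩⟩
  · rw [← hS.left 0 (by omega), hm.first, sgn3_of_le hk (by omega)]
  · rw [← hS.right _ (by omega) le_rfl, sgn3_eq_of_gt hk (by omega),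
      show X.G3.d + 1 + X.p = X.G.d + 1 by omega, show X.G3.d + X.p = X.G.d by omega, hm.last]
  · rcases lt_trichotomy i k with h4 | rfl | h4
    · rw [← hS.left i h4.le, sgn3_of_le hk h4.le] at h3
      rw [← hS.left (i + 1) h4, sgn3_of_le hk h4.le]
      exact hm.step i hi (by omega) h3
    · rw [← hS.left i le_rfl, sgn3_of_le hk le_rfl] at h3
      rw [← hS.right (i + 1) (by omega) (by omega), sgn3_of_le hk le_rfl,
        show i + 1 + X.p = i + X.p + 1 by ring]
      exact h1 h3
    · rw [← hS.right i h4 (by omega), sgn3_eq_of_gt hk h4] at h3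
      rw [← hS.right (i + 1) (by omega) (by omega), sgn3_eq_of_gt hk h4,
        show i + 1 + X.p = i + X.p + 1 by ring]
      exact hm.step_le (by omega) h3
  · have hj : ∃ r < X.p, j ≡ k + 1 - X.s + 1 + r [MOD X.p] := by
      refine ⟨(j + (X.p - 1) * (k + 1 - X.s + 1)) % X.p, Nat.mod_lt _ hp.2.1, ?_⟩
      have h2 : k + 1 - X.s + 1 + (j + (X.p - 1) * (k + 1 - X.s + 1)) % X.p ≡
          k + 1 - X.s + 1 + (j + (X.p - 1) * (k + 1 - X.s + 1)) [MOD X.p] :=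
        (Nat.mod_modEq _ _).add_left _
      rw [show k + 1 - X.s + 1 + (j + (X.p - 1) * (k + 1 - X.s + 1)) =
        j + X.p * (k + 1 - X.s + 1) by omega] at h2
      refine Nat.ModEq.symm (h2.trans ?_)
      simp [Nat.ModEq]
    obtain ⟨r, hr, hjr⟩ := hj
    rw [hnper.congr_nat hjr, hnper.congr_nat (hjr.add_right 1),
      X.G4.cyclicSgn_periodic.congr_nat hjr, hnval r hr]
    have e1 : X.G4.cyclicSgn (k + 1 - X.s + 1 + r) = X.sgn1 (k + 1 + r) := by
      rw [← X.cyclicSgn_eq (i := k + 1 + r) (by omega) (by omega) (by omega)]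
      congr 1; omega
    rw [e1]
    intro h3
    rcases Nat.lt_or_ge (r + 1) X.p with h4 | h4
    · rw [show k + 1 - X.s + 1 + r + 1 = k + 1 - X.s + 1 + (r + 1) by omega, hnval (r + 1) h4]
      exact hm.step_le (i := k + 1 + r) (by omega) h3
    · have h5 : k + 1 + r = k + X.p := by omega
      have h6 := hnval 0 (by omega)
      rw [show k + 1 - X.s + 1 + r + 1 = k + 1 - X.s + 1 + 0 + X.p by omega, hnper, h6]
      rw [h5] at h3 ⊢
      exact h2 h3

end SelfCrossing
end SnakeCalculus

/-! ### The first cut and the first splice -/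

namespace SnakeCalculus
namespace SelfCrossing

variable {X : SelfCrossing} {k : ℕ} {m m₃ n : ℕ → ℤˣ}

theorem sgn1_add_p (hk : X.IsWindow k) (hs : X.s ≤ k) : X.sgn1 (k + X.p) = X.sgn1 k := by
  have hp := X.p_eq
  unfold IsWindow at hk
  exact X.sgn1_periodic hs (by omega)

theorem sgn1_pred (h : k + 1 = X.s) : X.sgn1 k = -X.bandSign ∧ X.sgn1 (k + X.p) = X.bandSign := by
  have hp := X.p_eq
  rw [show k = X.s - 1 by omega, X.sgn1_pred_s, show X.s - 1 + X.p = X.s + X.p - 1 by omega,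
    X.sgn1_glue]
  exact ⟨rfl, rfl⟩

-- Let σ be the sign of e_k and e_{k+p}. A change from -σ to σ across one of these edges puts it
-- into the matching and gives a cut; a change from σ to -σ is not admissible.
set_option synthInstance.maxHeartbeats 400000 in
set_option synthInstance.maxSize 2000 in
theorem eq_succ_of_not_codeCut (hk : X.IsWindow k) (hs : X.s ≤ k) (hm : Admissible X.G.d X.sgn1 m)
    (hc : ¬X.CodeCut m k) : m (k + 1) = m k ∧ m (k + X.p + 1) = m (k + X.p) := by
  have hp := X.p_eq
  have hk' := hk
  unfold IsWindow at hk'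
  have h1 := hm.step_le (i := k) (by omega)
  have h2 := hm.step_le (i := k + X.p) (by omega)
  unfold CodeCut at hc
  rw [sgn1_add_p hk hs] at hc h2
  revert h1 h2 hc
  generalize X.sgn1 k = σ
  generalize m k = a, m (k + 1) = b, m (k + X.p) = c, m (k + X.p + 1) = d
  revert σ a b c d
  decide

theorem codeCut_pred_iff (h : k + 1 = X.s) : X.CodeCut m k ↔ m X.s = X.bandSign ∨
    (m (X.s + X.p) = X.bandSign ∧ m (k + X.p) = -X.bandSign ∧ m k = X.bandSign) := by
  obtain ⟨h1, h2⟩ := sgn1_pred h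
  rw [CodeCut, h1, h2, h, show k + X.p + 1 = X.s + X.p by omega]
  simp [and_assoc]

theorem junction_pred_iff (h : k + 1 = X.s) : X.Junction k m₃ n ↔
    (m₃ k = -X.bandSign → n 1 = -X.bandSign) ∧ (n 0 = X.bandSign → m₃ X.s = X.bandSign) := by
  obtain ⟨h1, h2⟩ := sgn1_pred h
  rw [Junction, h1, h2, h, Nat.sub_self]

/-- The codes on the tiles of the overlap before the first cut. -/
theorem code_of_not_codeCut (hm : Admissible X.G.d X.sgn1 m)
    (hc : ∀ j, X.IsWindow j → j < k → ¬X.CodeCut m j) (hk : k ≤ X.s') {i : ℕ} (hi : X.s ≤ i)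
    (hik : i ≤ k) : m i = -X.bandSign ∧ m (i + X.p) = m (X.s + X.p) := by
  have hp := X.p_eq
  have hs1 := X.one_le_s
  induction i, hi using Nat.le_induction with
  | base =>
    have h1 := hc (X.s - 1) (by unfold IsWindow; omega) (by omega)
    rw [codeCut_pred_iff (by omega), not_or] at h1
    exact ⟨units_eq_neg_iff_ne.2 h1.1, rfl⟩
  | succ i hi ih =>
    obtain ⟨h1, h2⟩ := ih (by omega)
    have hw : X.IsWindow i := by unfold IsWindow; omega
    obtain ⟨h3, h4⟩ := eq_succ_of_not_codeCut hw hi hm (hc i hw (by omega))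
    exact ⟨h3.trans h1, by rw [show i + 1 + X.p = i + X.p + 1 by ring, h4, h2]⟩

/-- The tile `k` is the first one at which the matching with code `m` is cut. -/
def IsFirstCut (X : SelfCrossing) (m : ℕ → ℤˣ) (k : ℕ) : Prop :=
  X.IsWindow k ∧ (∀ j, X.IsWindow j → j < k → ¬X.CodeCut m j) ∧
    (X.CodeCut m k ∨ k + 1 = X.s ∧ ∀ j, X.IsWindow j → ¬X.CodeCut m j)

theorem exists_isFirstCut (X : SelfCrossing) (m : ℕ → ℤˣ) : ∃ k, X.IsFirstCut m k := by
  classical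
  by_cases h : ∃ j, X.IsWindow j ∧ X.CodeCut m j
  · exact ⟨Nat.find h, (Nat.find_spec h).1, fun j h1 h2 h3 => Nat.find_min h h2 ⟨h1, h3⟩,
      Or.inl (Nat.find_spec h).2⟩
  · push Not at h
    have hp := X.p_eq
    have hs1 := X.one_le_s
    exact ⟨X.s - 1, by unfold IsWindow; omega, fun j h1 _ => h j h1, Or.inr ⟨by omega, h⟩⟩

theorem IsFirstCut.phi1_eq (h : X.IsFirstCut m k) (hm : Admissible X.G.d X.sgn1 m)
    (hS : X.Splice k m m₃ n) (hn : Function.Periodic n X.p) :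
    X.phi1 (X.G.ofCode X.sgn1 m) = (X.G3.ofCode X.sgn3 m₃, X.G4.ofCode n) := by
  have hp := X.p_eq
  obtain ⟨hk, hmin, hc | ⟨hks, hno⟩⟩ := h
  · have hne : k ∈ X.cutPositions (X.G.ofCode X.sgn1 m) := (mem_cutPositions_iff hm).2 ⟨hk, hc⟩
    have hpos : X.cutPos (X.G.ofCode X.sgn1 m) = k := by
      rw [cutPos, if_pos ⟨k, hne⟩]
      refine IsLeast.csInf_eq ⟨hne, fun j hj => ?_⟩
      by_contra hjk
      have h1 := (mem_cutPositions_iff hm).1 hj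
      exact hmin j h1.1 (by omega) h1.2
    have hpart : X.part4 (X.G.ofCode X.sgn1 m) = X.partAt (X.G.ofCode X.sgn1 m) k := by
      rw [part4, if_pos ⟨k, hne⟩, hpos, partAt]
    obtain ⟨h1, h2⟩ := images_partAt hk hS hm hn hc
    rw [phi1, hpart, hpos, h1, h2]
  · have hno' : ¬(X.cutPositions (X.G.ofCode X.sgn1 m)).Nonempty := by
      rintro ⟨j, hj⟩
      have h1 := (mem_cutPositions_iff hm).1 hj
      exact hno j h1.1 h1.2
    have h1 : ∀ i, X.s ≤ i → i ≤ X.s' → m i = -X.bandSign := fun i h1 h2 =>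
      (code_of_not_codeCut hm (fun j hj _ => hno j hj) le_rfl h1 h2).1
    obtain ⟨h2, h3⟩ := images_boundaryPart hk hks hS hn (h1 _ (by omega) (by omega))
      (h1 _ (by omega) (by omega))
    rw [phi1, part4, if_neg hno', cutPos, if_neg hno', show X.s - 1 = k by omega, h2, h3]

-- An end edge witnessing the cut forces the two new step conditions, for closing up the window and
-- for joining the rest. Without any cut the code is -β from s to s', which satisfies both.
set_option synthInstance.maxHeartbeats 400000 in
set_option synthInstance.maxSize 2000 in
theorem IsFirstCut.exists_cut (h : X.IsFirstCut m k) (hm : Admissible X.G.d X.sgn1 m) :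
    ∃ m₃ n, X.Splice k m m₃ n ∧ Admissible X.G3.d X.sgn3 m₃ ∧ X.G4.Admissible n := by
  have hp := X.p_eq
  obtain ⟨hk, hmin, hc⟩ := h
  have hk' := hk
  unfold IsWindow at hk'
  have hst := hm.step_le (i := k) (by omega)
  suffices (m k = X.sgn1 k → m (k + X.p + 1) = X.sgn1 k) ∧
      (m (k + X.p) = X.sgn1 (k + X.p) → m (k + 1) = X.sgn1 (k + X.p)) from
    SelfCrossing.exists_cut hk hm this.1 this.2
  rcases hc with hc | ⟨hks, hno⟩
  · unfold CodeCut at hc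
    revert hst hc
    generalize X.sgn1 k = σ, X.sgn1 (k + X.p) = τ
    generalize m k = a, m (k + 1) = b, m (k + X.p) = c, m (k + X.p + 1) = d
    rcases units_eq_or_eq_neg σ τ with rfl | rfl
    · revert σ a b c d; decide
    · revert τ a b c d; decide
  · have h1 : ∀ i, X.s ≤ i → i ≤ X.s' → m i = -X.bandSign := fun i h1 h2 =>
      (code_of_not_codeCut hm (fun j hj _ => hno j hj) le_rfl h1 h2).1
    rw [(sgn1_pred hks).1, (sgn1_pred hks).2, h1 (k + X.p + 1) (by omega) (by omega),
      h1 (k + X.p) (by omega) (by omega)]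
    exact ⟨fun _ => rfl, fun h => absurd h (units_neg_ne _)⟩

/-- A matching of `G` is recovered from its parts by splicing at the first possible position. -/
theorem IsFirstCut.isLeast (h : X.IsFirstCut m k) (hm : Admissible X.G.d X.sgn1 m)
    (hS : X.Splice k m m₃ n) (hm₃ : Admissible X.G3.d X.sgn3 m₃) (hn : X.G4.Admissible n) :
    ∃ k', X.IsWindow k' ∧ X.Splice k' m m₃ n ∧
      IsLeast (X.splicePositions (X.G3.ofCode X.sgn3 m₃, X.G4.ofCode n)) k' := by
  have hp := X.p_eq
  have hs1 := X.one_le_s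
  have hd := X.G3_d
  obtain ⟨hk, hmin, hc⟩ := h
  have hk' := hk
  unfold IsWindow at hk'
  have hw : X.IsWindow (X.s - 1) := by unfold IsWindow; omega
  have hfirst : X.Splice (X.s - 1) m m₃ n → ∃ k', X.IsWindow k' ∧ X.Splice k' m m₃ n ∧
      IsLeast (X.splicePositions (X.G3.ofCode X.sgn3 m₃, X.G4.ofCode n)) k' := by
    intro hS
    refine ⟨X.s - 1, hw, hS, (mem_splicePositions_iff hm₃ hn).2
      ⟨hw, fun h => by omega, (hS.admissible_iff hw hm₃ hn).1 hm⟩, fun j hj => ?_⟩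
    have h1 := hj.1.1
    omega
  rcases Nat.lt_or_ge k X.s with hks | hks
  · exact hfirst (by rwa [show X.s - 1 = k by omega])
  have hval := fun i => code_of_not_codeCut (i := i) hm hmin (by omega)
  have hm₃v : ∀ i, X.s ≤ i → i ≤ k → m₃ i = -X.bandSign := fun i h1 h2 => by
    rw [← hS.left i h2, (hval i h1 h2).1]
  have hnv : ∀ i, X.s ≤ i → i ≤ k → n (i + 1 - X.s) = m (X.s + X.p) := fun i h1 h2 => by
    rw [← (hval i h1 h2).2, hS.mid _ (by omega) (by omega),
      show i + X.p + 1 - X.s = i + 1 - X.s + X.p by omega]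
    exact (hn.periodic _).symm
  -- Before the cut, m₃ is -β and n has the constant value `m (s + p)`. If this is -β as well, the
  -- splice can be moved back to s - 1, which is then the least position.
  rcases units_eq_or_eq_neg (m (X.s + X.p)) X.bandSign with hb | hb
  swap
  · refine hfirst ((splice_iff_splice hk hw (by omega) hn.periodic fun i h1 h2 => ?_).1 hS)
    rw [hm₃v i (by omega) h2, hnv i (by omega) h2, hb]
  rw [hb] at hnv
  have hc1 := hmin (X.s - 1) hw (by omega)
  rw [codeCut_pred_iff (by omega), not_or, hb] at hc1
  -- Now n is β before the cut, and k itself is least: at a position from s on, opposite constant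
  -- values violate `Junction`, and a splice at s - 1 would have caused a cut there.
  refine ⟨k, hk, hS, (mem_splicePositions_iff hm₃ hn).2
    ⟨hk, fun h1 => ?_, (hS.admissible_iff hk hm₃ hn).1 hm⟩, fun j hj => ?_⟩
  · rintro ⟨-, h3⟩
    refine hc1.2 ⟨rfl, ?_, by rw [hS.left _ (by omega), h3]⟩
    exact (hval _ (by omega) (by omega)).1
  · by_contra hjk
    obtain ⟨hjw, -, hJ⟩ := (mem_splicePositions_iff hm₃ hn).1 hj
    have hjw' := hjw
    unfold IsWindow at hjw'
    rcases Nat.lt_or_ge j X.s with hjs | hjs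
    · rw [junction_pred_iff (by omega)] at hJ
      have e1 := hnv X.s le_rfl hks
      rw [show X.s + 1 - X.s = 1 by omega] at e1
      rw [hm₃v X.s le_rfl hks, e1] at hJ
      have h3 : m₃ j = X.bandSign := by
        rcases units_eq_or_eq_neg (m₃ j) X.bandSign with h4 | h4
        · exact h4
        · exact absurd (hJ.1 h4) (units_ne_neg _)
      have h0 : n 0 ≠ X.bandSign := fun h => units_neg_ne _ (hJ.2 h)
      refine hc1.2 ⟨rfl, ?_, ?_⟩
      · rcases Nat.lt_or_ge k (X.s - 1 + X.p) with h4 | h4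
        · rw [hS.mid _ h4 (by omega), show X.s - 1 + X.p + 1 - X.s = 0 + X.p by omega]
          rw [units_eq_neg_iff_ne]
          exact fun h => h0 ((hn.periodic 0).symm.trans h)
        · exact (hval _ (by omega) (by omega)).1
      · rw [hS.left _ (by omega), show X.s - 1 = j by omega, h3]
    · have e1 := hnv (j + 1) (by omega) (by omega)
      rw [show j + 1 + 1 - X.s = j + 1 - X.s + 1 by omega] at e1
      rw [Junction, sgn1_add_p hjw hjs, hnv j hjs (by omega), hm₃v j hjs (by omega), e1,
        hm₃v (j + 1) (by omega) (by omega)] at hJ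
      revert hJ
      generalize X.sgn1 j = σ, X.bandSign = β
      revert σ β; decide

/-- The codes on the tiles of the overlap before the first position of a splice. -/
theorem code_of_not_junction (hm₃ : Admissible X.G3.d X.sgn3 m₃) (hn : X.G4.Admissible n)
    (hJ : ∀ j, X.IsWindow j → j < k → ¬X.Junction j m₃ n) (hk : k ≤ X.s') {i : ℕ} (hi : X.s ≤ i)
    (hik : i ≤ k) : m₃ i = -X.bandSign ∧ n (i + 1 - X.s) = X.bandSign := by
  have hp := X.p_eq
  have hs1 := X.one_le_s
  have hd := X.G3_d
  induction i, hi using Nat.le_induction with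
  | base =>
    -- The failing half of `Junction` gives one of the two values; the step rule of `G3` across a,
    -- respectively of `G4` across the glueing edge, gives the other.
    have h1 := hJ (X.s - 1) (by unfold IsWindow; omega) (by omega)
    rw [junction_pred_iff (by omega)] at h1
    have h2 := hm₃.step_le (i := X.s - 1) (by omega)
    have h3 := hn.step 0
    rw [cyclicSgn_zero] at h3
    rw [sgn3, if_pos (by omega), sgn1_pred_s, show X.s - 1 + 1 = X.s by omega] at h2
    rw [show X.s + 1 - X.s = 1 by omega]
    revert h1 h2 h3
    generalize m₃ (X.s - 1) = a, m₃ X.s = b, n 0 = c, n (0 + 1) = d, X.bandSign = β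
    revert a b c d β
    decide
  | succ i hi ih =>
    obtain ⟨h1, h2⟩ := ih (by omega)
    have hw : X.IsWindow i := by unfold IsWindow; omega
    have h3 := hJ i hw (by omega)
    have h4 := hm₃.step_le (i := i) (by omega)
    have h5 := hn.step (i + 1 - X.s)
    rw [X.cyclicSgn_eq (by omega) (by omega) (by omega)] at h5
    rw [sgn3_of_ge hi, sgn1_add_p hw hi] at h4
    rw [Junction, sgn1_add_p hw hi] at h3
    rw [show i + 1 + 1 - X.s = i + 1 - X.s + 1 by omega]
    rw [h1] at h3 h4
    rw [h2] at h3 h5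
    revert h3 h4 h5
    generalize m₃ (i + 1) = a, n (i + 1 - X.s + 1) = b, X.bandSign = β, X.sgn1 i = σ
    revert a b β σ
    decide

set_option synthInstance.maxHeartbeats 400000 in
set_option synthInstance.maxSize 2000 in
/-- Splicing at the first possible position, followed by cutting at the first possible one. -/
theorem IsFirstCut.splice {k₀ : ℕ} (h : X.IsFirstCut m k₀) (hm : Admissible X.G.d X.sgn1 m)
    (hS : X.Splice k m m₃ n) (hm₃ : Admissible X.G3.d X.sgn3 m₃) (hn : X.G4.Admissible n)
    (hk : IsLeast (X.splicePositions (X.G3.ofCode X.sgn3 m₃, X.G4.ofCode n)) k) :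
    X.Splice k₀ m m₃ n := by
  have hp := X.p_eq
  have hs1 := X.one_le_s
  have hd := X.G3_d
  obtain ⟨hk₀, hmin, hc⟩ := h
  obtain ⟨hkw, ha, hJ⟩ := (mem_splicePositions_iff hm₃ hn).1 hk.1
  have hk₀' := hk₀
  have hkw' := hkw
  unfold IsWindow at hk₀' hkw'
  rcases Nat.lt_or_ge k X.s with hks | hks
  · rcases Nat.lt_or_ge k k₀ with hkk | hkk
    swap
    · rwa [show k₀ = k by omega]
    -- The splice is at s - 1 and the first cut comes later. Then n is -β and m₃ is constant up to
    -- the cut. The absence of a cut at s - 1 forces the constant to be -β, so the splice can be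
    -- moved to the cut.
    have hval := fun i => code_of_not_codeCut (i := i) hm hmin (by omega)
    have hm₃v : ∀ i, X.s ≤ i → i ≤ k₀ → m₃ i = m (X.s + X.p) := fun i h1 h2 => by
      rw [← hS.right i (by omega) (by omega), (hval i h1 h2).2]
    have hnv : ∀ i, X.s ≤ i → i ≤ k₀ → n (i + 1 - X.s) = -X.bandSign := fun i h1 h2 => by
      rw [← hS.mid i (by omega) (by omega), (hval i h1 h2).1]
    have hc1 := hmin k hkw hkk
    rw [codeCut_pred_iff (by omega), not_or] at hc1
    have h2 := hm₃.step_le (i := k) (by omega)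
    have h3 := hn.step 0
    have e1 : m (k + X.p) = n 0 := by
      rw [hS.mid _ (by omega) le_rfl, show k + X.p + 1 - X.s = 0 + X.p by omega]
      exact hn.periodic 0
    have e2 := hnv X.s le_rfl (by omega)
    rw [show X.s + 1 - X.s = 0 + 1 by omega] at e2
    rw [cyclicSgn_zero, e2] at h3
    rw [sgn3_of_le hkw le_rfl, (sgn1_pred (by omega)).1, show k + 1 = X.s by omega,
      hm₃v _ le_rfl (by omega)] at h2
    rw [e1, hS.left k le_rfl] at hc1
    have h4 : m (X.s + X.p) = -X.bandSign := by
      clear hJ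
      replace hc1 := hc1.2
      revert hc1 h2 h3
      generalize m (X.s + X.p) = a, n 0 = b, m₃ k = c, X.bandSign = β
      revert a b c β
      decide
    refine (splice_iff_splice hk₀ hkw hkk.le hn.periodic fun i h5 h6 => ?_).2 hS
    rw [hm₃v i (by omega) h6, hnv i (by omega) h6, h4]
  -- For a later first splice, m is -β on the tiles from s to k and β on their translates. This
  -- leaves no cut before k and produces one at k, so both positions agree.
  · have hnJ : ∀ j, X.IsWindow j → j < k → ¬X.Junction j m₃ n := by
      intro j hj hjk h1
      have h2 := hj
      unfold IsWindow at h2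
      have := hk.2 ((mem_splicePositions_iff hm₃ hn).2 ⟨hj, fun h => by omega, h1⟩)
      omega
    have hval := fun i => code_of_not_junction (i := i) hm₃ hn hnJ (by omega)
    have hmv : ∀ i, X.s ≤ i → i ≤ k → m i = -X.bandSign ∧ m (i + X.p) = X.bandSign := by
      intro i h1 h2
      refine ⟨by rw [hS.left i h2, (hval i h1 h2).1], ?_⟩
      rw [hS.mid _ (by omega) (by omega), show i + X.p + 1 - X.s = i + 1 - X.s + X.p by omega,
        ← (hval i h1 h2).2]
      exact hn.periodic _
    have hncut : ∀ j, X.IsWindow j → j < k → ¬X.CodeCut m j := by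
      intro j hj hjk
      have h2 := hj
      unfold IsWindow at h2
      rcases Nat.lt_or_ge j X.s with hjs | hjs
      · rw [codeCut_pred_iff (by omega), not_or]
        refine ⟨by rw [(hmv _ le_rfl hks).1]; exact units_neg_ne _, ?_⟩
        rintro ⟨-, h3, h4⟩
        rw [hS.left j hjk.le] at h4
        rcases Nat.lt_or_ge k (j + X.p) with h5 | h5
        · refine hnJ j hj hjk ((junction_pred_iff (by omega)).2
            ⟨fun h => absurd (h.symm.trans h4) (units_neg_ne _), fun h => ?_⟩)
          rw [hS.mid _ h5 (by omega), show j + X.p + 1 - X.s = 0 + X.p by omega] at h3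
          exact absurd ((h3.symm.trans (hn.periodic 0)).trans h) (units_neg_ne _)
        -- Here k = s' - 1. A cut at s - 1 would put a into the matching of `G3`, which the extra
        -- condition on this last position forbids.
        · exact ha (by omega) ⟨(hval _ le_rfl hks).1, by rw [show X.s - 1 = j by omega, h4]⟩
      · have h3 := hmv j hjs hjk.le
        have h4 := hmv (j + 1) (by omega) (by omega)
        rw [CodeCut, show j + X.p + 1 = j + 1 + X.p by ring, h3.1, h3.2, h4.1, h4.2,
          sgn1_add_p hj hjs]
        generalize X.sgn1 j = σ, X.bandSign = β
        revert σ β; decide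
    have hcut : X.CodeCut m k := by
      have h1 := hm₃.step_le (i := k) (by omega)
      have h2 := hn.step (k + 1 - X.s)
      rw [X.cyclicSgn_eq (by omega) (by omega) (by omega)] at h2
      rw [sgn3_of_le hkw le_rfl] at h1
      rw [Junction, sgn1_add_p hkw hks] at hJ
      rw [CodeCut, sgn1_add_p hkw hks, show k + X.p + 1 = k + 1 + X.p by ring,
        hS.right (k + 1) (by omega) (by omega), hS.mid (k + 1) (by omega) (by omega),
        (hmv k hks le_rfl).1, (hmv k hks le_rfl).2,
        show k + 1 + 1 - X.s = k + 1 - X.s + 1 by omega]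
      rw [(hval k hks le_rfl).1] at h1 hJ
      rw [(hval k hks le_rfl).2] at h2 hJ
      revert h1 h2 hJ
      generalize m₃ (k + 1) = a, n (k + 1 - X.s + 1) = b, X.sgn1 k = σ, X.bandSign = β
      revert a b σ β; decide
    rcases lt_trichotomy k₀ k with h1 | rfl | h1
    · rcases hc with hc | ⟨-, hno⟩
      · exact absurd hc (hncut k₀ hk₀ h1)
      · exact absurd hcut (hno k hkw)
    · exact hS
    · exact absurd hcut (hmin k hkw h1)

end SelfCrossing
end SnakeCalculus

/-! ### The maps between spliceable pairs and matchings of `G` -/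

namespace SnakeCalculus
namespace SelfCrossing

variable {X : SelfCrossing} {k : ℕ} {m m₃ n : ℕ → ℤˣ}

/-- The choice in the definition of `psi` is harmless, since any splice at k has the same code on
all tiles. -/
theorem Splice.psi_eq (hk : X.IsWindow k) (hS : X.Splice k m m₃ n)
    (hm : Admissible X.G.d X.sgn1 m) (hm₃ : Admissible X.G3.d X.sgn3 m₃) (hn : X.G4.Admissible n)
    (hl : IsLeast (X.splicePositions (X.G3.ofCode X.sgn3 m₃, X.G4.ofCode n)) k) :
    X.psi (X.G3.ofCode X.sgn3 m₃, X.G4.ofCode n) = Sum.inl (X.G.ofCode X.sgn1 m) := by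
  rw [psi, if_pos hl.nonempty, hl.csInf_eq]
  have h := Classical.epsilon_spec hl.1.2.2
  obtain ⟨m', hm', he⟩ := SnakeGraph.exists_code X.isSigns1 h.1
  rw [he] at h ⊢
  have hS' := splice_of_isSplice hk hm' hm₃ hn h
  congr 1
  exact SnakeGraph.ofCode_congr X.isSigns1 X.isSigns1 hm' hm
    fun i _ hi => hS'.eq_left hS (by omega)

/-- Cutting and splicing on `Match G`. -/
theorem phi1_spec {P : Set Edge} (hP : P ∈ X.G.matchings) :
    X.phi1 P ∈ X.target ∧ (X.splicePositions (X.phi1 P)).Nonempty ∧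
      X.psi (X.phi1 P) = Sum.inl P := by
  obtain ⟨m, hm, rfl⟩ := SnakeGraph.exists_code X.isSigns1 hP
  obtain ⟨k, hk⟩ := X.exists_isFirstCut m
  obtain ⟨m₃, n, hS, hm₃, hn⟩ := hk.exists_cut hm
  obtain ⟨k', hw, hS', hl⟩ := hk.isLeast hm hS hm₃ hn
  rw [hk.phi1_eq hm hS hn.periodic]
  exact ⟨⟨SnakeGraph.ofCode_mem_matchings X.isSigns3 hm₃, BandGraph.ofCode_mem_matchings hn⟩,
    hl.nonempty, hS'.psi_eq hw hm hm₃ hn hl⟩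

/-- Splicing and cutting on `Match G3 × Match G4`. -/
theorem psi_spec {Q : Set Edge × Set X.G4.BEdge} (hQ : Q ∈ X.target)
    (h : (X.splicePositions Q).Nonempty) :
    ∃ P ∈ X.G.matchings, X.psi Q = Sum.inl P ∧ X.phi1 P = Q := by
  obtain ⟨Q₃, Q₄⟩ := Q
  obtain ⟨m₃, hm₃, h₃⟩ := SnakeGraph.exists_code X.isSigns3 hQ.1
  obtain ⟨n, hn, h₄⟩ := BandGraph.exists_code hQ.2
  simp only at h₃ h₄
  subst h₃ h₄
  have hl : IsLeast (X.splicePositions (X.G3.ofCode X.sgn3 m₃, X.G4.ofCode n))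
      (sInf (X.splicePositions (X.G3.ofCode X.sgn3 m₃, X.G4.ofCode n))) :=
    ⟨Nat.sInf_mem h, fun j hj => Nat.sInf_le hj⟩
  generalize sInf (X.splicePositions (X.G3.ofCode X.sgn3 m₃, X.G4.ofCode n)) = k at hl
  obtain ⟨hw, -, hJ⟩ := (mem_splicePositions_iff hm₃ hn).1 hl.1
  obtain ⟨m, hS⟩ := X.exists_splice k m₃ n
  have hm := (hS.admissible_iff hw hm₃ hn).2 hJ
  obtain ⟨k₀, hk₀⟩ := X.exists_isFirstCut m
  exact ⟨_, SnakeGraph.ofCode_mem_matchings X.isSigns1 hm, hS.psi_eq hw hm hm₃ hn hl,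
    hk₀.phi1_eq hm (hk₀.splice hm hS hm₃ hn hl) hn.periodic⟩

end SelfCrossing
end SnakeCalculus

/-! ### Pairs without a splice, and codes of `G56` -/

namespace SnakeCalculus
namespace SelfCrossing

variable {X : SelfCrossing} {k : ℕ} {m₃ m₅₆ n : ℕ → ℤˣ}

/-- Two codes for which no position of a splice exists. -/
structure Nonspliceable (X : SelfCrossing) (m₃ n : ℕ → ℤˣ) : Prop where
  band : ∀ j, n j = X.bandSign
  overlap : ∀ i, X.s ≤ i → i < X.s' → m₃ i = -X.bandSign
  ends : m₃ (X.s - 1) = -X.bandSign → m₃ X.s' = -X.bandSign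

theorem sgn1_pred_s' : X.sgn1 (X.s' - 1) = X.bandSign := by
  have hp := X.p_eq
  rw [show X.s' - 1 = X.s + X.p - 1 by omega, sgn1_glue]

/-- Failure at all positions before s' - 1 fixes m₃ on s, …, s' - 1 and n on a full period. At s' -
1 the splice condition reduces to `m₃ s' = β`, and the position is barred exactly if a belongs to
the matching, that is if `m₃ (s - 1) = β`. -/
theorem not_nonempty_iff (hm₃ : Admissible X.G3.d X.sgn3 m₃) (hn : X.G4.Admissible n) :
    ¬(X.splicePositions (X.G3.ofCode X.sgn3 m₃, X.G4.ofCode n)).Nonempty ↔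
      X.Nonspliceable m₃ n := by
  have hp := X.p_eq
  have hs1 := X.one_le_s
  have hw : X.IsWindow (X.s' - 1) := by unfold IsWindow; omega
  have hlast := sgn1_add_p hw (by omega)
  rw [sgn1_pred_s'] at hlast
  constructor
  · intro h
    have hnJ : ∀ j, X.IsWindow j → j < X.s' - 1 → ¬X.Junction j m₃ n := fun j hj hlt hJ =>
      h ⟨j, (mem_splicePositions_iff hm₃ hn).2 ⟨hj, fun h => by omega, hJ⟩⟩
    have hval := fun i => code_of_not_junction (i := i) hm₃ hn hnJ (by omega)
    have hband : ∀ j, n j = X.bandSign := by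
      intro j
      have h1 : j + X.p ≡ 1 + (j + X.p - 1) % X.p [MOD X.p] := by
        have := (Nat.mod_modEq (j + X.p - 1) X.p).symm.add_left 1
        rwa [show 1 + (j + X.p - 1) = j + X.p by omega] at this
      have h2 := Nat.mod_lt (j + X.p - 1) hp.2.1
      have h3 : n (j + X.p) = n j := hn.periodic j
      have h4 := hn.periodic.congr_nat (i := j + X.p) h1
      rw [← h3, h4, ← (hval (X.s + (j + X.p - 1) % X.p) (by omega) (by omega)).2]
      congr 1; omega
    refine ⟨hband, fun i h1 h2 => (hval i h1 (by omega)).1, fun h1 => ?_⟩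
    by_contra h2
    refine h ⟨X.s' - 1, (mem_splicePositions_iff hm₃ hn).2 ⟨hw, fun _ h3 => ?_, ?_, fun _ => ?_⟩⟩
    · exact units_neg_ne _ (h1.symm.trans h3.2)
    · intro _; rw [sgn1_pred_s', hband]
    · rw [hlast, show X.s' - 1 + 1 = X.s' by omega]
      by_contra h3
      exact h2 (units_eq_neg_iff_ne.2 h3)
  · rintro ⟨hband, hov, hends⟩ ⟨j, hj⟩
    obtain ⟨hjw, ha, hJ⟩ := (mem_splicePositions_iff hm₃ hn).1 hj
    have hjw' := hjw
    unfold IsWindow at hjw'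
    rcases Nat.lt_or_ge j X.s with h1 | h1
    · rw [junction_pred_iff (by omega), hband, hov _ le_rfl (by omega)] at hJ
      exact units_neg_ne _ (hJ.2 (hband _))
    rcases Nat.lt_or_ge (j + 1) X.s' with h2 | h2
    · rw [Junction, sgn1_add_p hjw h1, hband, hband, hov j h1 (by omega),
        hov (j + 1) (by omega) h2] at hJ
      revert hJ
      generalize X.sgn1 j = σ, X.bandSign = β
      revert σ β; decide
    · obtain rfl : j = X.s' - 1 := by omega
      rw [Junction, hlast, hband, show X.s' - 1 + 1 = X.s' by omega] at hJ
      have h3 := hJ.2 (hband _)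
      rw [h3] at hends
      refine ha (by omega) ⟨hov _ le_rfl (by omega), ?_⟩
      by_contra h4
      exact units_ne_neg _ (hends (units_eq_neg_iff_ne.2 h4))

/-- The code `m₃` arises from `m₅₆` by inserting the tiles `s, …, s' - 1`. -/
structure Inserted (X : SelfCrossing) (m₃ m₅₆ : ℕ → ℤˣ) : Prop where
  left : ∀ i < X.s, m₃ i = m₅₆ i
  mid : ∀ i, X.s ≤ i → i < X.s' → m₃ i = -X.bandSign
  right : ∀ i, X.s ≤ i → m₃ (i + X.p) = m₅₆ i

theorem exists_inserted_left (X : SelfCrossing) (m₅₆ : ℕ → ℤˣ) : ∃ m₃, X.Inserted m₃ m₅₆ := by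
  have hp := X.p_eq
  refine ⟨fun i => if i < X.s then m₅₆ i else if i < X.s' then -X.bandSign else m₅₆ (i - X.p),
    fun i h => if_pos h, fun i h1 h2 => ?_, fun i h1 => ?_⟩
  · simp only [show ¬i < X.s by omega, h2, if_true, if_false]
  · simp only [show ¬i + X.p < X.s by omega, show ¬i + X.p < X.s' by omega, if_false,
      Nat.add_sub_cancel]

theorem Nonspliceable.exists_inserted (h : X.Nonspliceable m₃ n) :
    ∃ m₅₆, X.Inserted m₃ m₅₆ := by
  refine ⟨fun i => if i < X.s then m₃ i else m₃ (i + X.p), fun i h => (if_pos h).symm, h.overlap,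
    fun i h => (if_neg (by omega)).symm⟩

theorem sgn56_of_lt {i : ℕ} (h : i < X.s) : X.sgn56 i = X.sgn3 i := by
  rw [sgn56, sgn3, if_pos h, if_pos h]

theorem sgn56_of_ge {i : ℕ} (h : X.s ≤ i) : X.sgn56 i = X.sgn3 (i + X.p) := by
  rw [sgn56, sgn3, if_neg (by omega), if_neg (by omega)]
  congr 1; ring

theorem sgn3_pred_s : X.sgn3 (X.s - 1) = -X.bandSign := by
  have := X.one_le_s
  rw [sgn3, if_pos (by omega), sgn1_pred_s]

theorem sgn3_pred_s' : X.sgn3 (X.s' - 1) = X.bandSign := by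
  have hp := X.p_eq
  have hw : X.IsWindow (X.s' - 1) := by unfold IsWindow; omega
  rw [sgn3_of_le hw le_rfl, sgn1_pred_s']

/-- The step into the inserted tiles always holds, since a has sign -β, and the step out of them is
void, since e_{s'-1} has sign β. What `G3` loses is the step of `G56` across a, and this is the
additional condition. -/
theorem Inserted.admissible_iff (h : X.Inserted m₃ m₅₆) :
    Admissible X.G56.d X.sgn56 m₅₆ ↔ Admissible X.G3.d X.sgn3 m₃ ∧
      (m₃ (X.s - 1) = -X.bandSign → m₃ X.s' = -X.bandSign) := by
  have hp := X.p_eq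
  have hs1 := X.one_le_s
  have hd := X.G3_d
  have hd' := X.G56_d
  have hs' : m₃ X.s' = m₅₆ X.s := by rw [hp.1, h.right _ le_rfl]
  constructor
  · intro hm
    refine ⟨⟨?_, ?_, fun i hi hid h1 => ?_⟩, ?_⟩
    · rw [h.left 0 (by omega), hm.first, sgn56_of_lt (by omega)]
    · rw [show X.G3.d + 1 = X.G56.d + 1 + X.p by omega, h.right _ (by omega), hm.last,
        sgn56_of_ge (by omega)]
      congr 1; omega
    · rcases lt_or_ge i X.s with h2 | h2
      · rw [h.left i h2, ← sgn56_of_lt h2] at h1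
        rcases Nat.lt_or_ge (i + 1) X.s with h3 | h3
        · rw [h.left _ h3, ← sgn56_of_lt h2]
          exact hm.step_le (by omega) h1
        · rw [h.mid (i + 1) h3 (by omega), show i = X.s - 1 by omega, sgn3_pred_s]
      · rcases Nat.lt_or_ge i X.s' with h3 | h3
        · rw [h.mid i h2 h3] at h1
          rcases Nat.lt_or_ge (i + 1) X.s' with h4 | h4
          · rw [h.mid _ (by omega) h4, h1]
          · rw [show i = X.s' - 1 by omega, sgn3_pred_s'] at h1
            exact absurd h1 (units_neg_ne _)
        · obtain ⟨j, rfl⟩ := Nat.exists_eq_add_of_le' (show X.p ≤ i by omega)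
          rw [h.right j (by omega), ← sgn56_of_ge (by omega)] at h1
          rw [show j + X.p + 1 = j + 1 + X.p by ring, h.right _ (by omega),
            ← sgn56_of_ge (by omega)]
          exact hm.step_le (by omega) h1
    · intro h1
      rw [h.left _ (by omega)] at h1
      have h2 := hm.step_le (i := X.s - 1) (by omega)
      rw [sgn56_of_lt (by omega), sgn3_pred_s, show X.s - 1 + 1 = X.s by omega] at h2
      rw [hs', h2 h1]
  · rintro ⟨hm, he⟩
    refine ⟨?_, ?_, fun i hi hid h1 => ?_⟩
    · rw [← h.left 0 (by omega), hm.first, sgn56_of_lt (by omega)]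
    · rw [← h.right _ (by omega), show X.G56.d + 1 + X.p = X.G3.d + 1 by omega, hm.last,
        sgn56_of_ge (by omega)]
      congr 1; omega
    · rcases lt_or_ge i X.s with h2 | h2
      · rw [← h.left i h2, sgn56_of_lt h2] at h1
        rcases Nat.lt_or_ge (i + 1) X.s with h3 | h3
        · rw [← h.left _ h3, sgn56_of_lt h2]
          exact hm.step_le (by omega) h1
        · obtain rfl : i = X.s - 1 := by omega
          rw [sgn3_pred_s] at h1
          rw [show X.s - 1 + 1 = X.s by omega, ← hs', he h1, sgn56_of_lt h2, sgn3_pred_s]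
      · rw [← h.right i h2, sgn56_of_ge h2] at h1
        have h3 := hm.step_le (i := i + X.p) (by omega) h1
        rw [← h.right _ (by omega), sgn56_of_ge h2, ← h3]
        congr 1; ring

/-- Only the edge a sees a difference. In `G3` its right neighbour G_s always chooses it, whereas in
`G56` the neighbour is G_{s'}, whose choice has to be required; `selected_right` is the mirror
statement. -/
theorem Inserted.selected_left (h : X.Inserted m₃ m₅₆) {i : ℕ} (hi : i < X.s) {c : Corner}
    {σ : ℤˣ} : Selected X.sgn56 m₅₆ i c σ ↔ Selected X.sgn3 m₃ i c σ ∧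
      (i + 1 = X.s → c = .ne → σ = -X.bandSign → m₃ X.s' = -X.bandSign) := by
  have hp := X.p_eq
  cases c
  · simp only [Selected]
    rw [h.left i hi, h.left (i - 1) (by omega), sgn56_of_lt (by omega)]
    simp
  · simp only [Selected]
    rw [h.left i hi, sgn56_of_lt hi]
    rcases Nat.lt_or_ge (i + 1) X.s with h3 | h3
    · rw [h.left _ h3]
      simp [h3.ne]
    · have h4 : i + 1 = X.s := by omega
      rw [show i = X.s - 1 by omega, sgn3_pred_s, show X.s - 1 + 1 = X.s by omega,
        h.mid _ le_rfl (by omega), hp.1, h.right _ le_rfl]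
      constructor
      · rintro ⟨h1, h2⟩
        exact ⟨⟨h1, id⟩, fun _ _ h5 => by rw [h2 h5.symm, h5]⟩
      · rintro ⟨⟨h1, h2⟩, h5⟩
        exact ⟨h1, fun h6 => by rw [h5 rfl trivial h6.symm, h6]⟩

theorem Inserted.selected_right (h : X.Inserted m₃ m₅₆) {i : ℕ} (hi : X.s ≤ i) {c : Corner}
    {σ : ℤˣ} : Selected X.sgn56 m₅₆ i c σ ↔ Selected X.sgn3 m₃ (i + X.p) c σ ∧
      (i = X.s → c = .sw → σ = -X.bandSign → m₃ (X.s - 1) = X.bandSign) := by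
  have hp := X.p_eq
  have hs1 := X.one_le_s
  cases c
  · simp only [Selected]
    rw [h.right i hi]
    rcases hi.eq_or_lt with rfl | hlt
    · rw [sgn56_of_lt (by omega), sgn3_pred_s, show X.s + X.p - 1 = X.s' - 1 by omega,
        sgn3_pred_s', h.mid _ (by omega) (by omega), h.left _ (by omega)]
      constructor
      · rintro ⟨h1, h2⟩
        exact ⟨⟨h1, fun h => by rw [h]⟩, fun _ _ h5 => by rw [h2 h5.symm, h5, neg_neg]⟩
      · rintro ⟨⟨h1, h2⟩, h5⟩
        exact ⟨h1, fun h6 => by rw [h5 rfl trivial h6.symm, ← h6, neg_neg]⟩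
    · obtain ⟨j, rfl⟩ := Nat.exists_eq_add_of_le' (show 1 ≤ i by omega)
      rw [show j + 1 + X.p - 1 = j + X.p by omega, Nat.add_sub_cancel, h.right j (by omega),
        sgn56_of_ge (by omega)]
      simp [hlt.ne']
  · simp only [Selected]
    rw [h.right i hi, show i + X.p + 1 = i + 1 + X.p by ring, h.right (i + 1) (by omega),
      sgn56_of_ge hi]
    simp

end SelfCrossing
end SnakeCalculus

/-! ### Completion by boundary edges, and restriction to `G56` -/

namespace SnakeCalculus
namespace SelfCrossing

variable {X : SelfCrossing} {k : ℕ} {m₃ m₅₆ n : ℕ → ℤˣ}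

theorem mem_left56_iff {e : Edge} : e ∈ X.left56 (X.G56.ofCode X.sgn56 m₅₆) ↔
    ∃ i c σ, 1 ≤ i ∧ i < X.s ∧ Selected X.sgn56 m₅₆ i c σ ∧ e = X.G3.edge i c σ := by
  have hp := X.p_eq
  have hd := X.G56_d
  constructor
  · rintro ⟨i, c, σ, h1, h2, h3, h4⟩
    exact ⟨i, c, σ, h1, h2, (SnakeGraph.edge_mem_ofCode X.isSigns56 h1 (by omega)).1 h3, h4⟩
  · rintro ⟨i, c, σ, h1, h2, h3, h4⟩
    exact ⟨i, c, σ, h1, h2, (SnakeGraph.edge_mem_ofCode X.isSigns56 h1 (by omega)).2 h3, h4⟩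

theorem mem_right56_iff {e : Edge} : e ∈ X.right56 (X.G56.ofCode X.sgn56 m₅₆) ↔
    ∃ i c σ, X.s ≤ i ∧ i ≤ X.G56.d ∧ Selected X.sgn56 m₅₆ i c σ ∧
      ¬(1 < X.s ∧ i = X.s ∧ c = .sw ∧ σ = -X.bandSign) ∧ e = X.G3.edge (i + X.p) c σ := by
  have hs1 := X.one_le_s
  constructor
  · rintro ⟨i, c, σ, h1, h2, h3, h4⟩
    exact ⟨i, c, σ, h1, h2, (SnakeGraph.edge_mem_ofCode X.isSigns56 (by omega) h2).1 h3, h4⟩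
  · rintro ⟨i, c, σ, h1, h2, h3, h4⟩
    exact ⟨i, c, σ, h1, h2, (SnakeGraph.edge_mem_ofCode X.isSigns56 (by omega) h2).2 h3, h4⟩

namespace Inserted

theorem left56_subset (h : X.Inserted m₃ m₅₆) :
    X.left56 (X.G56.ofCode X.sgn56 m₅₆) ⊆ X.G3.ofCode X.sgn3 m₃ := by
  have hp := X.p_eq
  have hd := X.G3_d
  intro e he
  obtain ⟨i, c, σ, h1, h2, h3, rfl⟩ := mem_left56_iff.1 he
  exact ⟨i, c, σ, h1, by omega, rfl, ((h.selected_left h2).1 h3).1⟩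

theorem right56_subset (h : X.Inserted m₃ m₅₆) :
    X.right56 (X.G56.ofCode X.sgn56 m₅₆) ⊆ X.G3.ofCode X.sgn3 m₃ := by
  have hp := X.p_eq
  have hd := X.G3_d
  have hd' := X.G56_d
  intro e he
  obtain ⟨i, c, σ, h1, h2, h3, -, rfl⟩ := mem_right56_iff.1 he
  exact ⟨i + X.p, c, σ, by omega, by omega, rfl, ((h.selected_right h1).1 h3).1⟩

/-- The edge `a` belongs to the matching of `G3` whenever it is added. -/
theorem a3_mem (h : X.Inserted m₃ m₅₆) (hm₃ : Admissible X.G3.d X.sgn3 m₃)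
    (hu : ∀ u ∈ X.a3.ends, ∀ f ∈ X.left56 (X.G56.ofCode X.sgn56 m₅₆), u ∉ f.ends) :
    X.a3 ∈ X.G3.ofCode X.sgn3 m₃ := by
  have hp := X.p_eq
  have hd := X.G3_d
  have hs1 := X.one_le_s
  rw [a3_mem_iff]
  refine ⟨h.mid _ le_rfl (by omega), ?_⟩
  by_contra hne
  rw [← Ne, ← units_eq_neg_iff_ne] at hne
  have hs : 1 < X.s := by
    by_contra h1
    have h2 := hm₃.first
    rw [show 0 = X.s - 1 by omega, sgn3_pred_s, hne] at h2
    exact units_ne_neg _ h2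
  -- If tile s - 1 did not choose a, its other north/east edge would belong to P and cover the end
  -- point at the northeast corner.
  have hsel : Selected X.sgn56 m₅₆ (X.s - 1) .ne X.bandSign := by
    refine ⟨by rw [← h.left _ (by omega), hne], fun h1 => ?_⟩
    rw [sgn56_of_lt (by omega), sgn3_pred_s] at h1
    exact absurd h1 (units_neg_ne _)
  have ha : X.a3 = X.G3.edge (X.s - 1) .ne (-X.bandSign) := by
    have h1 := X.G3.edge_succ_sw (X.s - 1) (by omega)
    rw [← X.isSigns3 (X.s - 1) (by omega) (by omega), sgn3_pred_s,
      show X.s - 1 + 1 = X.s by omega] at h1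
    rw [a3, aSign_eq, h1]
  have htip : ∀ σ, X.G3.tile (X.s - 1) + (1, 1) ∈ (X.G3.edge (X.s - 1) .ne σ).ends := by
    intro σ
    have h1 : (X.G3.edge (X.s - 1) .ne σ).tip = _ := tip_sideOfSign_ne _ _
    rw [← h1]
    exact Sym2.mem_mk_right _ _
  exact hu _ (by rw [ha]; exact htip _) _
    (mem_left56_iff.2 ⟨X.s - 1, .ne, X.bandSign, by omega, by omega, hsel, rfl⟩) (htip _)

theorem base56_subset (h : X.Inserted m₃ m₅₆) (hm₃ : Admissible X.G3.d X.sgn3 m₃) :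
    X.base56 (X.G56.ofCode X.sgn56 m₅₆) ⊆ X.G3.ofCode X.sgn3 m₃ := by
  have h1 := Set.union_subset h.left56_subset h.right56_subset
  unfold base56
  split_ifs with hu
  · exact Set.union_subset h1 (Set.singleton_subset_iff.2 (h.a3_mem hm₃ hu))
  · exact h1

theorem subset_base56 (P : Set Edge) : X.left56 P ∪ X.right56 P ⊆ X.base56 P := by
  unfold base56
  split_ifs
  · exact Set.subset_union_left
  · exact subset_rfl

theorem a3_mem_base56 (h : X.Inserted m₃ m₅₆) (hm₃ : Admissible X.G3.d X.sgn3 m₃)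
    (ha : X.a3 ∈ X.G3.ofCode X.sgn3 m₃) : X.a3 ∈ X.base56 (X.G56.ofCode X.sgn56 m₅₆) := by
  by_cases hu : ∀ u ∈ X.a3.ends, ∀ f ∈ X.left56 (X.G56.ofCode X.sgn56 m₅₆), u ∉ f.ends
  · rw [base56, if_pos hu]
    exact Or.inr rfl
  · push Not at hu
    obtain ⟨u, h1, f, hf, h2⟩ := hu
    have := SnakeGraph.matching_unique (SnakeGraph.ofCode_mem_matchings X.isSigns3 hm₃) ha
      (h.left56_subset hf) h1 h2
    exact subset_base56 _ (Or.inl (this ▸ hf))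

/-- All interior edges in the matching of `G3` are prescribed. -/
theorem interiorEdge_mem_base56 (h : X.Inserted m₃ m₅₆) (hm₃ : Admissible X.G3.d X.sgn3 m₃)
    {i : ℕ} (hi : 1 ≤ i) (hid : i < X.G3.d)
    (he : X.G3.interiorEdge i ∈ X.G3.ofCode X.sgn3 m₃) :
    X.G3.interiorEdge i ∈ X.base56 (X.G56.ofCode X.sgn56 m₅₆) := by
  have hp := X.p_eq
  have hd := X.G3_d
  have hd' := X.G56_d
  have hs1 := X.one_le_s
  have hε := X.isSigns3 i hi hid
  have hint : X.G3.interiorEdge i = X.G3.edge i .ne (X.sgn3 i) := by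
    rw [X.G3.interiorEdge_eq, hε]
  have hsel := (SnakeGraph.edge_mem_ofCode X.isSigns3 hi hid.le).1 (hint ▸ he)
  have hsw : X.G3.interiorEdge i = X.G3.edge (i + 1) .sw (X.sgn3 i) := by
    rw [X.G3.interiorEdge_eq_sw i hi, hε]
  rcases Nat.lt_or_ge (i + 1) X.s with h1 | h1
  · refine subset_base56 _ (Or.inl (mem_left56_iff.2 ⟨i, .ne, X.sgn3 i, hi, by omega, ?_, hint⟩))
    exact (h.selected_left (by omega)).2 ⟨hsel, fun h2 => absurd h2 h1.ne⟩
  rcases Nat.lt_or_ge i X.s with h2 | h2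
  · have : X.G3.interiorEdge i = X.a3 := by
      rw [hsw, show i = X.s - 1 by omega, sgn3_pred_s, show X.s - 1 + 1 = X.s by omega, a3, aSign_eq]
    rw [this] at he ⊢
    exact h.a3_mem_base56 hm₃ he
  rcases Nat.lt_or_ge (i + 1) X.s' with h3 | h3
  -- Between two inserted tiles the code is constant, and such an interior edge is never selected.
  · have h4 := hsel.1
    have h5 := hsel.2 rfl
    rw [h.mid i h2 (by omega)] at h4
    rw [h.mid _ (by omega) h3, h4] at h5
    exact absurd h5 (units_neg_ne _)
  refine subset_base56 _ (Or.inr (mem_right56_iff.2 ?_))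
  rcases Nat.lt_or_ge i X.s' with h4 | h4
  · obtain rfl : i = X.s' - 1 := by omega
    rw [sgn3_pred_s'] at hsw
    have hsel' := (SnakeGraph.edge_mem_ofCode X.isSigns3 (by omega) (by omega)).1 (hsw ▸ he)
    rw [show X.s' - 1 + 1 = X.s + X.p by omega] at hsel' hsw
    exact ⟨X.s, .sw, X.bandSign, le_rfl, by omega, (h.selected_right le_rfl).2
      ⟨hsel', fun _ _ h => absurd h (units_ne_neg _)⟩,
      fun h => units_ne_neg _ h.2.2.2, hsw⟩
  · obtain ⟨j, rfl⟩ := Nat.exists_eq_add_of_le' (show X.p ≤ i by omega)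
    exact ⟨j, .ne, _, by omega, by omega, (h.selected_right (by omega)).2
      ⟨hsel, fun _ h => by simp at h⟩, fun h => by simp at h, hint⟩

theorem isCompletion (h : X.Inserted m₃ m₅₆) (hm₃ : Admissible X.G3.d X.sgn3 m₃) :
    X.IsCompletion (X.base56 (X.G56.ofCode X.sgn56 m₅₆)) (X.G3.ofCode X.sgn3 m₃) := by
  refine ⟨SnakeGraph.ofCode_mem_matchings X.isSigns3 hm₃, h.base56_subset hm₃, fun e he => ?_⟩
  refine ⟨SnakeGraph.ofCode_subset he.1, ?_⟩
  rintro ⟨i, hi, hid, rfl⟩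
  exact he.2 (h.interiorEdge_mem_base56 hm₃ hi hid he.1)

/-- The chosen south/west edge of the first tile of `G3` is prescribed. -/
theorem first_mem_base56 (h : X.Inserted m₃ m₅₆) (hm₃ : Admissible X.G3.d X.sgn3 m₃) :
    X.G3.edge 1 .sw (m₃ 1) ∈ X.base56 (X.G56.ofCode X.sgn56 m₅₆) := by
  have hp := X.p_eq
  have hd := X.G3_d
  have hs1 := X.one_le_s
  have hsel : Selected X.sgn3 m₃ 1 .sw (m₃ 1) :=
    ⟨rfl, fun h => by rw [Nat.sub_self] at h ⊢; rw [hm₃.first, h]⟩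
  rcases hs1.eq_or_lt with hs | hs
  · have h1 : m₃ X.s = -X.bandSign := h.mid _ le_rfl (by omega)
    have ha : X.G3.edge 1 .sw (m₃ 1) = X.a3 := by
      rw [a3, aSign_eq, ← h1, ← hs]
    have := (SnakeGraph.edge_mem_ofCode X.isSigns3 le_rfl (by omega)).2 hsel
    rw [ha] at this ⊢
    exact h.a3_mem_base56 hm₃ this
  · exact subset_base56 _ (Or.inl (mem_left56_iff.2 ⟨1, .sw, _, le_rfl, hs,
      (h.selected_left hs).2 ⟨hsel, fun _ h => by simp at h⟩, rfl⟩))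

/-- A completion contains the prescribed interior edges and no others. The value on the first tile
is prescribed too, and from `m i` the next value is determined by whether e_i belongs to the
matching. -/
theorem isCompletion_unique (h : X.Inserted m₃ m₅₆) (hm₃ : Admissible X.G3.d X.sgn3 m₃)
    {R : Set Edge} (hR : X.IsCompletion (X.base56 (X.G56.ofCode X.sgn56 m₅₆)) R) :
    R = X.G3.ofCode X.sgn3 m₃ := by
  have hd := X.G3.one_le_d
  obtain ⟨hRm, hsub, hbd⟩ := hR
  obtain ⟨m', hm', rfl⟩ := SnakeGraph.exists_code X.isSigns3 hRm
  refine SnakeGraph.ofCode_congr X.isSigns3 X.isSigns3 hm' hm₃ fun i hi => ?_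
  induction i, hi using Nat.le_induction with
  | base =>
    intro _
    exact ((SnakeGraph.edge_mem_ofCode X.isSigns3 le_rfl hd).1
      (hsub (h.first_mem_base56 hm₃))).1
  | succ i hi ih =>
    intro hid
    have ih := ih (by omega)
    have hint : X.G3.interiorEdge i = X.G3.edge i .ne (X.sgn3 i) := by
      rw [X.G3.interiorEdge_eq, X.isSigns3 i hi (by omega)]
    have h1 : X.G3.interiorEdge i ∈ X.G3.ofCode X.sgn3 m₃ ↔
        X.G3.interiorEdge i ∈ X.G3.ofCode X.sgn3 m' := by
      constructor
      · exact fun h2 => hsub (h.interiorEdge_mem_base56 hm₃ hi (by omega) h2)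
      · intro h2
        by_contra h3
        exact (hbd ⟨h2, fun h4 => h3 (h.base56_subset hm₃ h4)⟩).2 ⟨i, hi, by omega, rfl⟩
    rw [hint, SnakeGraph.edge_mem_ofCode X.isSigns3 hi (by omega),
      SnakeGraph.edge_mem_ofCode X.isSigns3 hi (by omega)] at h1
    simp only [Selected, true_imp_iff] at h1
    have h2 := hm₃.step_le (i := i) (by omega)
    have h3 := hm'.step_le (i := i) (by omega)
    rw [ih] at h1 h3
    revert h1 h2 h3
    generalize m₃ i = a, m₃ (i + 1) = b, m' (i + 1) = c, X.sgn3 i = σ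
    revert a b c σ
    decide

theorem completion_eq (h : X.Inserted m₃ m₅₆) (hm₃ : Admissible X.G3.d X.sgn3 m₃) :
    X.completion (X.base56 (X.G56.ofCode X.sgn56 m₅₆)) = X.G3.ofCode X.sgn3 m₃ := by
  have hex : ∃! R, X.IsCompletion (X.base56 (X.G56.ofCode X.sgn56 m₅₆)) R :=
    ⟨_, h.isCompletion hm₃, fun _ hR => h.isCompletion_unique hm₃ hR⟩
  rw [completion, dif_pos hex]
  exact h.isCompletion_unique hm₃ hex.exists.choose_spec

/-- Requiring both copies of a in the matching of `G3` supplies exactly the extra conditions in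
`selected_left` and `selected_right`; every other edge has one copy. -/
theorem restrict56_eq (h : X.Inserted m₃ m₅₆) (hm : Admissible X.G56.d X.sgn56 m₅₆) :
    X.restrict56 (X.G3.ofCode X.sgn3 m₃) = X.G56.ofCode X.sgn56 m₅₆ := by
  have hp := X.p_eq
  have hd := X.G3_d
  have hd' := X.G56_d
  have hs1 := X.one_le_s
  have hm₃ := (h.admissible_iff.1 hm).1
  ext e
  constructor
  · rintro ⟨he, hall⟩
    obtain ⟨i, c, σ, hi, hid, rfl⟩ := X.G56.mem_edgesOn_iff.1 he
    rw [SnakeGraph.edge_mem_ofCode X.isSigns56 hi hid]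
    have h1 := hall i c σ hi hid rfl
    have hcopy : 1 < X.s → X.G56.edge (X.s - 1) .ne (-X.bandSign) =
        X.G56.edge X.s .sw (-X.bandSign) := by
      intro hs
      have h1 := X.G56.edge_succ_sw (X.s - 1) (by omega)
      rw [← X.isSigns56 (X.s - 1) (by omega) (by omega), sgn56_of_lt (by omega), sgn3_pred_s,
        show X.s - 1 + 1 = X.s by omega] at h1
      exact h1.symm
    split_ifs at h1 with his
    · rw [SnakeGraph.edge_mem_ofCode X.isSigns3 hi (by omega)] at h1
      refine (h.selected_left his).2 ⟨h1, ?_⟩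
      rintro h2 rfl rfl
      have h3 := hall X.s .sw (-X.bandSign) hs1 (by omega)
        (by rw [show i = X.s - 1 by omega, hcopy (by omega)])
      rw [if_neg (by omega), SnakeGraph.edge_mem_ofCode X.isSigns3 (by omega) (by omega),
        ← hp.1] at h3
      exact h3.1
    · rw [SnakeGraph.edge_mem_ofCode X.isSigns3 (by omega) (by omega)] at h1
      refine (h.selected_right (by omega)).2 ⟨h1, ?_⟩
      rintro rfl rfl rfl
      rcases hs1.eq_or_lt with hs | hs
      · have h2 := hm₃.first
        rw [show 0 = X.s - 1 by omega, sgn3_pred_s, neg_neg] at h2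
        exact h2
      · have h3 := hall (X.s - 1) .ne (-X.bandSign) (by omega) (by omega) (hcopy hs).symm
        rw [if_pos (by omega), SnakeGraph.edge_mem_ofCode X.isSigns3 (by omega) (by omega)] at h3
        rw [h3.1, neg_neg]
  · intro he
    refine ⟨SnakeGraph.ofCode_subset he, ?_⟩
    rintro i c σ hi hid rfl
    rw [SnakeGraph.edge_mem_ofCode X.isSigns56 hi hid] at he
    split_ifs with his
    · exact (SnakeGraph.edge_mem_ofCode X.isSigns3 hi (by omega)).2 ((h.selected_left his).1 he).1
    · exact (SnakeGraph.edge_mem_ofCode X.isSigns3 (by omega) (by omega)).2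
        ((h.selected_right (by omega)).1 he).1

end Inserted

end SelfCrossing
end SnakeCalculus

/-! ### Boundary edges of `G4` and the matching with constant code -/

namespace SnakeCalculus

namespace BandGraph

variable {B : BandGraph}

theorem edge_mem_edgeSet (i : ℕ) (c : Corner) (σ : ℤˣ) : B.edge i c σ ∈ B.graph.edgeSet :=
  ⟨_, (B.cut 0).mem_edgesOn_iff.2 ⟨i % B.p + 1, c, σ, by omega, Nat.mod_lt _ B.one_le_p, rfl⟩, rfl⟩

theorem exists_eq_edge {x : B.BEdge} (hx : x ∈ B.graph.edgeSet) :
    ∃ i < B.p, ∃ c σ, x = B.edge i c σ := by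
  obtain ⟨e, he, rfl⟩ := hx
  obtain ⟨i, c, σ, hi, hip, rfl⟩ := (B.cut 0).mem_edgesOn_iff.1 he
  have hlt : i - 1 < B.p := by
    have : (B.cut 0).d = B.p := rfl
    omega
  refine ⟨i - 1, hlt, c, σ, ?_⟩
  rw [edge, Nat.mod_eq_of_lt hlt, Nat.sub_add_cancel hi]

theorem edge_sw_mem_boundaryEdges_iff {i : ℕ} {σ : ℤˣ} :
    B.edge i .sw σ ∈ B.boundaryEdges ↔ σ = -B.cyclicSgn i := by
  have hp := B.one_le_p
  rw [units_eq_neg_iff_ne]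
  constructor
  · rintro ⟨-, h⟩ rfl
    refine h ⟨i % B.p, Nat.mod_lt _ hp, ?_⟩
    exact B.edge_congr (Nat.mod_modEq i B.p).symm _ _
  · refine fun hne => ⟨edge_mem_edgeSet _ _ _, ?_⟩
    rintro ⟨k, hk, h⟩
    have hs : B.sgn k = B.cyclicSgn k := by rw [cyclicSgn, Nat.mod_eq_of_lt hk]
    obtain ⟨h1, ⟨h2, -⟩ | ⟨h2, -⟩ | ⟨-, h2, -⟩⟩ := edge_eq_edge h
    · rw [h1, hs, ← B.cyclicSgn_periodic.congr_nat h2] at hne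
      exact hne rfl
    · simp at h2
    · simp at h2

theorem edge_ne_mem_boundaryEdges_iff {i : ℕ} {σ : ℤˣ} :
    B.edge i .ne σ ∈ B.boundaryEdges ↔ σ = -B.cyclicSgn (i + 1) := by
  have hp := B.one_le_p
  rw [units_eq_neg_iff_ne]
  constructor
  · rintro h1 rfl
    rw [← edge_succ_sw, edge_sw_mem_boundaryEdges_iff] at h1
    exact units_ne_neg _ h1
  · refine fun hne => ⟨edge_mem_edgeSet _ _ _, ?_⟩
    rintro ⟨k, hk, h⟩
    obtain ⟨h1, ⟨-, h2⟩ | ⟨-, -, -, h2⟩ | ⟨h2, -⟩⟩ := edge_eq_edge h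
    · simp at h2
    · exact hne h2
    · simp at h2

end BandGraph

namespace SelfCrossing

variable {X : SelfCrossing} {k : ℕ} {m₃ m₅₆ n : ℕ → ℤˣ}

/-- A constant code selects boundary edges only, since a selected interior edge requires different
values on its two sides. -/
theorem admissible_const (X : SelfCrossing) : X.G4.Admissible fun _ => X.bandSign :=
  ⟨fun _ => rfl, fun _ h => h⟩

namespace Inserted

theorem added_eq (h : X.Inserted m₃ m₅₆) (hm₃ : Admissible X.G3.d X.sgn3 m₃) :
    X.added (X.G56.ofCode X.sgn56 m₅₆) = X.G3.ofCode X.sgn3 m₃ \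
      (X.left56 (X.G56.ofCode X.sgn56 m₅₆) ∪ X.right56 (X.G56.ofCode X.sgn56 m₅₆)) := by
  rw [added, h.completion_eq hm₃]

theorem not_mem_left56 {i : ℕ} {c : Corner} {σ : ℤˣ} (hi : X.s ≤ i)
    (hne : i = X.s → c = .sw → σ = -X.bandSign → m₃ X.s' ≠ -X.bandSign) (h : X.Inserted m₃ m₅₆) :
    X.G3.edge i c σ ∉ X.left56 (X.G56.ofCode X.sgn56 m₅₆) := by
  have hp := X.p_eq
  have hd := X.G3_d
  have hs1 := X.one_le_s
  intro h1
  obtain ⟨j, c', τ, hj, hjs, h2, h3⟩ := mem_left56_iff.1 h1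
  obtain ⟨rfl, ⟨h4, -⟩ | ⟨-, -, h4, -⟩ | ⟨rfl, rfl, h4, h5⟩⟩ := X.G3.edge_eq_edge (by omega) hj h3
  · omega
  · omega
  · rw [← X.isSigns3 j hj (by omega), show j = X.s - 1 by omega, sgn3_pred_s] at h5
    exact hne (by omega) rfl h5 (((h.selected_left hjs).1 h2).2 (by omega) rfl h5)

theorem not_mem_right56 {i : ℕ} {c : Corner} {σ : ℤˣ} (hi : 1 ≤ i) (his : i < X.s')
    (hne : i + 1 = X.s' → c = .ne → σ ≠ X.bandSign) :
    X.G3.edge i c σ ∉ X.right56 (X.G56.ofCode X.sgn56 m₅₆) := by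
  have hp := X.p_eq
  have hd := X.G3_d
  intro h1
  obtain ⟨j, c', τ, hj, hjd, -, -, h3⟩ := mem_right56_iff.1 h1
  obtain ⟨rfl, ⟨h4, -⟩ | ⟨rfl, rfl, h4, h5⟩ | ⟨-, -, h4, -⟩⟩ :=
    X.G3.edge_eq_edge (by omega) (by omega) h3
  · omega
  · rw [← X.isSigns3 i hi (by omega), show i = X.s' - 1 by omega, sgn3_pred_s'] at h5
    exact hne (by omega) rfl h5
  · omega

/-- The added edges on the tiles `s, …, s'` of `G3`. -/
theorem sign_of_mem_added (h : X.Inserted m₃ m₅₆) (hm₃ : Admissible X.G3.d X.sgn3 m₃) {i : ℕ}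
    {c : Corner} {σ : ℤˣ} (hi : X.s ≤ i) (his : i ≤ X.s')
    (he : X.G3.edge i c σ ∈ X.added (X.G56.ofCode X.sgn56 m₅₆)) :
    (c = .sw ∧ σ = -X.bandSign) ∨ (c = .ne ∧ σ = X.bandSign) := by
  have hp := X.p_eq
  have hd := X.G3_d
  have hd' := X.G56_d
  have hs1 := X.one_le_s
  rw [h.added_eq hm₃] at he
  obtain ⟨he, hno⟩ := he
  rw [SnakeGraph.edge_mem_ofCode X.isSigns3 (by omega) (by omega)] at he
  rcases his.eq_or_lt with rfl | hlt
  · rw [hp.1] at he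
    by_contra hc
    push Not at hc
    refine hno (Or.inr (mem_right56_iff.2 ⟨X.s, c, σ, le_rfl, by omega,
      (h.selected_right le_rfl).2 ⟨he, fun _ h1 h2 => absurd h2 (hc.1 h1)⟩,
      fun h1 => hc.1 h1.2.2.1 h1.2.2.2, by rw [hp.1]⟩))
  · cases c
    · exact Or.inl ⟨rfl, by rw [← he.1, h.mid i hi hlt]⟩
    · refine Or.inr ⟨rfl, ?_⟩
      have := he.1
      rw [h.mid i hi hlt, neg_inj] at this
      exact this.symm

/-- The boundary edges of `G4` corresponding to the added edges. -/
theorem exists_mem_added (h : X.Inserted m₃ m₅₆) (hm : Admissible X.G56.d X.sgn56 m₅₆) {j : ℕ}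
    (hj : j < X.p) {c : Corner} {σ : ℤˣ} (hb : X.G4.edge j c σ ∈ X.G4.boundaryEdges)
    (hc : (c = .sw ∧ σ = -X.bandSign) ∨ (c = .ne ∧ σ = X.bandSign)) :
    ∃ i c' τ, X.s ≤ i ∧ i ≤ X.s' ∧ X.G3.edge i c' τ ∈ X.added (X.G56.ofCode X.sgn56 m₅₆) ∧
      X.G4.edge j c σ = X.G4.edge (i - X.s) c' τ := by
  have hp := X.p_eq
  have hd := X.G3_d
  have hs1 := X.one_le_s
  obtain ⟨hm₃, hends⟩ := h.admissible_iff.1 hm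
  simp only [h.added_eq hm₃]
  rcases hc with ⟨rfl, rfl⟩ | ⟨rfl, rfl⟩
  · rw [BandGraph.edge_sw_mem_boundaryEdges_iff, neg_inj] at hb
    rcases Nat.eq_zero_or_pos j with rfl | hj0
    · by_cases hcase : X.s = 1 ∨ m₃ X.s' ≠ -X.bandSign
      · refine ⟨X.s, .sw, -X.bandSign, le_rfl, by omega, ⟨X.a3_mem_iff.2 ⟨?_, ?_⟩, ?_⟩,
          by rw [Nat.sub_self]⟩
        · exact h.mid _ le_rfl (by omega)
        · rcases hcase with hs | hne
          · have h1 := hm₃.first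
            rwa [show 0 = X.s - 1 by omega, sgn3_pred_s, neg_neg] at h1
          · by_contra h1
            exact hne (hends (units_eq_neg_iff_ne.2 h1))
        · rintro (h1 | h1)
          · rcases hcase with hs | hne
            · obtain ⟨i, -, -, h2, h3, -⟩ := mem_left56_iff.1 h1
              omega
            · exact not_mem_left56 le_rfl (fun _ _ _ => hne) h h1
          · exact not_mem_right56 hs1 (by omega) (fun _ h => by simp at h) h1
      · push Not at hcase
        have hmem : X.G3.edge X.s' .sw (-X.bandSign) ∈ X.G3.ofCode X.sgn3 m₃ := by
          rw [SnakeGraph.edge_mem_ofCode X.isSigns3 (by omega) (by omega)]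
          refine ⟨hcase.2, fun h1 => ?_⟩
          rw [sgn3_pred_s'] at h1
          exact absurd h1 (units_ne_neg _)
        refine ⟨X.s', .sw, -X.bandSign, by omega, le_rfl, ⟨hmem, ?_⟩, ?_⟩
        · rintro (h1 | h1)
          · exact not_mem_left56 (by omega) (fun h2 => by omega) h h1
          · obtain ⟨i, c', τ, h2, h3, -, h4, h5⟩ := mem_right56_iff.1 h1
            obtain ⟨rfl, ⟨h6, rfl⟩ | ⟨h6, -⟩ | ⟨-, -, h6, -⟩⟩ :=
              X.G3.edge_eq_edge (by omega) (by omega) h5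
            · exact h4 ⟨by omega, by omega, rfl, rfl⟩
            · simp at h6
            · omega
        · refine X.G4.edge_congr ?_ _ _
          rw [show X.s' - X.s = X.p by omega]
          simp [Nat.ModEq, G4_p]
    · refine ⟨j + X.s, .sw, -X.bandSign, by omega, by omega, ⟨?_, ?_⟩,
        by rw [Nat.add_sub_cancel]⟩
      · rw [SnakeGraph.edge_mem_ofCode X.isSigns3 (by omega) (by omega)]
        refine ⟨h.mid _ (by omega) (by omega), fun h1 => ?_⟩
        rw [sgn3_of_ge (by omega), sgn1_add_p (by unfold IsWindow; omega) (by omega),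
          ← X.cyclicSgn_eq (by omega) (by omega) (by omega),
          show j + X.s - 1 + 1 - X.s = j by omega, ← hb] at h1
        exact absurd h1 (units_ne_neg _)
      · rintro (h1 | h1)
        · exact not_mem_left56 (by omega) (fun h2 => by omega) h h1
        · exact not_mem_right56 (by omega) (by omega) (fun _ h => by simp at h) h1
  · rw [BandGraph.edge_ne_mem_boundaryEdges_iff] at hb
    have hε : X.sgn3 (j + X.s) = -X.bandSign := by
      rw [sgn3_of_ge (by omega), sgn1_add_p (by unfold IsWindow; omega) (by omega),
        ← X.cyclicSgn_eq (by omega) (by omega) (by omega),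
        show j + X.s + 1 - X.s = j + 1 by omega, hb, neg_neg]
    refine ⟨j + X.s, .ne, X.bandSign, by omega, by omega, ⟨?_, ?_⟩, by rw [Nat.add_sub_cancel]⟩
    · rw [SnakeGraph.edge_mem_ofCode X.isSigns3 (by omega) (by omega)]
      refine ⟨h.mid _ (by omega) (by omega), fun h1 => ?_⟩
      rw [hε] at h1
      exact absurd h1 (units_neg_ne _)
    · rintro (h1 | h1)
      · exact not_mem_left56 (by omega) (fun _ h => by simp at h) h h1
      · refine not_mem_right56 (by omega) (by omega) (fun h2 _ _ => ?_) h1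
        rw [show j + X.s = X.s' - 1 by omega, sgn3_pred_s'] at hε
        exact units_ne_neg _ hε

/-- The boundary edges of `G4` form two classes, those chosen by the constant code -β and those
chosen by β. The inserted tiles carry the first class, which is exactly what is added, and the
second remains. -/
theorem unused4_eq (h : X.Inserted m₃ m₅₆) (hm : Admissible X.G56.d X.sgn56 m₅₆) :
    X.unused4 (X.G56.ofCode X.sgn56 m₅₆) = X.G4.ofCode fun _ => X.bandSign := by
  have hm₃ := (h.admissible_iff.1 hm).1
  have hper := X.admissible_const.periodic
  ext x
  constructor
  · rintro ⟨hb, hno⟩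
    obtain ⟨j, hj, c, σ, rfl⟩ := BandGraph.exists_eq_edge hb.1
    rw [BandGraph.edge_mem_ofCode hper]
    by_cases hc : (c = .sw ∧ σ = -X.bandSign) ∨ (c = .ne ∧ σ = X.bandSign)
    · obtain ⟨i, c', τ, h1, h2, h3, h4⟩ := h.exists_mem_added hm hj hb hc
      exact absurd h4 (hno i c' τ h1 h2 h3)
    · push Not at hc
      cases c
      · have h1 := hc.1 rfl
        rw [BandGraph.edge_sw_mem_boundaryEdges_iff] at hb
        simp only [Selected, Nat.add_sub_cancel]
        clear hno hc
        revert h1 hb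
        generalize X.bandSign = β, X.G4.cyclicSgn j = ε
        revert β ε σ; decide
      · have h1 := hc.2 rfl
        rw [BandGraph.edge_ne_mem_boundaryEdges_iff] at hb
        simp only [Selected]
        clear hno hc
        revert h1 hb
        generalize X.bandSign = β, X.G4.cyclicSgn (j + 1) = ε
        revert β ε σ; decide
  · rintro ⟨j, c, σ, rfl, hs⟩
    refine ⟨?_, fun i c' τ h1 h2 h3 he => ?_⟩
    · cases c
      · rw [BandGraph.edge_sw_mem_boundaryEdges_iff]
        simp only [Selected, Nat.add_sub_cancel] at hs
        revert hs
        generalize X.bandSign = β, X.G4.cyclicSgn j = ε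
        revert β ε σ; decide
      · rw [BandGraph.edge_ne_mem_boundaryEdges_iff]
        simp only [Selected] at hs
        revert hs
        generalize X.bandSign = β, X.G4.cyclicSgn (j + 1) = ε
        revert β ε σ; decide
    · have h4 : X.G4.edge j c σ ∈ X.G4.ofCode fun _ => X.bandSign := ⟨j, c, σ, rfl, hs⟩
      rw [he, BandGraph.edge_mem_ofCode hper] at h4
      rcases h.sign_of_mem_added hm₃ h1 h2 h3 with ⟨rfl, rfl⟩ | ⟨rfl, rfl⟩
      · exact units_ne_neg _ h4.1
      · exact units_ne_neg _ h4.1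

theorem phi56_eq (h : X.Inserted m₃ m₅₆) (hm : Admissible X.G56.d X.sgn56 m₅₆) :
    X.phi56 (X.G56.ofCode X.sgn56 m₅₆) =
      (X.G3.ofCode X.sgn3 m₃, X.G4.ofCode fun _ => X.bandSign) := by
  rw [phi56, h.completion_eq (h.admissible_iff.1 hm).1, h.unused4_eq hm]

end Inserted

/-- Resolving and restricting on `Match G56`. -/
theorem phi56_spec {P : Set Edge} (hP : P ∈ X.G56.matchings) :
    X.phi56 P ∈ X.target ∧ ¬(X.splicePositions (X.phi56 P)).Nonempty ∧
      X.psi (X.phi56 P) = Sum.inr P := by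
  obtain ⟨m₅₆, hm, rfl⟩ := SnakeGraph.exists_code X.isSigns56 hP
  obtain ⟨m₃, h⟩ := X.exists_inserted_left m₅₆
  obtain ⟨hm₃, hends⟩ := h.admissible_iff.1 hm
  have hno := (not_nonempty_iff hm₃ X.admissible_const).2 ⟨fun _ => rfl, h.mid, hends⟩
  rw [h.phi56_eq hm]
  refine ⟨⟨SnakeGraph.ofCode_mem_matchings X.isSigns3 hm₃,
    BandGraph.ofCode_mem_matchings X.admissible_const⟩, hno, ?_⟩
  rw [psi, if_neg hno, h.restrict56_eq hm]

/-- Restricting and resolving on the pairs which cannot be spliced. -/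
theorem psi_spec_of_not_nonempty {Q : Set Edge × Set X.G4.BEdge} (hQ : Q ∈ X.target)
    (h : ¬(X.splicePositions Q).Nonempty) :
    ∃ P ∈ X.G56.matchings, X.psi Q = Sum.inr P ∧ X.phi56 P = Q := by
  obtain ⟨Q₃, Q₄⟩ := Q
  obtain ⟨m₃, hm₃, h₃⟩ := SnakeGraph.exists_code X.isSigns3 hQ.1
  obtain ⟨n, hn, h₄⟩ := BandGraph.exists_code hQ.2
  simp only at h₃ h₄
  subst h₃ h₄
  have hN := (not_nonempty_iff hm₃ hn).1 h
  obtain ⟨m₅₆, hI⟩ := hN.exists_inserted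
  have hm := hI.admissible_iff.2 ⟨hm₃, hN.ends⟩
  obtain rfl : n = fun _ => X.bandSign := funext hN.band
  exact ⟨_, SnakeGraph.ofCode_mem_matchings X.isSigns56 hm,
    by rw [psi, if_neg h, hI.restrict56_eq hm], hI.phi56_eq hm⟩

/-! ### The two maps are mutually inverse -/

theorem phi_mapsTo (X : SelfCrossing) : Set.MapsTo X.phi X.source X.target := by
  rintro _ (⟨P, hP, rfl⟩ | ⟨P, hP, rfl⟩)
  · exact (phi1_spec hP).1
  · exact (phi56_spec hP).1

theorem psi_mapsTo (X : SelfCrossing) : Set.MapsTo X.psi X.target X.source := by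
  intro Q hQ
  by_cases h : (X.splicePositions Q).Nonempty
  · obtain ⟨P, hP, h1, -⟩ := psi_spec hQ h
    exact h1 ▸ Or.inl ⟨P, hP, rfl⟩
  · obtain ⟨P, hP, h1, -⟩ := psi_spec_of_not_nonempty hQ h
    exact h1 ▸ Or.inr ⟨P, hP, rfl⟩

theorem psi_invOn_phi (X : SelfCrossing) : Set.InvOn X.psi X.phi X.source X.target := by
  constructor
  · rintro _ (⟨P, hP, rfl⟩ | ⟨P, hP, rfl⟩)
    · exact (phi1_spec hP).2.2
    · exact (phi56_spec hP).2.2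
  · intro Q hQ
    by_cases h : (X.splicePositions Q).Nonempty
    · obtain ⟨P, -, h1, h2⟩ := psi_spec hQ h
      rw [h1]; exact h2
    · obtain ⟨P, -, h1, h2⟩ := psi_spec_of_not_nonempty hQ h
      rw [h1]; exact h2

end SelfCrossing
end SnakeCalculus

theorem mainTheorem3 (X : SnakeCalculus.SelfCrossing) :
    Set.BijOn X.phi X.source X.target ∧ Set.InvOn X.psi X.phi X.source X.target ∧
      ∀ Q ∈ X.target, (X.splicePositions Q).Nonempty ↔
        ¬∃ P ∈ X.G56.matchings, Q = X.phi (Sum.inr P) := by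
  refine ⟨X.psi_invOn_phi.bijOn X.phi_mapsTo X.psi_mapsTo, X.psi_invOn_phi, fun Q hQ => ?_⟩
  constructor
  · rintro h ⟨P, hP, rfl⟩
    exact (SnakeCalculus.SelfCrossing.phi56_spec hP).2.1 h
  · intro h
    by_contra h1
    obtain ⟨P, hP, -, h2⟩ := SnakeCalculus.SelfCrossing.psi_spec_of_not_nonempty hQ h1
    exact h ⟨P, hP, h2.symm⟩
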